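/- Let $k$ be a field, let $\mathcal T$ be a smooth curve over $k$ (a scheme smooth of relative dimension $1$ over $k$), let $\mathbb P=\mathbb P(a_0,\dots,a_s)$ be a weighted projective space with positive integer weights, and fix $D=\mathbb P(a_0,\dots,a_d)=(x_{d+1}=\dots=x_s=0)\subset\mathbb P$ for some $d\le s-2$. Conventions. A closed subscheme of $\mathbb P\times\mathcal T$ is given by its homogeneous coordinate ring: over each affine open $\operatorname{Spec}A\subset\mathcal T$ a homogeneous ideal $I\subset A[x_0,\dots,x_s]$, compatibly with restriction; it is flat over $\mathcal T$ if all the rings $A[x]/I$ are flat over $A$; its fibre over $t\in\mathcal T$ is given by the image ideal in $\kappa(t)[x_0,\dots,x_s]$. The same conventions apply to $\mathbb P(a_0,\dots,a_s,b)$. For a subscheme $Y\subset\mathbb P$ over a field $K$ with coordinate ring $R=P/I$, $P=K[x_0,\dots,x_s]$, of codimension $c$, "projectively Gorenstein with $\omega_Y=\mathcal O_Y(k_Y)$" means that $R$ is Cohen–Macaulay ($\operatorname{Ext}^i_P(R,P)=0$ for $i\ne c$) and that $\operatorname{Ext}^c_P(R,P(-\sum_i a_i))\cong R(k_Y)$ as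 graded modules. For $D\subset Y$ over a ring $A$, with $R=A[x]/I_Y$ the coordinate ring of $Y$ and $I_D\subset R$ the ideal of $D$, an unprojection of $D\subset Y$ with unprojection variable $S$ of weight $b$ is the subscheme $X\subset\mathbb P(a_0,\dots,a_s,b)$ with coordinate ring $R[S]/(Sf-\varphi(f) : f\in I_D)$, where $\varphi\colon I_D\to R$ is an $R$-homomorphism, homogeneous of degree $b$, which together with the inclusion $I_D\subset R$ generates $\operatorname{Hom}_R(I_D,R)$. Over a base $\mathcal T$, $\mathcal X$ is the unprojection of $D\times\mathcal T\subset\mathcal Y$ if this holds over each affine open of $\mathcal T$. **Lemma.** Let $\mathcal Y\subset\mathbb P\times\mathcal T$ be flat over $\mathcal T$. Suppose that there is an integer $k_Y$ such that for every closed point $t\in\mathcal T$ the fibre $Y_t\subset\mathbb P_{\kappa(t)}$ is projectively Gorenstein with $\omega_{Y_t}=\mathcal O_{Y_t}(k_Y)$, contains $D$, and has $\dim Y_t=\dim D+1=d+1$ (that is, its coordinate ring has Krull dimension $d+2$). Let $b=k_Y-k_D$, where $k_D=-(a_0+\dots+a_d)$, and suppose $b>0$. Then: 1. every closed point of $\mathcal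 T$ has an affine open neighbourhood over which an unprojection of $D\times\mathcal T\subset\mathcal Y$ with unprojection variable of weight $b$ exists; 2. if $\mathcal X\subset\mathbb P(a_0,\dots,a_s,b)\times\mathcal T$ is the unprojection of $D\times\mathcal T\subset\mathcal Y$, then $\mathcal X$ is flat over $\mathcal T$, and for every closed point $t\in\mathcal T$ the fibre $X_t$ is the unprojection of $D\subset Y_t$. -/

import Mathlib

open AlgebraicGeometry

universe u v

noncomputable section

namespace WeightedProj

section Graded

variable {A : Type u} [CommRing A] {σ : Type v}

/-- The weights `a i` of the variables, as integers. -/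
def wt (a : σ → ℕ) : σ → ℤ := fun i => (a i : ℤ)

/-- `p` is homogeneous of degree `m` when the variable `x_i` has weight `a i`. The zero polynomial
is homogeneous of every degree, and it is the only one of negative degree. -/
abbrev IsHomog (a : σ → ℕ) (p : MvPolynomial σ A) (m : ℤ) : Prop :=
  MvPolynomial.IsWeightedHomogeneous (wt a) p m

/-- An ideal that contains the weighted homogeneous components of its elements. -/
def IsHomogIdeal (a : σ → ℕ) (I : Ideal (MvPolynomial σ A)) : Prop :=
  ∀ p ∈ I, ∀ m : ℤ, MvPolynomial.weightedHomogeneousComponent (wt a) m p ∈ I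

end Graded

section Gorenstein

variable {K : Type u} [Field K] {σ : Type v}

/-- A graded free resolution `⋯ → F₂ → F₁ → F₀ = P → P/I → 0` of the graded module `P/I` over the
weighted polynomial ring `P = K[x_i]`, with `F_i = ⨁_q P(-deg i q)` of finite rank and
`d i : F_{i+1} → F_i` homogeneous of degree `0`. -/
structure GradedFreeResolution (a : σ → ℕ) (I : Ideal (MvPolynomial σ K)) where
  rank : ℕ → ℕ
  deg : (i : ℕ) → Fin (rank i) → ℤ
  d : (i : ℕ) → Matrix (Fin (rank i)) (Fin (rank (i + 1))) (MvPolynomial σ K)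
  homog : ∀ i p q, IsHomog a (d i p q) (deg (i + 1) q - deg i p)
  rank_zero : rank 0 = 1
  deg_zero : ∀ p, deg 0 p = 0
  exact_zero : ∀ x : Fin (rank 0) → MvPolynomial σ K,
    x ∈ LinearMap.range (d 0).mulVecLin ↔ ∀ p, x p ∈ I
  exact_succ : ∀ i, Function.Exact (d (i + 1)).mulVecLin (d i).mulVecLin

namespace GradedFreeResolution

variable {a : σ → ℕ} {I : Ideal (MvPolynomial σ K)} (F : GradedFreeResolution a I)

/-- The cocycles of the dual complex `Hom_P(F_i, P)`. -/
def cocycles (i : ℕ) : Submodule (MvPolynomial σ K) (Fin (F.rank i) → MvPolynomial σ K) :=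
  LinearMap.ker (F.d i).vecMulLinear

/-- The coboundaries of the dual complex, so that `Ext^i_P(P/I, P) = cocycles i / coboundaries i`. -/
def coboundaries :
    (i : ℕ) → Submodule (MvPolynomial σ K) (Fin (F.rank i) → MvPolynomial σ K)
  | 0 => ⊥
  | j + 1 => LinearMap.range (F.d j).vecMulLinear

end GradedFreeResolution

/-- The subscheme `Y` of the weighted projective space `ℙ(a)` with homogeneous coordinate ring
`R = P/I` is projectively Gorenstein with `ω_Y = 𝒪_Y(k)`. Writing `c` for the codimension of `R` and
`ω_P = P(-∑ a i)` for the graded canonical module of `P`, this says that `R` is Cohen-Macaulay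
(`Ext^i_P(R, P) = 0` for `i ≠ c`) and that `ω_R = Ext^c_P(R, ω_P)` is isomorphic to `R(k)` as a
graded module. The class of `v` is the image of `1 ∈ R(k)`, an element of degree `-k`: as a
homomorphism `F_c → P(-∑ a i)` of degree `-k` it maps the basis element `q` to a form `v q` of
degree `deg c q - ∑ a i - k`. -/
def IsProjGorenstein [Fintype σ] (a : σ → ℕ) (I : Ideal (MvPolynomial σ K)) (k : ℤ) : Prop :=
  ∃ (F : GradedFreeResolution a I) (c : ℕ),
    ringKrullDim (MvPolynomial σ K ⧸ I) + (c : WithBot ℕ∞) = (Fintype.card σ : WithBot ℕ∞) ∧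
    (∀ i, i ≠ c → F.cocycles i = F.coboundaries i) ∧
    ∃ v ∈ F.cocycles c,
      (∀ q, IsHomog a (v q) (F.deg c q - ∑ i, (a i : ℤ) - k)) ∧
      F.cocycles c = Submodule.span (MvPolynomial σ K) {v} ⊔ F.coboundaries c ∧
      ∀ p : MvPolynomial σ K, p • v ∈ F.coboundaries c ↔ p ∈ I

end Gorenstein

section Unprojection

variable {A : Type u} [CommRing A] {σ : Type v}

/-- The ideal of `D` in the coordinate ring `A[x]/I_Y` of `Y`. -/
abbrev idealIn (IY ID : Ideal (MvPolynomial σ A)) : Ideal (MvPolynomial σ A ⧸ IY) :=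
  ID.map (Ideal.Quotient.mk IY)

/-- A homomorphism `φ : I_D → R = A[x]/I_Y`, homogeneous of degree `b`, that generates
`Hom_R(I_D, R)` together with the inclusion `I_D ⊂ R`. -/
structure IsUnprojectionHom (a : σ → ℕ) (IY ID : Ideal (MvPolynomial σ A)) (b : ℕ)
    (φ : idealIn IY ID →ₗ[MvPolynomial σ A ⧸ IY] (MvPolynomial σ A ⧸ IY)) : Prop where
  homog : ∀ (m : ℤ) (f : idealIn IY ID),
    (∃ p, IsHomog a p m ∧ Ideal.Quotient.mk IY p = f) →
      ∃ g, IsHomog a g (m + b) ∧ Ideal.Quotient.mk IY g = φ f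
  generates : Submodule.span (MvPolynomial σ A ⧸ IY) {(idealIn IY ID).subtype, φ} = ⊤

/-- The ideal of the unprojection in `A[x, S]`, where `S` is the variable `none`: it is generated by
`I_Y` and all `S f - g` with `f ∈ I_D` and `g` a representative of `φ f`. -/
def unprojectionIdeal (IY ID : Ideal (MvPolynomial σ A))
    (φ : idealIn IY ID →ₗ[MvPolynomial σ A ⧸ IY] (MvPolynomial σ A ⧸ IY)) :
    Ideal (MvPolynomial (Option σ) A) :=
  IY.map (MvPolynomial.rename (R := A) (some : σ → Option σ)) ⊔
    Ideal.span {r | ∃ (f : MvPolynomial σ A) (hf : f ∈ ID) (g : MvPolynomial σ A),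
      Ideal.Quotient.mk IY g =
        φ ⟨Ideal.Quotient.mk IY f, Ideal.mem_map_of_mem (Ideal.Quotient.mk IY) hf⟩ ∧
      r = MvPolynomial.X none * MvPolynomial.rename some f - MvPolynomial.rename some g}

/-- `J ⊂ A[x, S]` defines the (Kustin-Miller, type I) unprojection of `D ⊂ Y`, with unprojection
variable `S` of weight `b`. -/
def IsUnprojection (a : σ → ℕ) (IY ID : Ideal (MvPolynomial σ A)) (b : ℕ)
    (J : Ideal (MvPolynomial (Option σ) A)) : Prop :=
  ∃ φ, IsUnprojectionHom a IY ID b φ ∧ J = unprojectionIdeal IY ID φ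

/-- The weights of `ℙ(a_0, …, a_s, b)`, the variable `none` having weight `b`. -/
def extendWeights (a : σ → ℕ) (b : ℕ) : Option σ → ℕ := fun o => o.elim b a

end Unprojection

/-- The ideal `(x_{d+1}, …, x_s)` of `D = ℙ(a_0, …, a_d)` in `A[x_0, …, x_s]`. -/
def coordIdeal (A : Type u) [CommRing A] (s d : ℕ) : Ideal (MvPolynomial (Fin (s + 1)) A) :=
  Ideal.span {p | ∃ i : Fin (s + 1), d < (i : ℕ) ∧ p = MvPolynomial.X i}

section Family

/-- A closed subscheme of `ℙ(a) × T`, given by its sheaf of homogeneous ideals in `𝒪_T[x_i]`: a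
homogeneous ideal over each affine open of `T`, compatible with restriction. -/
structure Family (T : Scheme.{u}) {σ : Type v} (a : σ → ℕ) where
  ideal : ∀ U : T.affineOpens, Ideal (MvPolynomial σ Γ(T, U))
  homog : ∀ U, IsHomogIdeal a (ideal U)
  map_ideal_basicOpen : ∀ (U : T.affineOpens) (f : Γ(T, U)),
    (ideal U).map (MvPolynomial.map
      (T.presheaf.map (CategoryTheory.homOfLE (T.basicOpen_le f)).op).hom) =
      ideal (T.affineBasicOpen f)

namespace Family

variable {T : Scheme.{u}} {σ : Type v} {a : σ → ℕ} (Z : Family T a)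

/-- The coordinate rings are flat over the base. -/
def IsFlat : Prop :=
  ∀ U : T.affineOpens, Module.Flat Γ(T, U) (MvPolynomial σ Γ(T, U) ⧸ Z.ideal U)

/-- The homogeneous ideal of the fibre over `t`, in the polynomial ring over the residue field of
`t`: the extension of the ideal over an affine neighbourhood `U` of `t` (all `U` give the same). -/
def fibreIdeal (t : T) : Ideal (MvPolynomial σ (T.residueField t)) :=
  ⨆ (U : T.affineOpens) (h : t ∈ U.1),
    (Z.ideal U).map (MvPolynomial.map (T.evaluation U.1 t h).hom)

end Family

end Family

end WeightedProj

end

/-! The mechanism is Kustin–Miller adjunction, made explicit so that it can be lifted from a fibre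
to the base. On one fibre let `P` be the polynomial ring, `R = P/I` the coordinate ring of `Y`, of
codimension `m + 1`, and `x` the `n = m + 2` equations of `D`. The dual of a free resolution of `R`
has cohomology only in degree `m + 1`, where it is `ω_R ≅ R`, generated by the class of `v`. The
Koszul complex of `x` has cohomology only in degree `n`, where it is `O_D = P/(x)`. Comparing both
in their double complex, one finds nothing in total degree `m + 1`, so no non-zero element of `R` is
killed by `I_D`, and in total degree `n` an isomorphism `H¹(x; R) ≅ O_D`, because `I ⊂ (x)`.
Homomorphisms `I_D → R` are tuples with `x_i r_j = x_j r_i` in `R`, so `H¹(x; R) = Hom(I_D, R)/R`.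
Hence `Hom(I_D, R)` is generated by the inclusion and one `φ` that corresponds to `1 ∈ O_D`, and
counting degrees gives `b = k_Y - k_D`. A `Staircase` is a zigzag in this double complex; the
carrying lemmas are `exists_compatible_isJoined`, `exists_of_compatible` and
`mem_of_forall_mul_mem`.

A closed point of a smooth curve has an affine neighbourhood `Spec A` on which its ideal is
generated by a regular element `t`, which stays regular on `A[x]/I` by flatness. After localisation
at `1 + t A[x]`, the resolution of the fibre and the structure of its dual lift by Nakayama, and so
does `φ`; denominators are `1` modulo `t` and can be cleared without changing the reduction
(`exists_compatible_lift`). A homogeneous component of the lift has degree `b`, and graded Nakayama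
shows that it generates over `A` after one element `1 + tc` of `A` is inverted
(`exists_unprojection_tuple`). This is the first claim. Given any other generator over the base,
this lift is a combination of it and the inclusion; the same holds after reduction, so the other
generator also reduces to a generator on the fibre (`IsUnprojectionHom.isUnprojection_map`).

Flatness needs no generation property: the relations `S f = φ(f)` bring every element to a normal
form in `R ⊕ ⨁_{j ≥ 1} S^j O_D`, so the coordinate ring of `X` is an `A`-linear retract of a flat
module (`flat_unprojectionIdeal`). That `D × T` lies in `Y` follows from the closed fibres because
`T` is reduced and Jacobson. -/

set_option linter.unusedSectionVars false

/-! ### Koszul complexes -/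

/-- The underlying module of the Koszul complex on `n` elements with coefficients in `M`, as an
iterated mapping cone. -/
def Kos (M : Type*) : ℕ → Type _
  | 0 => M
  | n + 1 => Kos M n × Kos M n

namespace Kos

instance instAddCommGroup (M : Type*) [AddCommGroup M] : ∀ n, AddCommGroup (Kos M n)
  | 0 => inferInstanceAs (AddCommGroup M)
  | n + 1 =>
    letI := instAddCommGroup M n
    inferInstanceAs (AddCommGroup (Kos M n × Kos M n))

instance instModule (S M : Type*) [CommRing S] [AddCommGroup M] [Module S M] :
    ∀ n, Module S (Kos M n)
  | 0 => inferInstanceAs (Module S M)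
  | n + 1 =>
    letI := instModule S M n
    inferInstanceAs (Module S (Kos M n × Kos M n))

section Basic

variable {S M N L : Type*} [CommRing S] [AddCommGroup M] [AddCommGroup N] [AddCommGroup L]
  [Module S M]

/-- Build an element of the cone from its two components. -/
def pair {n : ℕ} (a b : Kos M n) : Kos M (n + 1) := (a, b)

theorem exists_pair {n : ℕ} (y : Kos M (n + 1)) : ∃ a b, y = pair a b := ⟨y.1, y.2, rfl⟩

theorem pair_inj {n : ℕ} {a b a' b' : Kos M n} : pair a b = pair a' b' ↔ a = a' ∧ b = b' :=
  Prod.mk.injEq _ _ _ _ ▸ Iff.rfl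

theorem pair_add {n : ℕ} (a b a' b' : Kos M n) :
    pair a b + pair a' b' = pair (a + a') (b + b') := rfl

theorem pair_sub {n : ℕ} (a b a' b' : Kos M n) :
    pair a b - pair a' b' = pair (a - a') (b - b') := rfl

theorem smul_pair {n : ℕ} (s : S) (a b : Kos M n) : s • pair a b = pair (s • a) (s • b) := rfl

theorem pair_eq_zero {n : ℕ} {a b : Kos M n} : pair a b = 0 ↔ a = 0 ∧ b = 0 := pair_inj

/-- Functoriality of the underlying group. -/
def map (f : M →+ N) : ∀ n, Kos M n →+ Kos N n
  | 0 => f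
  | n + 1 => (map f n).prodMap (map f n)

theorem map_pair (f : M →+ N) {n : ℕ} (a b : Kos M n) :
    map f (n + 1) (pair a b) = pair (map f n a) (map f n b) := rfl

theorem map_map (f : M →+ N) (g : N →+ L) : ∀ {n : ℕ} (y : Kos M n),
    map g n (map f n y) = map (g.comp f) n y
  | 0, _ => rfl
  | n + 1, y => by
    obtain ⟨a, b, rfl⟩ := exists_pair y
    simp only [map_pair, map_map]

theorem map_zero_hom : ∀ {n : ℕ} (y : Kos M n), map (0 : M →+ N) n y = 0
  | 0, _ => rfl
  | n + 1, y => by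
    obtain ⟨a, b, rfl⟩ := exists_pair y
    rw [map_pair, map_zero_hom a, map_zero_hom b]; rfl

theorem map_smul [Module S N] (f : M →+ N) (s : S) (hf : ∀ m, f (s • m) = s • f m) :
    ∀ {n : ℕ} (y : Kos M n), map f n (s • y) = s • map f n y
  | 0, y => hf y
  | n + 1, y => by
    obtain ⟨a, b, rfl⟩ := exists_pair y
    simp only [map_pair, smul_pair, map_smul f s hf]

/-- The Koszul differential. -/
def d (x : ℕ → S) : ∀ n, Kos M n → Kos M n
  | 0, _ => (0 : M)
  | n + 1, y => pair (d x n y.1) (x n • y.1 - d x n y.2)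

theorem d_pair (x : ℕ → S) {n : ℕ} (a b : Kos M n) :
    d x (n + 1) (pair a b) = pair (d x n a) (x n • a - d x n b) := rfl

theorem d_add (x : ℕ → S) : ∀ {n : ℕ} (y z : Kos M n), d x n (y + z) = d x n y + d x n z
  | 0, _, _ => (add_zero (0 : M)).symm
  | n + 1, y, z => by
    obtain ⟨a, b, rfl⟩ := exists_pair y
    obtain ⟨a', b', rfl⟩ := exists_pair z
    simp only [pair_add, d_pair, d_add x (n := n), smul_add]
    congr 1; abel

theorem d_smul (x : ℕ → S) (s : S) : ∀ {n : ℕ} (y : Kos M n), d x n (s • y) = s • d x n y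
  | 0, _ => (smul_zero (A := M) s).symm
  | n + 1, y => by
    obtain ⟨a, b, rfl⟩ := exists_pair y
    simp only [smul_pair, d_pair, d_smul x s (n := n), smul_sub, smul_comm s (x n)]

theorem d_zero (x : ℕ → S) {n : ℕ} : d x n (0 : Kos M n) = 0 := by
  simpa using d_smul x (0 : S) (0 : Kos M n)

theorem d_sub (x : ℕ → S) {n : ℕ} (y z : Kos M n) : d x n (y - z) = d x n y - d x n z := by
  rw [sub_eq_add_neg, d_add, ← neg_one_smul S z, d_smul, neg_one_smul, ← sub_eq_add_neg]

theorem d_d (x : ℕ → S) : ∀ {n : ℕ} (y : Kos M n), d x n (d x n y) = 0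
  | 0, _ => rfl
  | n + 1, y => by
    obtain ⟨a, b, rfl⟩ := exists_pair y
    simp only [d_pair, d_d x (n := n), d_sub, d_smul, sub_zero, sub_self]; rfl

theorem map_d {S' : Type*} [CommRing S'] [Module S' N] (f : M →+ N) (x : ℕ → S) (x' : ℕ → S') :
    ∀ {n : ℕ} (_ : ∀ i < n, ∀ m, f (x i • m) = x' i • f m) (y : Kos M n),
      map f n (d x n y) = d x' n (map f n y)
  | 0, _, _ => f.map_zero
  | n + 1, h, y => by
    have key : ∀ {k : ℕ} (y : Kos M k), map f k (x n • y) = x' n • map f k y := by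
      intro k
      induction k with
      | zero => exact fun y => h n (Nat.lt_succ_self n) y
      | succ k ih =>
        intro y
        obtain ⟨a, b, rfl⟩ := exists_pair y
        simp only [map_pair, smul_pair, ih]
    obtain ⟨a, b, rfl⟩ := exists_pair y
    simp only [map_pair, d_pair, map_sub, key,
      map_d f x x' (n := n) fun i hi => h i (Nat.lt_succ_of_lt hi)]

/-- Homogeneous elements of cohomological degree `q`. -/
def Deg : ∀ n : ℕ, ℤ → Kos M n → Prop
  | 0, q, y => q ≠ 0 → y = (0 : M)
  | n + 1, q, y => Deg n q y.1 ∧ Deg n (q - 1) y.2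

theorem deg_pair {n : ℕ} {q : ℤ} {a b : Kos M n} :
    Deg (n + 1) q (pair a b) ↔ Deg n q a ∧ Deg n (q - 1) b := Iff.rfl

theorem Deg.zero : ∀ {n : ℕ} {q : ℤ}, Deg n q (0 : Kos M n)
  | 0, _ => fun _ => rfl
  | n + 1, _ => ⟨Deg.zero (n := n), Deg.zero (n := n)⟩

theorem Deg.add : ∀ {n : ℕ} {q : ℤ} {y z : Kos M n}, Deg n q y → Deg n q z → Deg n q (y + z)
  | 0, _, y, z, hy, hz => fun h => by
    have h1 : y = 0 := hy h
    have h2 : z = 0 := hz h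
    rw [h1, h2, add_zero]; rfl
  | n + 1, q, y, z, hy, hz => ⟨Deg.add (n := n) hy.1 hz.1, Deg.add (n := n) hy.2 hz.2⟩

theorem Deg.smul (s : S) : ∀ {n : ℕ} {q : ℤ} {y : Kos M n}, Deg n q y → Deg n q (s • y)
  | 0, _, y, hy => fun h => by
    have h1 : y = 0 := hy h
    rw [h1, smul_zero]; rfl
  | n + 1, q, y, hy => ⟨Deg.smul s (n := n) hy.1, Deg.smul s (n := n) hy.2⟩

theorem Deg.sub {n : ℕ} {q : ℤ} {y z : Kos M n} (hy : Deg n q y) (hz : Deg n q z) :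
    Deg n q (y - z) := by
  have := Deg.add hy (Deg.smul (-1 : ℤ) hz)
  rwa [neg_one_smul, ← sub_eq_add_neg] at this

theorem Deg.map (f : M →+ N) : ∀ {n : ℕ} {q : ℤ} {y : Kos M n}, Deg n q y → Deg n q (map f n y)
  | 0, _, y, hy => fun h => by
    have h1 : y = 0 := hy h
    rw [h1, map_zero]; rfl
  | n + 1, q, y, hy => ⟨Deg.map f (n := n) hy.1, Deg.map f (n := n) hy.2⟩

theorem Deg.d (x : ℕ → S) : ∀ {n : ℕ} {q : ℤ} {y : Kos M n}, Deg n q y → Deg n (q + 1) (d x n y)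
  | 0, _, _, _ => fun _ => rfl
  | n + 1, q, y, hy => by
    obtain ⟨a, b, rfl⟩ := exists_pair y
    rw [deg_pair] at hy
    rw [d_pair, deg_pair, add_sub_cancel_right]
    refine ⟨Deg.d x hy.1, Deg.sub (Deg.smul _ hy.1) ?_⟩
    simpa using Deg.d x hy.2

theorem Deg.eq_zero_of_neg : ∀ {n : ℕ} {q : ℤ} {y : Kos M n}, Deg n q y → q < 0 → y = 0
  | 0, _, _, hy, h => hy h.ne
  | n + 1, q, y, hy, h => by
    obtain ⟨a, b, rfl⟩ := exists_pair y
    rw [deg_pair] at hy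
    rw [Deg.eq_zero_of_neg hy.1 h, Deg.eq_zero_of_neg hy.2 (by omega)]; rfl

theorem Deg.eq_zero_of_lt : ∀ {n : ℕ} {q : ℤ} {y : Kos M n}, Deg n q y → n < q → y = 0
  | 0, _, _, hy, h => hy (by push_cast at h; omega)
  | n + 1, q, y, hy, h => by
    obtain ⟨a, b, rfl⟩ := exists_pair y
    rw [deg_pair] at hy
    push_cast at h
    rw [Deg.eq_zero_of_lt hy.1 (by omega), Deg.eq_zero_of_lt hy.2 (by omega)]; rfl

/-- The inclusion of the part of degree `0`. -/
def ι₀ : ∀ n, M → Kos M n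
  | 0, m => m
  | n + 1, m => pair (ι₀ n m) 0

/-- The inclusion of the part of degree `1`. -/
def ι₁ : ∀ n, (ℕ → M) → Kos M n
  | 0, _ => (0 : M)
  | n + 1, r => pair (ι₁ n r) (ι₀ n (r n))

/-- The inclusion of the part of top degree. -/
def top : ∀ n, M → Kos M n
  | 0, m => m
  | n + 1, m => pair 0 (top n m)

theorem exists_ι₀ : ∀ {n : ℕ} {y : Kos M n}, Deg n 0 y → ∃ m, y = ι₀ n m
  | 0, y, _ => ⟨y, rfl⟩
  | n + 1, y, hy => by
    obtain ⟨a, b, rfl⟩ := exists_pair y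
    obtain ⟨m, rfl⟩ := exists_ι₀ hy.1
    exact ⟨m, pair_inj.2 ⟨rfl, hy.2.eq_zero_of_neg (by omega)⟩⟩

theorem ι₁_congr : ∀ {n : ℕ} {r r' : ℕ → M}, (∀ i < n, r i = r' i) → ι₁ n r = ι₁ n r'
  | 0, _, _, _ => rfl
  | n + 1, r, r', h => pair_inj.2
    ⟨ι₁_congr fun i hi => h i (Nat.lt_succ_of_lt hi), by rw [h n (Nat.lt_succ_self n)]⟩

theorem exists_ι₁ : ∀ {n : ℕ} {y : Kos M n}, Deg n 1 y → ∃ r, y = ι₁ n r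
  | 0, y, hy => ⟨0, hy one_ne_zero⟩
  | n + 1, y, hy => by
    obtain ⟨a, b, rfl⟩ := exists_pair y
    obtain ⟨r, hr⟩ := exists_ι₁ hy.1
    obtain ⟨m, hm⟩ := exists_ι₀ (n := n) (y := b) hy.2
    refine ⟨fun i => if i = n then m else r i, pair_inj.2 ⟨?_, ?_⟩⟩
    · exact hr.trans (ι₁_congr fun i hi => by simp [hi.ne])
    · simpa using hm

theorem exists_top : ∀ {n : ℕ} {y : Kos M n}, Deg n n y → ∃ m, y = top n m
  | 0, y, _ => ⟨y, rfl⟩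
  | n + 1, y, hy => by
    obtain ⟨a, b, rfl⟩ := exists_pair y
    obtain ⟨m, hm⟩ := exists_top (n := n) (y := b) (by simpa [deg_pair] using (deg_pair.1 hy).2)
    exact ⟨m, pair_inj.2 ⟨hy.1.eq_zero_of_lt (by push_cast; omega), hm⟩⟩

theorem deg_top : ∀ {n : ℕ} (m : M), Deg n n (top n m)
  | 0, _ => fun h => absurd rfl h
  | n + 1, m => deg_pair.2 ⟨Deg.zero, by simpa using deg_top m⟩

theorem deg_ι₀ : ∀ {n : ℕ} (m : M), Deg n 0 (ι₀ n m)
  | 0, _ => fun h => absurd rfl h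
  | n + 1, m => ⟨deg_ι₀ (n := n) m, Deg.zero (n := n)⟩

theorem deg_ι₁ : ∀ {n : ℕ} (r : ℕ → M), Deg n 1 (ι₁ n r)
  | 0, _ => fun _ => rfl
  | n + 1, r => ⟨deg_ι₁ (n := n) r, deg_ι₀ (n := n) _⟩

theorem map_ι₀ (f : M →+ N) : ∀ {n : ℕ} (m : M), map f n (ι₀ n m) = ι₀ n (f m)
  | 0, _ => rfl
  | n + 1, m => by rw [ι₀, map_pair, map_ι₀ f, map_zero]; rfl

theorem map_ι₁ (f : M →+ N) : ∀ {n : ℕ} (r : ℕ → M), map f n (ι₁ n r) = ι₁ n (fun i => f (r i))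
  | 0, _ => f.map_zero
  | n + 1, r => by rw [ι₁, map_pair, map_ι₁ f, map_ι₀]; rfl

theorem map_top (f : M →+ N) : ∀ {n : ℕ} (m : M), map f n (top n m) = top n (f m)
  | 0, _ => rfl
  | n + 1, m => by rw [top, map_pair, map_top f, map_zero]; rfl

theorem ι₀_inj : ∀ {n : ℕ} {m m' : M}, ι₀ n m = ι₀ n m' → m = m'
  | 0, _, _, h => h
  | _ + 1, _, _, h => ι₀_inj (pair_inj.1 h).1

theorem ι₁_inj : ∀ {n : ℕ} {r r' : ℕ → M}, ι₁ n r = ι₁ n r' → ∀ i < n, r i = r' i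
  | 0, _, _, _ => fun i hi => absurd hi (Nat.not_lt_zero i)
  | n + 1, r, r', h => fun i hi => by
    rcases Nat.lt_succ_iff_lt_or_eq.1 hi with hi | rfl
    · exact ι₁_inj (pair_inj.1 h).1 i hi
    · exact ι₀_inj (pair_inj.1 h).2

theorem ι₀_smul (s : S) : ∀ {n : ℕ} (m : M), ι₀ n (s • m) = s • ι₀ n m
  | 0, _ => rfl
  | n + 1, m => by rw [ι₀, ι₀_smul s, ι₀, smul_pair, smul_zero]

theorem ι₀_sub : ∀ {n : ℕ} (m m' : M), ι₀ n (m - m') = ι₀ n m - ι₀ n m'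
  | 0, _, _ => rfl
  | n + 1, m, m' => by rw [ι₀, ι₀_sub, ι₀, ι₀, pair_sub, sub_zero]

theorem ι₀_zero : ∀ {n : ℕ}, ι₀ n (0 : M) = 0
  | 0 => rfl
  | n + 1 => by rw [ι₀, ι₀_zero]; rfl

theorem ι₁_sub : ∀ {n : ℕ} (r r' : ℕ → M), ι₁ n (fun i => r i - r' i) = ι₁ n r - ι₁ n r'
  | 0, _, _ => (sub_zero (0 : M)).symm
  | n + 1, r, r' => by rw [ι₁, ι₁_sub, ι₁, ι₁, pair_sub, ι₀_sub]

theorem ι₁_smul (s : S) : ∀ {n : ℕ} (r : ℕ → M), ι₁ n (fun i => s • r i) = s • ι₁ n r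
  | 0, _ => (smul_zero (A := M) s).symm
  | n + 1, r => by rw [ι₁, ι₁_smul s, ι₁, smul_pair, ι₀_smul]

theorem top_smul (s : S) : ∀ {n : ℕ} (m : M), top n (s • m) = s • top n m
  | 0, _ => rfl
  | n + 1, m => by rw [top, top_smul s, top, smul_pair, smul_zero]

theorem top_sub : ∀ {n : ℕ} (m m' : M), top n (m - m') = top n m - top n m'
  | 0, _, _ => rfl
  | n + 1, m, m' => by rw [top, top_sub, top, top, pair_sub, sub_zero]

theorem top_inj : ∀ {n : ℕ} {m m' : M}, top n m = top n m' → m = m'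
  | 0, _, _, h => h
  | _ + 1, _, _, h => top_inj (pair_inj.1 h).2

theorem d_ι₀ (x : ℕ → S) : ∀ {n : ℕ} (m : M), d x n (ι₀ n m) = ι₁ n fun i => x i • m
  | 0, _ => rfl
  | n + 1, m => by
    rw [ι₀, d_pair, d_ι₀ x, d_zero, sub_zero, ι₁, ι₀_smul]

theorem d_ι₁_pair (x : ℕ → S) {n : ℕ} (r : ℕ → M) : d x (n + 1) (ι₁ (n + 1) r) =
    pair (d x n (ι₁ n r)) (ι₁ n fun i => x n • r i - x i • r n) := by
  rw [ι₁, d_pair, d_ι₀, ι₁_sub (fun i => x n • r i), ι₁_smul]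

/-- All components of `y` lie in the image of `f`. -/
theorem exists_map_eq_of_map_eq_zero {f : M →+ N} {g : N →+ L}
    (hfg : ∀ y, g y = 0 → ∃ x, f x = y) : ∀ {n : ℕ} {q : ℤ} {y : Kos N n}, Deg n q y →
      map g n y = 0 → ∃ y', Deg n q y' ∧ map f n y' = y
  | 0, q, y, hy, h => by
    by_cases hq : q = 0
    · obtain ⟨x, hx⟩ := hfg y h
      exact ⟨x, fun h => absurd hq h, hx⟩
    · exact ⟨0, Deg.zero, (map_zero _).trans (hy hq).symm⟩
  | n + 1, q, y, hy, h => by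
    obtain ⟨a, b, rfl⟩ := exists_pair y
    rw [deg_pair] at hy
    rw [map_pair, pair_eq_zero] at h
    obtain ⟨a', ha, rfl⟩ := exists_map_eq_of_map_eq_zero hfg hy.1 h.1
    obtain ⟨b', hb, rfl⟩ := exists_map_eq_of_map_eq_zero hfg hy.2 h.2
    exact ⟨pair a' b', ⟨ha, hb⟩, rfl⟩

theorem exists_map_eq_ι₁ {f : M →+ N} {n : ℕ} {r : ℕ → N} (h : ∀ i < n, ∃ m, f m = r i) :
    ∃ y', Deg n 1 y' ∧ map f n y' = ι₁ n r := by
  choose! r' hr' using h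
  exact ⟨ι₁ n r', deg_ι₁ _, (map_ι₁ _ _).trans (ι₁_congr hr')⟩

theorem exists_of_map_eq_ι₀ {f : M →+ N} : ∀ {n : ℕ} {y : Kos M n} {m : N},
    map f n y = ι₀ n m → ∃ m', f m' = m
  | 0, y, _, h => ⟨y, h⟩
  | _ + 1, _, _, h => exists_of_map_eq_ι₀ (pair_inj.1 h).1

theorem exists_of_map_eq_ι₁ {f : M →+ N} : ∀ {n : ℕ} {y : Kos M n} {r : ℕ → N},
    map f n y = ι₁ n r → ∀ i < n, ∃ m, f m = r i
  | 0, _, _, _ => fun i hi => absurd hi (Nat.not_lt_zero i)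
  | n + 1, _, r, h => fun i hi => by
    rcases Nat.lt_succ_iff_lt_or_eq.1 hi with hi | rfl
    · exact exists_of_map_eq_ι₁ (pair_inj.1 h).1 i hi
    · exact exists_of_map_eq_ι₀ (pair_inj.1 h).2

/-- The components of `d (ι₁ r)` are, up to sign, the minors `x i • r j - x j • r i`; a lift in
Koszul degree `2` thus encodes the compatibility of the values of a homomorphism. -/
theorem exists_of_map_eq_d_ι₁ [Module S N] {f : M →+ N} (x : ℕ → S) : ∀ {n : ℕ} {y : Kos M n} {r : ℕ → N},
    map f n y = d x n (ι₁ n r) → ∀ i < n, ∀ j < n, ∃ m, f m = x i • r j - x j • r i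
  | 0, _, _, _ => fun i hi => absurd hi (Nat.not_lt_zero i)
  | n + 1, y, r, h => by
    obtain ⟨a, b, rfl⟩ := exists_pair y
    rw [map_pair, d_ι₁_pair, pair_inj] at h
    have h1 := exists_of_map_eq_d_ι₁ x h.1
    have h2 := exists_of_map_eq_ι₁ h.2
    intro i hi j hj
    rcases Nat.lt_succ_iff_lt_or_eq.1 hi with hi | rfl
    · rcases Nat.lt_succ_iff_lt_or_eq.1 hj with hj | rfl
      · exact h1 i hi j hj
      · obtain ⟨m, hm⟩ := h2 i hi
        exact ⟨-m, by rw [map_neg, hm, neg_sub]⟩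
    · rcases Nat.lt_succ_iff_lt_or_eq.1 hj with hj | rfl
      · exact h2 j hj
      · exact ⟨0, by rw [map_zero, sub_self]⟩

theorem exists_map_eq_d_ι₁ [Module S N] {f : M →+ N} (x : ℕ → S) : ∀ {n : ℕ} {r : ℕ → N},
    (∀ i < n, ∀ j < n, ∃ m, f m = x i • r j - x j • r i) →
      ∃ y', Deg n 2 y' ∧ map f n y' = d x n (ι₁ n r)
  | 0, _, _ => ⟨0, Deg.zero, map_zero _⟩
  | n + 1, r, h => by
    obtain ⟨a, ha, ha'⟩ := exists_map_eq_d_ι₁ x (n := n) (r := r) fun i hi j hj =>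
      h i (Nat.lt_succ_of_lt hi) j (Nat.lt_succ_of_lt hj)
    obtain ⟨b, hb, hb'⟩ := exists_map_eq_ι₁ (f := f) (n := n)
      (r := fun i => x n • r i - x i • r n) fun i hi => h n (Nat.lt_succ_self n) i (Nat.lt_succ_of_lt hi)
    refine ⟨pair a b, ⟨ha, hb⟩, ?_⟩
    rw [map_pair, d_ι₁_pair, ha', hb']

end Basic

/-! ### Exactness of the Koszul complex on a regular sequence. -/

section Exact

variable {S M : Type*} [CommRing S] [AddCommGroup M] [Module S M]

/-- `m` is a combination of `x 0, …, x (n - 1)`. -/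
def InSpan (x : ℕ → S) : ℕ → M → Prop
  | 0, m => m = 0
  | n + 1, m => ∃ a b, InSpan x n b ∧ m = x n • a + b

/-- Multiplication by `x i` is injective on `M / (x 0, …, x (i - 1)) M` for `i < n`. -/
def WeaklyRegular (M : Type*) [AddCommGroup M] [Module S M] (x : ℕ → S) (n : ℕ) : Prop :=
  ∀ i < n, ∀ m : M, InSpan x i (x i • m) → InSpan x i m

theorem InSpan.neg {x : ℕ → S} : ∀ {n : ℕ} {m : M}, InSpan x n m → InSpan x n (-m)
  | 0, m, h => by rw [InSpan] at h ⊢; rw [h, neg_zero]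
  | n + 1, _, ⟨a, b, hb, rfl⟩ => ⟨-a, -b, hb.neg, by rw [smul_neg, neg_add]⟩

/-- With `inSpan_of_d_eq_top` this identifies the top Koszul cohomology with `M / (x 0, …, x (n -
1)) M`. -/
theorem exists_d_eq_top {x : ℕ → S} : ∀ {n : ℕ} {m : M}, InSpan x n m →
    ∃ y : Kos M n, Deg n (n - 1 : ℤ) y ∧ d x n y = top n m
  | 0, m, h => ⟨0, Deg.zero, by rw [InSpan] at h; rw [h]; rfl⟩
  | n + 1, _, ⟨a, b, hb, rfl⟩ => by
    obtain ⟨y, hy, hyb⟩ := exists_d_eq_top (x := x) (InSpan.neg hb)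
    refine ⟨pair (top n a) y, deg_pair.2 ⟨?_, ?_⟩, ?_⟩
    · simpa using deg_top a
    · simpa using hy
    · have h0 : d x n (top n a) = 0 :=
        ((deg_top a).d x).eq_zero_of_lt (by omega)
      have h1 : top n (x n • a + b) = top n (x n • a) - top n (-b) := by
        rw [← top_sub, sub_neg_eq_add]
      rw [d_pair, h0, hyb, top, h1, top_smul]

theorem inSpan_of_d_eq_top {x : ℕ → S} : ∀ {n : ℕ} {y : Kos M n} {m : M}, d x n y = top n m →
    Deg n (n - 1 : ℤ) y → InSpan x n m
  | 0, _, _, h, _ => h.symm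
  | n + 1, y, m, h, hd => by
    obtain ⟨a, b, rfl⟩ := exists_pair y
    rw [deg_pair] at hd
    obtain ⟨a', rfl⟩ := exists_top (n := n) (y := a) (by simpa using hd.1)
    have hb : Deg n (n - 1 : ℤ) b := by simpa using hd.2
    obtain ⟨b', hb'⟩ := exists_top (n := n) (y := d x n b) (by simpa using hb.d x)
    rw [d_pair, top, pair_inj, hb', ← top_smul, ← top_sub] at h
    refine ⟨a', -b', (inSpan_of_d_eq_top hb' hb).neg, ?_⟩
    rw [← sub_eq_add_neg]
    exact (top_inj h.2).symm

/-- The Koszul complex of a weakly regular sequence is exact below the top degree. -/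
theorem exists_d_eq {x : ℕ → S} : ∀ {n : ℕ}, WeaklyRegular M x n → ∀ {q : ℤ}, q ≠ n →
    ∀ {y : Kos M n}, Deg n q y → d x n y = 0 → ∃ y', Deg n (q - 1) y' ∧ d x n y' = y
  | 0, _, q, hq, y, hy, _ => ⟨0, Deg.zero, (hy (by simpa using hq)).symm⟩
  | n + 1, hx, q, hq, y, hy, h => by
    have hx' : WeaklyRegular M x n := fun i hi => hx i (Nat.lt_succ_of_lt hi)
    obtain ⟨a, b, rfl⟩ := exists_pair y
    rw [deg_pair] at hy
    rw [d_pair, pair_eq_zero, sub_eq_zero] at h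
    -- Only `q = n` escapes the induction hypothesis: there `a` is a top class killed by `x n`
    -- modulo boundaries, and regularity of `x n` makes it a boundary.
    obtain ⟨a', ha', rfl⟩ : ∃ a', Deg n (q - 1) a' ∧ d x n a' = a := by
      by_cases hqn : q = n
      · subst hqn
        obtain ⟨m, rfl⟩ := exists_top hy.1
        rw [← top_smul] at h
        exact exists_d_eq_top (hx n (Nat.lt_succ_self n) m (inSpan_of_d_eq_top h.2.symm hy.2))
      · exact exists_d_eq hx' hqn hy.1 h.1
    have hc : d x n (x n • a' - b) = 0 := by rw [d_sub, d_smul, h.2, sub_self]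
    obtain ⟨b', hb', hbb⟩ := exists_d_eq hx' (q := q - 1) (by push_cast at hq; omega)
      ((ha'.smul (x n)).sub hy.2) hc
    refine ⟨pair a' b', ⟨ha', hb'⟩, ?_⟩
    rw [d_pair, hbb, sub_sub_cancel]

theorem InSpan.pi {x : ℕ → S} {ι : Type*} : ∀ {n : ℕ} {m : ι → S},
    InSpan x n m ↔ ∀ p, InSpan x n (m p)
  | 0, _ => funext_iff
  | n + 1, m => by
    refine ⟨fun ⟨a, b, hb, h⟩ p => ⟨a p, b p, InSpan.pi.1 hb p, by rw [h]; rfl⟩, fun h => ?_⟩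
    choose a b hb h using h
    exact ⟨a, b, InSpan.pi.2 hb, funext h⟩

theorem WeaklyRegular.pi {x : ℕ → S} {n : ℕ} (h : WeaklyRegular S x n) (ι : Type*) :
    WeaklyRegular (ι → S) x n :=
  fun i hi m hm => InSpan.pi.2 fun p => h i hi _ (InSpan.pi.1 hm p)

theorem inSpan_iff {x : ℕ → S} : ∀ {n : ℕ} {m : S},
    InSpan x n m ↔ m ∈ Ideal.span (x '' {i | i < n})
  | 0, _ => by simp [InSpan]
  | n + 1, m => by
    have : x '' {i | i < n + 1} = insert (x n) (x '' {i | i < n}) := by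
      rw [← Set.image_insert_eq]; congr 1; ext i; simp; omega
    rw [this, Ideal.mem_span_insert]
    constructor
    · rintro ⟨a, b, hb, rfl⟩
      exact ⟨a, b, inSpan_iff.1 hb, by rw [smul_eq_mul, mul_comm]⟩
    · rintro ⟨a, b, hb, rfl⟩
      exact ⟨a, b, inSpan_iff.2 hb, by rw [smul_eq_mul, mul_comm]⟩

end Exact

end Kos

/-! ### Duals of free resolutions of Gorenstein type -/

section Gorenstein

variable {S : Type*} [CommRing S]

/-- The differential of the dual of a complex of finite free modules, given by matrices. -/
def dualD {rank : ℕ → ℕ} (D : ∀ i, Matrix (Fin (rank i)) (Fin (rank (i + 1))) S) (i : ℕ) :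
    (Fin (rank i) → S) →+ (Fin (rank (i + 1)) → S) :=
  (D i).vecMulLinear.toAddMonoidHom

/-- The complex dual to `D` starts with `S`, is exact except in degree `m + 1`, where its cohomology
is `S / I`, generated by the class of `v`. -/
structure IsGorensteinDual (I : Ideal S) (rank : ℕ → ℕ)
    (D : ∀ i, Matrix (Fin (rank i)) (Fin (rank (i + 1))) S) (m : ℕ)
    (v : Fin (rank (m + 1)) → S) : Prop where
  rank_zero : rank 0 = 1
  entries : ∀ p q, D 0 p q ∈ I
  comp : ∀ i y, dualD D (i + 1) (dualD D i y) = 0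
  inj : ∀ y, dualD D 0 y = 0 → y = 0
  exact : ∀ i, i ≠ m → ∀ y, dualD D (i + 1) y = 0 → ∃ x, dualD D i x = y
  closed : dualD D (m + 1) v = 0
  gen : ∀ y, dualD D (m + 1) y = 0 → ∃ (p : S) (x : _), y = p • v + dualD D m x
  ann : ∀ p : S, (∃ x, dualD D m x = p • v) ↔ p ∈ I

theorem dualD_smul {rank : ℕ → ℕ} (D : ∀ i, Matrix (Fin (rank i)) (Fin (rank (i + 1))) S) (i : ℕ)
    (s : S) (y : Fin (rank i) → S) : dualD D i (s • y) = s • dualD D i y :=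
  _root_.map_smul (D i).vecMulLinear s y

variable {rank : ℕ → ℕ} (D : ∀ i, Matrix (Fin (rank i)) (Fin (rank (i + 1))) S) (x : ℕ → S) (n : ℕ)

open Kos in
/-- `y` is joined to the top class of `z` by a staircase in the double complex of the dual of `D`
and the Koszul complex of `x`. -/
def Staircase : ∀ i, Kos (Fin (rank i) → S) n → (Fin (rank 0) → S) → Prop
  | 0, y, z => y = top n z
  | i + 1, y, z => Deg n (n - (i + 1 : ℕ) : ℤ) y ∧
      ∃ y', Staircase i y' z ∧ Kos.map (dualD D i) n y' = Kos.d x n y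

open Kos

variable {D x n}

theorem dualD_d (i : ℕ) (y : Kos (Fin (rank i) → S) n) :
    Kos.map (dualD D i) n (Kos.d x n y) = Kos.d x n (Kos.map (dualD D i) n y) :=
  map_d _ x x (fun _ _ _ => dualD_smul D i _ _) y

theorem Staircase.sub : ∀ {i : ℕ} {y₁ y₂ : Kos (Fin (rank i) → S) n} {z₁ z₂ : Fin (rank 0) → S},
    Staircase D x n i y₁ z₁ → Staircase D x n i y₂ z₂ → Staircase D x n i (y₁ - y₂) (z₁ - z₂)
  | 0, _, _, _, _, h₁, h₂ => by rw [Staircase] at *; rw [h₁, h₂, top_sub]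
  | _ + 1, _, _, _, _, ⟨h₁, y₁, hy₁, e₁⟩, ⟨h₂, y₂, hy₂, e₂⟩ =>
    ⟨h₁.sub h₂, y₁ - y₂, hy₁.sub hy₂, by rw [map_sub, e₁, e₂, d_sub]⟩

theorem Staircase.smul (s : S) : ∀ {i : ℕ} {y : Kos (Fin (rank i) → S) n} {z : Fin (rank 0) → S},
    Staircase D x n i y z → Staircase D x n i (s • y) (s • z)
  | 0, _, _, h => by rw [Staircase] at *; rw [h, top_smul]
  | i + 1, _, _, ⟨h, y, hy, e⟩ => ⟨h.smul s, s • y, hy.smul s, by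
      rw [Kos.map_smul _ s (dualD_smul D i s), e, d_smul]⟩

variable {I : Ideal S} {m : ℕ} {v : Fin (rank (m + 1)) → S}

namespace IsGorensteinDual

theorem map_map_eq_zero (h : IsGorensteinDual I rank D m v) (i : ℕ)
    (y : Kos (Fin (rank i) → S) n) :
    Kos.map (dualD D (i + 1)) n (Kos.map (dualD D i) n y) = 0 := by
  rw [map_map]
  have : (dualD D (i + 1)).comp (dualD D i) = 0 := AddMonoidHom.ext fun y => h.comp i y
  rw [this, map_zero_hom]

/-- Below degree `m` the dual complex is exact, so each Koszul differential is the image of an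
element one row lower, whose own Koszul differential is again a cocycle. Row `0` is reached exactly
in the top Koszul degree. -/
theorem exists_staircase (h : IsGorensteinDual I rank D m v) : ∀ {i : ℕ}, i ≤ m →
    ∀ {y : Kos (Fin (rank i) → S) n}, Deg n (n - i : ℤ) y →
      Kos.map (dualD D i) n (Kos.d x n y) = 0 → ∃ z, Staircase D x n i y z
  | 0, _, y, hy, _ => exists_top (by simpa using hy)
  | i + 1, hi, y, hy, hd => by
    have h1 : Deg n (n - i : ℤ) (Kos.d x n y) := by
      have := hy.d x
      rwa [show (n - (i + 1 : ℕ) : ℤ) + 1 = n - i by push_cast; ring] at this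
    obtain ⟨y', hy', e⟩ := exists_map_eq_of_map_eq_zero (h.exact i (by omega)) h1 hd
    obtain ⟨z, hz⟩ := h.exists_staircase (i := i) (by omega) hy' (by rw [dualD_d, e, d_d])
    exact ⟨z, hy, y', hz, e⟩

/-- A staircase that ends at a combination of the variables is a boundary. -/
theorem exists_of_staircase (h : IsGorensteinDual I rank D m v) (hx : WeaklyRegular S x n) :
    ∀ {i : ℕ} {y : Kos (Fin (rank i) → S) n} {z : Fin (rank 0) → S}, Staircase D x n i y z →
      InSpan x n z → ∃ η, Deg n (n - i - 1 : ℤ) η ∧ Kos.map (dualD D i) n (y - Kos.d x n η) = 0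
  | 0, _, z, hy, hz => by
    obtain ⟨η, hη, e⟩ := exists_d_eq_top hz
    rw [Staircase] at hy
    exact ⟨η, by simpa using hη, by rw [e, hy, sub_self, map_zero]⟩
  | i + 1, y, z, ⟨hy, y', hy', e⟩, hz => by
    obtain ⟨η, hη, e'⟩ := h.exists_of_staircase hx hy' hz
    rw [map_sub, sub_eq_zero, dualD_d, e] at e'
    have hη' : Deg n (n - (i + 1 : ℕ) : ℤ) (Kos.map (dualD D i) n η) := by
      have := hη.map (dualD D i)
      rwa [show (n - i - 1 : ℤ) = n - (i + 1 : ℕ) by push_cast; ring] at this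
    obtain ⟨θ, hθ, e''⟩ := exists_d_eq (hx.pi _) (by push_cast; omega) (hy.sub hη')
      (by rw [d_sub, e', sub_self])
    exact ⟨θ, hθ, by rw [e'', sub_sub_cancel, h.map_map_eq_zero]⟩

/-- Below the anti-diagonal `n` of the double complex every partial cocycle is a boundary. -/
theorem exists_of_deg_lt (h : IsGorensteinDual I rank D m v) (hx : WeaklyRegular S x n) :
    ∀ {i : ℕ}, i ≤ m → ∀ {q : ℤ}, q + i < n → ∀ {y : Kos (Fin (rank i) → S) n}, Deg n q y →
      Kos.map (dualD D i) n (Kos.d x n y) = 0 →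
      ∃ η, Deg n (q - 1) η ∧ Kos.map (dualD D i) n (y - Kos.d x n η) = 0
  | 0, _, q, hq, y, hy, hd => by
    obtain ⟨w, -, hw⟩ := exists_map_eq_of_map_eq_zero (f := (0 : (Fin (rank 0) → S) →+ _))
      (g := dualD D 0) (fun y hy => ⟨0, (h.inj y hy).symm⟩) (hy.d x) hd
    rw [map_zero_hom] at hw
    obtain ⟨η, hη, e⟩ := exists_d_eq (hx.pi _) (by push_cast at hq; omega) hy hw.symm
    exact ⟨η, hη, by rw [e, sub_self, map_zero]⟩
  | i + 1, hi, q, hq, y, hy, hd => by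
    push_cast at hq
    obtain ⟨y', hy', e⟩ := exists_map_eq_of_map_eq_zero (h.exact i (by omega)) (hy.d x) hd
    obtain ⟨η, hη, e'⟩ := h.exists_of_deg_lt hx (i := i) (by omega) (by omega) hy'
      (by rw [dualD_d, e, d_d])
    rw [map_sub, sub_eq_zero, dualD_d, e] at e'
    rw [add_sub_cancel_right] at hη
    obtain ⟨θ, hθ, e''⟩ := exists_d_eq (hx.pi _) (by omega) (hy.sub (hη.map (dualD D i)))
      (by rw [d_sub, e', sub_self])
    exact ⟨θ, hθ, by rw [e'', sub_sub_cancel, h.map_map_eq_zero]⟩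

/-- The annihilator of `(x 0, …, x (n - 1))` in `S / I` is zero. -/
theorem mem_of_forall_mul_mem (h : IsGorensteinDual I rank D m v) (hx : WeaklyRegular S x n)
    (hn : m + 1 < n) {f : S} (hf : ∀ j < n, x j * f ∈ I) : f ∈ I := by
  obtain ⟨y, hy, e⟩ : ∃ y, Deg n 1 y ∧ Kos.map (dualD D m) n y = Kos.d x n (ι₀ n (f • v)) := by
    rw [d_ι₀]
    exact exists_map_eq_ι₁ fun j hj => by simpa [smul_smul] using (h.ann _).2 (hf j hj)
  -- Total degree `m + 1` lies below the diagonal `n`, so `y` can be replaced by the Koszul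
  -- differential of some `η` of degree `0`. The difference of `f • v` and the image of `η` is then
  -- a Koszul cocycle of degree `0`, hence zero.
  obtain ⟨η, hη, e'⟩ := h.exists_of_deg_lt hx le_rfl (by omega) hy (by rw [dualD_d, e, d_d])
  rw [map_sub, sub_eq_zero, dualD_d, e] at e'
  obtain ⟨θ, hθ, e''⟩ := exists_d_eq (hx.pi _) (by omega)
    ((deg_ι₀ (f • v)).sub (hη.map (dualD D m))) (by rw [d_sub, e', sub_self])
  rw [hθ.eq_zero_of_neg (by omega), d_zero] at e''
  obtain ⟨w, rfl⟩ := exists_ι₀ hη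
  rw [map_ι₀, eq_comm, sub_eq_zero] at e''
  exact (h.ann f).1 ⟨w, (ι₀_inj e'').symm⟩

end IsGorensteinDual

/-- The residues of `r j` modulo `I` are the values at `x j` of a homomorphism on
`(x 0, …, x (n - 1))`. -/
def IsCompatible (I : Ideal S) (x : ℕ → S) (n : ℕ) (r : ℕ → S) : Prop :=
  ∀ i < n, ∀ j < n, x i * r j - x j * r i ∈ I

variable (D x n v) in
/-- The multiples `r j • v` of the dualizing class are joined to the top class of `z` by a staircase,
up to coboundaries. -/
def IsJoined (r : ℕ → S) (z : Fin (rank 0) → S) : Prop :=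
  ∃ β : ℕ → Fin (rank m) → S,
    Staircase D x n (m + 1) (ι₁ n fun j => r j • v + dualD D m (β j)) z

theorem IsJoined.sub_smul {r r' : ℕ → S} {z z' : Fin (rank 0) → S} (h : IsJoined D x n v r z)
    (h' : IsJoined D x n v r' z') (s : S) :
    IsJoined D x n v (fun j => r j - s * r' j) (z - s • z') := by
  obtain ⟨β, hβ⟩ := h
  obtain ⟨β', hβ'⟩ := h'
  refine ⟨fun j => β j - s • β' j, ?_⟩
  have := hβ.sub (hβ'.smul s)
  rw [← ι₁_smul, ← ι₁_sub] at this
  convert! this using 3 with j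
  rw [map_sub, dualD_smul, _root_.sub_smul, mul_smul, smul_add]
  abel

namespace IsGorensteinDual

/-- As `I` kills the class of `v`, the minors of a compatible tuple times `v` are coboundaries; this
starts a descent, whose end `z` is the class of the homomorphism in `O_D`. -/
theorem exists_isJoined (h : IsGorensteinDual I rank D m v) (hn : n = m + 2) {r : ℕ → S}
    (hr : IsCompatible I x n r) : ∃ z, IsJoined D x n v r z := by
  obtain ⟨y, hy, e⟩ : ∃ y, Deg n 2 y ∧
      Kos.map (dualD D m) n y = Kos.d x n (ι₁ n fun j => r j • v) :=
    exists_map_eq_d_ι₁ x fun i hi j hj => by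
      simpa [smul_smul, sub_smul] using (h.ann _).2 (hr i hi j hj)
  obtain ⟨z, hz⟩ := h.exists_staircase (i := m) le_rfl (x := x) (y := y)
    (by rwa [show (n - m : ℤ) = 2 by omega]) (by rw [dualD_d, e, d_d])
  refine ⟨z, 0, ?_, y, hz, ?_⟩
  · rw [show (n - (m + 1 : ℕ) : ℤ) = 1 by omega]
    exact deg_ι₁ _
  · simpa using e

/-- This is injectivity of `Hom(I_D, R)/R → O_D`: a tuple whose class vanishes is, modulo `I`,
multiplication by some `p`. -/
theorem exists_of_isJoined (h : IsGorensteinDual I rank D m v) (hx : WeaklyRegular S x n)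
    (hn : n = m + 2) {r : ℕ → S} {z : Fin (rank 0) → S} (hr : IsJoined D x n v r z)
    (hz : InSpan x n z) : ∃ p, ∀ j < n, r j - p * x j ∈ I := by
  obtain ⟨β, hd, y, hy, e⟩ := hr
  obtain ⟨η, hη, e'⟩ := h.exists_of_staircase hx hy hz
  rw [map_sub, sub_eq_zero, dualD_d, e] at e'
  have h1 := hη.map (dualD D m)
  rw [show (n - m - 1 : ℤ) = 1 by omega] at hη h1
  rw [show (n - (m + 1 : ℕ) : ℤ) = 1 by omega] at hd
  obtain ⟨θ, hθ, e''⟩ := exists_d_eq (hx.pi _) (by omega) (hd.sub h1) (by rw [d_sub, e', sub_self])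
  obtain ⟨w, rfl⟩ := exists_ι₀ hθ
  obtain ⟨γ, rfl⟩ := exists_ι₁ hη
  rw [map_ι₁, ← ι₁_sub, d_ι₀] at e''
  have e3 := ι₁_inj e''
  -- The products `x j • w` differ from multiples of `v` by coboundaries, so every `x j` kills the
  -- image of `w`. Koszul exactness in degree `0` makes this image zero, and `w` becomes `p • v`
  -- plus a coboundary.
  have hw : dualD D (m + 1) w = 0 := by
    have e4 : ∀ j < n, x j • dualD D (m + 1) w = 0 := fun j hj => by
      rw [← dualD_smul, e3 j hj, map_sub, map_add, h.comp, h.comp, dualD_smul, h.closed]; simp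
    have e5 : Kos.d x n (ι₀ n (dualD D (m + 1) w)) = 0 := by
      rw [d_ι₀, ι₁_congr (r' := fun _ => 0) e4]
      simpa using ι₁_smul (0 : S) (n := n) fun _ => (0 : Fin (rank (m + 1 + 1)) → S)
    obtain ⟨θ', hθ', e6⟩ := exists_d_eq (hx.pi _) (by omega) (deg_ι₀ _) e5
    rw [hθ'.eq_zero_of_neg (by omega), d_zero] at e6
    exact ι₀_inj (e6.symm.trans ι₀_zero.symm)
  obtain ⟨p, x', rfl⟩ := h.gen w hw
  refine ⟨p, fun j hj => (h.ann _).1 ⟨x j • x' + γ j - β j, ?_⟩⟩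
  have e4 := e3 j hj
  rw [map_sub, map_add, dualD_smul, sub_smul, mul_comm, mul_smul]
  rw [smul_add] at e4
  rw [← sub_eq_zero] at e4 ⊢
  rw [← e4]
  abel

/-- The Kustin-Miller homomorphism. -/
theorem exists_compatible_isJoined (h : IsGorensteinDual I rank D m v) (hx : WeaklyRegular S x n)
    (hn : n = m + 2) (hI : ∀ p ∈ I, InSpan x n p) :
    ∃ r, IsCompatible I x n r ∧ IsJoined D x n v r fun _ => 1 := by
  -- The staircase is climbed from `1` in row `0`: the image of each step in the next row is Koszul
  -- closed below the top degree, hence a Koszul boundary.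
  have key : ∀ i : ℕ, ∃ y : Kos (Fin (rank i) → S) n, Staircase D x n i y (fun _ => 1) ∧
      ∃ y₁, Deg n (n - (i + 1 : ℕ) : ℤ) y₁ ∧ Kos.d x n y₁ = Kos.map (dualD D i) n y := by
    intro i
    induction i with
    | zero =>
      refine ⟨top n fun _ => 1, rfl, ?_⟩
      rw [Kos.map_top]
      -- In the top degree closedness does not suffice; the first step exists because the entries of
      -- `D 0` lie in `I ⊂ (x)`.
      have : InSpan x n (dualD D 0 fun _ => 1) := InSpan.pi.2 fun q => by
        refine hI _ ?_
        change Matrix.vecMul (fun _ => 1) (D 0) q ∈ I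
        rw [Matrix.vecMul, dotProduct]
        exact Ideal.sum_mem _ fun p _ => Ideal.mul_mem_left _ _ (h.entries p q)
      simpa using exists_d_eq_top this
    | succ i ih =>
      obtain ⟨y, hy, y₁, hy₁, e⟩ := ih
      refine ⟨y₁, ⟨hy₁, y, hy, e.symm⟩, ?_⟩
      obtain ⟨y₂, hy₂, e₂⟩ := exists_d_eq (hx.pi _) (by push_cast; omega)
        (hy₁.map (dualD D (i + 1))) (by rw [← dualD_d, e, h.map_map_eq_zero])
      refine ⟨y₂, ?_, e₂⟩
      rwa [show (n - (i + 1 + 1 : ℕ) : ℤ) = n - (i + 1 : ℕ) - 1 by push_cast; ring]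
  obtain ⟨y, hy, y₁, hy₁, e⟩ := key (m + 1)
  rw [show (n - (m + 1 + 1 : ℕ) : ℤ) = 0 by omega] at hy₁
  obtain ⟨w, rfl⟩ := exists_ι₀ hy₁
  -- A Koszul primitive of this element would have degree `-1`.
  have hw : dualD D (m + 1 + 1) w = 0 := by
    obtain ⟨y₂, hy₂, e₂⟩ := exists_d_eq (hx.pi _) (by omega)
        (hy₁.map (dualD D (m + 1 + 1))) (by rw [← dualD_d, e, h.map_map_eq_zero])
    rw [hy₂.eq_zero_of_neg (by omega), d_zero, map_ι₀] at e₂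
    exact ι₀_inj (e₂.symm.trans ι₀_zero.symm)
  -- Exactness beyond degree `m + 1` allows `y` to be corrected by `d (ι₀ w')`, after which its
  -- components `ρ j` are cocycles, that is, multiples `r j • v` up to coboundaries.
  obtain ⟨w', rfl⟩ := h.exact (m + 1) (by omega) w hw
  obtain ⟨hyd, y', hy', e'⟩ := hy
  rw [show (n - (m + 1 : ℕ) : ℤ) = 1 by omega] at hyd
  have hdeg : Deg n 1 (Kos.d x n (ι₀ n w')) := by simpa using (deg_ι₀ (n := n) w').d x
  obtain ⟨ρ, hρ⟩ := exists_ι₁ (hyd.sub hdeg)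
  have hc : ∀ j < n, dualD D (m + 1) (ρ j) = 0 := by
    have : Kos.map (dualD D (m + 1)) n (ι₁ n ρ) = 0 := by
      rw [← hρ, map_sub, dualD_d, map_ι₀, e, sub_self]
    rw [map_ι₁] at this
    refine ι₁_inj (r' := fun _ => 0) (this.trans ?_)
    simpa using (ι₁_smul (0 : S) (n := n) fun _ => (0 : Fin (rank (m + 1 + 1)) → S)).symm
  choose! r β hr using fun j hj => h.gen _ (hc j hj)
  have hst : Staircase D x n (m + 1) (ι₁ n fun j => r j • v + dualD D m (β j)) fun _ => 1 := by
    rw [← ι₁_congr hr, ← hρ]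
    refine ⟨?_, y', hy', by rw [d_sub, d_d, sub_zero, e']⟩
    rw [show (n - (m + 1 : ℕ) : ℤ) = 1 by omega]
    exact hyd.sub hdeg
  refine ⟨r, ?_, β, hst⟩
  -- The next step of the staircase shows that the minors of `r` times `v` are coboundaries, so they
  -- lie in `I`.
  obtain ⟨-, y₃, -, e₃⟩ := hst
  intro i hi j hj
  obtain ⟨a, ha⟩ := exists_of_map_eq_d_ι₁ x e₃ i hi j hj
  refine (h.ann _).1 ⟨a - x i • β j + x j • β i, ?_⟩
  rw [map_add, map_sub, ha, dualD_smul, dualD_smul, _root_.sub_smul, mul_smul, mul_smul, smul_add,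
    smul_add]
  abel

/-- Homomorphisms are generated by the inclusion and the Kustin-Miller homomorphism. -/
theorem exists_of_compatible (h : IsGorensteinDual I rank D m v) (hx : WeaklyRegular S x n)
    (hn : n = m + 2) {r₀ r : ℕ → S} (hr₀ : IsJoined D x n v r₀ fun _ => 1)
    (hr : IsCompatible I x n r) : ∃ p s, ∀ j < n, r j - (p * x j + s * r₀ j) ∈ I := by
  obtain ⟨z, hz⟩ := h.exists_isJoined hn hr
  have : Subsingleton (Fin (rank 0)) := by rw [h.rank_zero]; infer_instance
  -- Row `0` has rank one, so subtracting the entry of `z` times `r₀` leaves a tuple whose staircase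
  -- ends at `0`.
  obtain ⟨p, hp⟩ := h.exists_of_isJoined hx hn
    (hz.sub_smul hr₀ (z ⟨0, by rw [h.rank_zero]; exact one_pos⟩)) (InSpan.pi.2 fun q => by
      rw [inSpan_iff, Subsingleton.elim q ⟨0, by rw [h.rank_zero]; exact one_pos⟩]
      simp)
  refine ⟨p, z ⟨0, by rw [h.rank_zero]; exact one_pos⟩, fun j hj => ?_⟩
  convert hp j hj using 1
  ring

end IsGorensteinDual

end Gorenstein

/-! ### Lifting along the reduction modulo a nonzerodivisor in the Jacobson radical -/

section Lift

variable {S P : Type*} [CommRing S] [CommRing P]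

/-- `ρ` is the reduction of a Noetherian ring modulo a nonzerodivisor `t` in its Jacobson
radical. -/
structure IsLocalReduction (ρ : S →+* P) (t : S) : Prop where
  noeth : IsNoetherianRing S
  mem_jacobson : t ∈ Ideal.jacobson (⊥ : Ideal S)
  regular : ∀ s : S, t * s = 0 → s = 0
  surj : Function.Surjective ρ
  ker : ∀ s, ρ s = 0 ↔ ∃ s', s = t * s'

namespace IsLocalReduction

variable {ρ : S →+* P} {t : S} (h : IsLocalReduction ρ t)

include h

/-- Nakayama's lemma: an inclusion of submodules may be checked modulo `t`. -/
theorem le_of_forall {M : Type*} [AddCommGroup M] [Module S M] [Module.Finite S M]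
    {N N' : Submodule S M} (hN : ∀ y ∈ N, ∃ x ∈ N', ∃ z ∈ N, y = x + t • z) : N ≤ N' := by
  have := h.noeth
  refine Submodule.le_of_le_smul_of_le_jacobson_bot (I := Ideal.span {t})
    (IsNoetherian.noetherian N) ?_ ?_
  · rw [Ideal.span_singleton_le_iff_mem]
    exact h.mem_jacobson
  · intro y hy
    obtain ⟨x, hx, z, hz, rfl⟩ := hN y hy
    exact Submodule.add_mem_sup hx (Submodule.smul_mem_smul (Ideal.mem_span_singleton_self t) hz)

theorem exists_lift {ι : Type*} (y : ι → P) : ∃ y' : ι → S, (fun p => ρ (y' p)) = y := by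
  choose y' hy' using fun p => h.surj (y p)
  exact ⟨y', funext hy'⟩

theorem exists_eq_smul {ι : Type*} {y : ι → S} (hy : ∀ p, ρ (y p) = 0) : ∃ z, y = t • z := by
  choose z hz using fun p => (h.ker _).1 (hy p)
  exact ⟨z, funext hz⟩

theorem map_t : ρ t = 0 := (h.ker t).2 ⟨1, (mul_one t).symm⟩

theorem smul_eq_zero {ι : Type*} {y : ι → S} (hy : t • y = 0) : y = 0 :=
  funext fun p => h.regular _ (congrFun hy p)

variable {ι κ l : Type*} [Finite κ] {f : (ι → S) →ₗ[S] (κ → S)} {f' : (ι → P) →ₗ[P] (κ → P)}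
  {g : (κ → S) →ₗ[S] (l → S)} {g' : (κ → P) →ₗ[P] (l → P)}

omit [Finite κ] in
theorem exists_add_smul (hf : ∀ y p, ρ (f y p) = f' (fun i => ρ (y i)) p) {y : κ → S}
    (hy : ∃ x', f' x' = fun p => ρ (y p)) : ∃ x z, y = f x + t • z := by
  obtain ⟨x', hx'⟩ := hy
  obtain ⟨x, rfl⟩ := h.exists_lift x'
  obtain ⟨z, hz⟩ := h.exists_eq_smul (y := y - f x) fun p => by
    rw [Pi.sub_apply, _root_.map_sub, hf, hx', sub_self]
  exact ⟨x, z, by rw [← hz, add_sub_cancel]⟩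

/-- A cycle is a boundary plus `t • z`, where `z` is again a cycle because `t` is regular; Nakayama
concludes. -/
theorem exact_of_exact (hf : ∀ y p, ρ (f y p) = f' (fun i => ρ (y i)) p)
    (hg : ∀ y p, ρ (g y p) = g' (fun i => ρ (y i)) p) (hfg : ∀ x, g (f x) = 0)
    (he : ∀ y, g' y = 0 → ∃ x, f' x = y) {y : κ → S} (hy : g y = 0) : ∃ x, f x = y := by
  have : LinearMap.ker g ≤ LinearMap.range f := h.le_of_forall fun y hy => by
    obtain ⟨x, z, rfl⟩ := h.exists_add_smul hf (y := y) (he _ (by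
      funext p; rw [← hg, LinearMap.mem_ker.1 hy, Pi.zero_apply, map_zero]; rfl))
    refine ⟨f x, ⟨x, rfl⟩, z, h.smul_eq_zero ?_, rfl⟩
    rwa [LinearMap.mem_ker, map_add, hfg, zero_add, map_smul] at hy
  exact this hy

omit [Finite κ] in
-- Any lift `y₁` of a cycle has `g y₁ = t • z`. If the image of `g` is saturated, `z = g y₂`, and
-- `y₁ - t • y₂` is a cycle with the same reduction.
theorem exists_lift_ker (hg : ∀ y p, ρ (g y p) = g' (fun i => ρ (y i)) p)
    (hs : ∀ z, (∃ y, g y = t • z) → ∃ y, g y = z) {y : κ → P} (hy : g' y = 0) :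
    ∃ y' : κ → S, g y' = 0 ∧ (fun p => ρ (y' p)) = y := by
  obtain ⟨y₁, rfl⟩ := h.exists_lift y
  obtain ⟨z, hz⟩ := h.exists_eq_smul (y := g y₁) fun p => by rw [hg, hy]; rfl
  obtain ⟨y₂, rfl⟩ := hs z ⟨y₁, hz⟩
  refine ⟨y₁ - t • y₂, by rw [_root_.map_sub, map_smul, hz, sub_self], funext fun p => ?_⟩
  simp [h.map_t]

omit [Finite κ] in
-- Exactness of the reduction at the source of `g` makes the cokernel of `g` free of `t`-torsion,
-- which is what `exists_lift_ker` needs.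
theorem saturated_of_exact (hf : ∀ y p, ρ (f y p) = f' (fun i => ρ (y i)) p)
    (hg : ∀ y p, ρ (g y p) = g' (fun i => ρ (y i)) p) (hfg : ∀ x, g (f x) = 0)
    (he : ∀ y, g' y = 0 → ∃ x, f' x = y) (z : l → S) (hz : ∃ y, g y = t • z) :
    ∃ y, g y = z := by
  obtain ⟨y, hy⟩ := hz
  obtain ⟨x, w, rfl⟩ := h.exists_add_smul hf (y := y) (he _ (by
      funext p; rw [← hg, hy]; simp [h.map_t]))
  refine ⟨w, ?_⟩
  rw [map_add, hfg, zero_add, map_smul, ← sub_eq_zero, ← smul_sub] at hy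
  exact sub_eq_zero.1 (h.smul_eq_zero hy)

end IsLocalReduction

theorem map_mulVec_apply (ρ : S →+* P) {ι κ : Type*} [Fintype ι] (D : Matrix κ ι S) (y : ι → S)
    (p : κ) : ρ (D.mulVecLin y p) = (D.map ρ).mulVecLin (fun i => ρ (y i)) p :=
  RingHom.map_mulVec ρ D y p

theorem map_vecMul_apply (ρ : S →+* P) {ι κ : Type*} [Fintype ι] (D : Matrix ι κ S) (y : ι → S)
    (p : κ) : ρ (D.vecMulLinear y p) = (D.map ρ).vecMulLinear (fun i => ρ (y i)) p :=
  RingHom.map_vecMul ρ D y p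

/-- Multiplication by an element of `I` is homotopic to zero on a resolution of `S / I`. -/
theorem exists_vecMul_eq_smul {I : Ideal S} {rank : ℕ → ℕ}
    {D : ∀ i, Matrix (Fin (rank i)) (Fin (rank (i + 1))) S}
    (h0 : ∀ y, (∀ p, y p ∈ I) → ∃ x, (D 0).mulVec x = y)
    (hD : ∀ i, D i * D (i + 1) = 0)
    (hexact : ∀ i y, (D i).mulVec y = 0 → ∃ x, (D (i + 1)).mulVec x = y) {p : S} (hp : p ∈ I)
    (i : ℕ) : ∃ (H : Matrix (Fin (rank (i + 1))) (Fin (rank i)) S)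
      (G : Matrix (Fin (rank i)) (Fin (rank i)) S), D i * H + G = p • (1 : Matrix _ _ S) ∧
        G * D i = 0 ∧ ∀ j (e : i = j + 1) (w : Fin (rank i) → S), ∃ x,
          (D j).vecMul x = fun q => G.vecMul w (Fin.cast (by rw [e]) q) := by
  -- The matrix `G` is the half of the homotopy that factors through the previous differential, and
  -- is `0` for `i = 0`; its transpose therefore lands in the coboundaries.
  induction i with
  | zero =>
    have : ∀ q : Fin (rank 0), ∃ x, (D 0).mulVec x =
        fun p' => (p • (1 : Matrix (Fin (rank 0)) (Fin (rank 0)) S)) p' q := fun q => h0 _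
      fun p' => by
        rw [Matrix.smul_apply, smul_eq_mul]
        exact Ideal.mul_mem_right _ _ hp
    choose H hH using this
    refine ⟨Matrix.of fun a b => H b a, 0, ?_, Matrix.zero_mul _, fun j e => absurd e (by omega)⟩
    rw [add_zero]
    ext a b
    exact congrFun (hH b) a
  | succ i ih =>
    obtain ⟨H, G, hHG, hG, -⟩ := ih
    have h1 : D i * (p • (1 : Matrix (Fin (rank (i + 1))) (Fin (rank (i + 1))) S) - H * D i) = 0 := by
      rw [Matrix.mul_sub, ← Matrix.mul_assoc, eq_sub_of_add_eq hHG, Matrix.sub_mul, hG, sub_zero,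
        Matrix.smul_mul, Matrix.one_mul, Matrix.mul_smul, Matrix.mul_one, sub_self]
    have : ∀ q, ∃ x, (D (i + 1)).mulVec x = fun p' =>
        (p • (1 : Matrix (Fin (rank (i + 1))) (Fin (rank (i + 1))) S) - H * D i) p' q := fun q => hexact i _ (by
      funext a
      exact congrFun (congrFun h1 a) q)
    choose H' hH' using this
    refine ⟨Matrix.of fun a b => H' b a, H * D i, ?_, by rw [Matrix.mul_assoc, hD, Matrix.mul_zero], ?_⟩
    · rw [← eq_sub_iff_add_eq]
      ext a b
      exact congrFun (hH' b) a
    · intro j e w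
      obtain rfl : i = j := by omega
      exact ⟨H.vecMul w, by rw [Matrix.vecMul_vecMul]; rfl⟩

section Resolution

variable {ρ : S →+* P} {t : S} {I : Ideal S} {rank : ℕ → ℕ}

/-- The differentials are lifted one after another, column by column; Nakayama gives exactness at
each stage. -/
theorem IsLocalReduction.exists_lift_resolution (h : IsLocalReduction ρ t)
    (hI : ∀ p, t * p ∈ I → p ∈ I) (d : ∀ i, Matrix (Fin (rank i)) (Fin (rank (i + 1))) P)
    (h0 : ∀ y : Fin (rank 0) → P, y ∈ LinearMap.range (d 0).mulVecLin ↔ ∀ p, y p ∈ I.map ρ)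
    (hexact : ∀ i, Function.Exact (d (i + 1)).mulVecLin (d i).mulVecLin) :
    ∃ D : ∀ i, Matrix (Fin (rank i)) (Fin (rank (i + 1))) S, (∀ i, (D i).map ρ = d i) ∧
      (∀ y : Fin (rank 0) → S, y ∈ LinearMap.range (D 0).mulVecLin ↔ ∀ p, y p ∈ I) ∧
      ∀ i, Function.Exact (D (i + 1)).mulVecLin (D i).mulVecLin := by
  -- Saturation of the image is carried through the recursion, since it is what makes the columns of
  -- the next differential lift to cycles.
  let Q : ∀ i, Matrix (Fin (rank i)) (Fin (rank (i + 1))) S → Prop := fun i D => D.map ρ = d i ∧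
    ∀ z, (∃ y, D.mulVecLin y = t • z) → ∃ y, D.mulVecLin y = z
  have step : ∀ i (D : {D // Q i D}), ∃ D' : {D // Q (i + 1) D},
      Function.Exact D'.1.mulVecLin D.1.mulVecLin := by
    rintro i ⟨D, hD, hs⟩
    have hcol : ∀ q, ∃ y, D.mulVecLin y = 0 ∧ (fun p => ρ (y p)) = fun p => d (i + 1) p q :=
      fun q => h.exists_lift_ker (g' := (D.map ρ).mulVecLin) (map_mulVec_apply ρ D) hs (by
        rw [hD, hexact i]
        exact ⟨Pi.single q 1, by ext; simp⟩)
    choose D' hD' hρ using hcol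
    have hm : (Matrix.of fun a b => D' b a).map ρ = d (i + 1) := by
      ext a b
      exact congrFun (hρ b) a
    have hc : ∀ x, D.mulVecLin ((Matrix.of fun a b => D' b a).mulVecLin x) = 0 := by
      intro x
      have : D * (Matrix.of fun a b => D' b a) = 0 := by
        ext a b
        exact congrFun (hD' b) a
      rw [Matrix.mulVecLin_apply, Matrix.mulVecLin_apply, Matrix.mulVec_mulVec, this,
        Matrix.zero_mulVec]
    have he : Function.Exact (Matrix.of fun a b => D' b a).mulVecLin D.mulVecLin := by
      intro y
      refine ⟨fun hy => ?_, ?_⟩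
      · exact h.exact_of_exact (map_mulVec_apply ρ _) (map_mulVec_apply ρ _) hc
          (fun y hy => by rw [hm]; exact (hexact i y).1 (by rwa [hD] at hy)) hy
      · rintro ⟨x, rfl⟩
        exact hc x
    refine ⟨⟨Matrix.of fun a b => D' b a, hm, fun z hz => ?_⟩, he⟩
    have := (he (t • z)).2 hz
    rw [map_smul] at this
    exact (he z).1 (h.smul_eq_zero this)
  obtain ⟨D₀, hD₀, hr₀⟩ : ∃ D₀, Q 0 D₀ ∧
      ∀ y : Fin (rank 0) → S, y ∈ LinearMap.range D₀.mulVecLin ↔ ∀ p, y p ∈ I := by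
    have hent : ∀ p q, ∃ s ∈ I, ρ s = d 0 p q := fun p q =>
      (Ideal.mem_map_iff_of_surjective ρ h.surj).1
        ((h0 fun p => d 0 p q).1 ⟨Pi.single q 1, by ext; simp⟩ p)
    choose D₀ hD₀ hρ using hent
    have hm : (Matrix.of D₀).map ρ = d 0 := by
      ext a b
      exact hρ a b
    have hmem : ∀ x p, (Matrix.of D₀).mulVecLin x p ∈ I := fun x p => by
      rw [Matrix.mulVecLin_apply, Matrix.mulVec, dotProduct]
      exact Ideal.sum_mem _ fun q _ => Ideal.mul_mem_right _ _ (hD₀ p q)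
    have hr : ∀ y : Fin (rank 0) → S,
        y ∈ LinearMap.range (Matrix.of D₀).mulVecLin ↔ ∀ p, y p ∈ I := by
      intro y
      constructor
      · rintro ⟨x, rfl⟩ p
        exact hmem x p
      · have : Submodule.pi Set.univ (fun _ : Fin (rank 0) => I) ≤
            LinearMap.range (Matrix.of D₀).mulVecLin := h.le_of_forall fun y hy => by
          obtain ⟨x, z, hz⟩ := h.exists_add_smul (map_mulVec_apply ρ (Matrix.of D₀)) (y := y) (by
            rw [hm]
            exact (h0 _).2 fun p => Ideal.mem_map_of_mem ρ (hy p trivial))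
          refine ⟨_, ⟨x, rfl⟩, z, fun p _ => hI _ ?_, hz⟩
          have : t * z p = y p - (Matrix.of D₀).mulVecLin x p := by
            rw [hz]; simp
          rw [this]
          exact I.sub_mem (hy p trivial)
            (hmem x p)
        exact fun hy => this fun p _ => hy p
    exact ⟨Matrix.of D₀, ⟨hm, fun z hz => (hr z).2 fun p => hI _ ((hr _).1 hz p)⟩, hr⟩
  choose next hnext using step
  let D : ∀ i, {D // Q i D} := fun i => Nat.rec ⟨D₀, hD₀⟩ (fun i D => next i D) i
  exact ⟨fun i => (D i).1, fun i => (D i).2.1, hr₀, fun i => hnext i (D i)⟩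

/-- Dualising the lifted resolution gives a lift of the dual complex, so its exactness, the
generator `v` and the annihilator of `v` all lift by Nakayama. -/
theorem IsLocalReduction.exists_lift_dual (h : IsLocalReduction ρ t)
    (hI : ∀ p, t * p ∈ I → p ∈ I) (d : ∀ i, Matrix (Fin (rank i)) (Fin (rank (i + 1))) P)
    (h0 : ∀ y : Fin (rank 0) → P, y ∈ LinearMap.range (d 0).mulVecLin ↔ ∀ p, y p ∈ I.map ρ)
    (hexact : ∀ i, Function.Exact (d (i + 1)).mulVecLin (d i).mulVecLin) {m : ℕ}
    {v : Fin (rank (m + 1)) → P} (hd : IsGorensteinDual (I.map ρ) rank d m v) :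
    ∃ (D : ∀ i, Matrix (Fin (rank i)) (Fin (rank (i + 1))) S) (w : Fin (rank (m + 1)) → S),
      IsGorensteinDual I rank D m w ∧ (∀ i, (D i).map ρ = d i) ∧ (fun p => ρ (w p)) = v := by
  obtain ⟨D, hDd, hr, hD⟩ := h.exists_lift_resolution hI d h0 hexact
  obtain rfl : (fun i => (D i).map ρ) = d := funext hDd
  have hcomp : ∀ i, D i * D (i + 1) = 0 := by
    intro i
    ext a b
    have := (hD i _).2 ⟨Pi.single b 1, rfl⟩
    rw [Matrix.mulVecLin_apply, Matrix.mulVecLin_apply, Matrix.mulVec_mulVec,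
      Matrix.mulVec_single_one] at this
    exact congrFun this a
  have hc : ∀ i y, dualD D (i + 1) (dualD D i y) = 0 := fun i y => by
    change Matrix.vecMul (Matrix.vecMul y (D i)) (D (i + 1)) = 0
    rw [Matrix.vecMul_vecMul, hcomp, Matrix.vecMul_zero]
  have hex : ∀ i, i ≠ m → ∀ y, dualD D (i + 1) y = 0 → ∃ x, dualD D i x = y := fun i hi y hy =>
    h.exact_of_exact (map_vecMul_apply ρ (D i)) (map_vecMul_apply ρ (D (i + 1))) (hc i)
      (hd.exact i hi) hy
  -- For `m = 0` there is no preceding differential, and the zero map from the module of rank `0`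
  -- takes its place.
  have hsat : ∀ z, (∃ y, dualD D m y = t • z) → ∃ y, dualD D m y = z := by
    cases m with
    | zero =>
      exact h.saturated_of_exact (ι := Fin 0) (f := 0) (f' := 0) (fun y p => by simp)
        (map_vecMul_apply ρ (D 0)) (fun x => map_zero _) fun y hy => ⟨0, (hd.inj y hy).symm⟩
    | succ m =>
      exact h.saturated_of_exact (map_vecMul_apply ρ (D m)) (map_vecMul_apply ρ (D (m + 1))) (hc m)
        (hd.exact m (by omega))
  obtain ⟨w, hw, rfl⟩ := h.exists_lift_ker (map_vecMul_apply ρ (D (m + 1))) (fun z hz => by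
    refine hex (m + 1) (by omega) z (h.smul_eq_zero ?_)
    obtain ⟨y, hy⟩ := hz
    rw [← dualD_smul, ← hy]
    exact hc _ y) hd.closed
  -- The homotopy kills the cohomology of the dual by `I`; on the cocycle `w` only the coboundary
  -- half of it survives.
  have hann : ∀ p ∈ I, ∃ x, dualD D m x = p • w := by
    intro p hp
    obtain ⟨H, G, hHG, -, hG⟩ := exists_vecMul_eq_smul (fun y hy => (hr y).2 hy) hcomp
      (fun i y hy => (hD i y).1 hy) hp (m + 1)
    obtain ⟨x, hx⟩ := hG m rfl w
    refine ⟨x, hx.trans ?_⟩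
    have := congrArg (Matrix.vecMul w) hHG
    rw [Matrix.vecMul_add, ← Matrix.vecMul_vecMul] at this
    have hw' : Matrix.vecMul w (D (m + 1)) = 0 := hw
    rw [hw', Matrix.zero_vecMul, zero_add, Matrix.vecMul_smul, Matrix.vecMul_one] at this
    exact this
  refine ⟨D, w, ⟨hd.rank_zero, fun p q => (hr fun p => D 0 p q).1
    ⟨Pi.single q 1, by ext; simp⟩ p, hc, fun y hy => ?_, hex, hw, fun y hy => ?_, fun p =>
      ⟨fun hp => ?_, hann p⟩⟩, fun i => rfl, rfl⟩
  · obtain ⟨x, hx⟩ := h.exact_of_exact (ι := Fin 0) (f := 0) (f' := 0) (fun y p => by simp)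
      (map_vecMul_apply ρ (D 0)) (fun x => map_zero _) (fun y hy => ⟨0, (hd.inj y hy).symm⟩) hy
    exact hx.symm
  · have : LinearMap.ker (D (m + 1)).vecMulLinear ≤
        Submodule.span S {w} ⊔ LinearMap.range (D m).vecMulLinear := h.le_of_forall fun y hy => by
      obtain ⟨p', x', hx'⟩ := hd.gen (fun q => ρ (y q)) (by
        funext q
        exact (map_vecMul_apply ρ (D (m + 1)) y q).symm.trans
          (by rw [LinearMap.mem_ker.1 hy]; exact map_zero ρ))
      obtain ⟨p, rfl⟩ := h.surj p'
      obtain ⟨x, rfl⟩ := h.exists_lift x'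
      obtain ⟨z, hz⟩ := h.exists_eq_smul (y := y - (p • w + (D m).vecMulLinear x)) fun q => by
        have := congrFun hx' q
        rw [Pi.sub_apply, _root_.map_sub, this, Pi.add_apply, Pi.add_apply, map_add ρ,
          map_vecMul_apply, Pi.smul_apply, Pi.smul_apply, smul_eq_mul, smul_eq_mul, map_mul]
        exact sub_self _
      refine ⟨p • w + (D m).vecMulLinear x, ?_, z, h.smul_eq_zero ?_, by rw [← hz]; abel⟩
      · exact Submodule.add_mem_sup
          (Submodule.smul_mem _ _ (Submodule.mem_span_singleton_self w)) ⟨x, rfl⟩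
      · rw [← map_smul, ← hz, _root_.map_sub, LinearMap.mem_ker.1 hy, map_add, map_smul]
        have h1 : (D (m + 1)).vecMulLinear w = 0 := hw
        have h2 : (D (m + 1)).vecMulLinear ((D m).vecMulLinear x) = 0 := hc m x
        rw [h1, h2]; simp
    obtain ⟨a, ha, b, ⟨x, rfl⟩, rfl⟩ := Submodule.mem_sup.1 (this hy)
    obtain ⟨p, rfl⟩ := Submodule.mem_span_singleton.1 ha
    exact ⟨p, x, rfl⟩
  · have : (LinearMap.range (D m).vecMulLinear).comap (LinearMap.toSpanSingleton S _ w) ≤ I :=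
      h.le_of_forall fun p hp => by
        obtain ⟨x, hx⟩ := hp
        have h1 : ρ p ∈ I.map ρ := (hd.ann _).1 ⟨fun q => ρ (x q), by
          funext q
          refine (map_vecMul_apply ρ (D m) x q).symm.trans ?_
          rw [hx]; simp⟩
        obtain ⟨p', hp', e⟩ := (Ideal.mem_map_iff_of_surjective ρ h.surj).1 h1
        obtain ⟨s, hs⟩ := (h.ker (p - p')).1 (by rw [_root_.map_sub, e, sub_self])
        refine ⟨p', hp', s, ?_, by rw [smul_eq_mul, ← hs]; ring⟩
        obtain ⟨x', hx'⟩ := hann p' hp'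
        refine hsat _ ⟨x - x', ?_⟩
        rw [_root_.map_sub, hx']
        change (D m).vecMulLinear x - p' • w = _
        rw [hx, LinearMap.toSpanSingleton_apply, LinearMap.toSpanSingleton_apply, smul_smul, ← hs,
          _root_.sub_smul]
    exact this hp

end Resolution

end Lift

/-! ### Lifting the Kustin–Miller homomorphism from the fibre. -/

section LiftJoined

variable {S P : Type*} [CommRing S] [CommRing P]

open Kos

/-- Entrywise application of a ring homomorphism. -/
def piMap (ρ : S →+* P) (k : ℕ) : (Fin k → S) →+ (Fin k → P) :=
  AddMonoidHom.compLeft ρ.toAddMonoidHom (Fin k)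

theorem piMap_smul (ρ : S →+* P) (k : ℕ) (s : S) (y : Fin k → S) :
    piMap ρ k (s • y) = ρ s • piMap ρ k y := by
  ext p
  exact map_mul ρ _ _

theorem piMap_dualD (ρ : S →+* P) {rank : ℕ → ℕ}
    {D : ∀ i, Matrix (Fin (rank i)) (Fin (rank (i + 1))) S}
    {D' : ∀ i, Matrix (Fin (rank i)) (Fin (rank (i + 1))) P} (hD : ∀ i, (D i).map ρ = D' i) (i : ℕ)
    (y : Fin (rank i) → S) : piMap ρ _ (dualD D i y) = dualD D' i (piMap ρ _ y) := by
  ext p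
  refine (map_vecMul_apply ρ (D i) y p).trans ?_
  rw [hD]
  rfl

variable {rank : ℕ → ℕ} {D : ∀ i, Matrix (Fin (rank i)) (Fin (rank (i + 1))) S}
  {D' : ∀ i, Matrix (Fin (rank i)) (Fin (rank (i + 1))) P} {x : ℕ → S} {n : ℕ}

theorem Staircase.map (ρ : S →+* P) (hD : ∀ i, (D i).map ρ = D' i) :
    ∀ {i : ℕ} {y : Kos (Fin (rank i) → S) n} {z : Fin (rank 0) → S}, Staircase D x n i y z →
      Staircase D' (fun j => ρ (x j)) n i (Kos.map (piMap ρ _) n y) (piMap ρ _ z)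
  | 0, _, _, h => by rw [Staircase] at *; rw [h, Kos.map_top]
  | i + 1, y, z, ⟨h, y', hy', e⟩ => by
    refine ⟨h.map _, _, Staircase.map ρ hD hy', ?_⟩
    rw [← map_d _ x _ (fun j _ m => piMap_smul ρ _ (x j) m), ← e, map_map, map_map]
    have : (dualD D' i).comp (piMap ρ _) = (piMap ρ _).comp (dualD D i) :=
      AddMonoidHom.ext fun w => (piMap_dualD ρ hD i w).symm
    rw [this]

theorem IsJoined.map {m : ℕ} {v : Fin (rank (m + 1)) → S} {v' : Fin (rank (m + 1)) → P}
    (ρ : S →+* P) (hD : ∀ i, (D i).map ρ = D' i) (hv : (fun p => ρ (v p)) = v') {r : ℕ → S}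
    {z : Fin (rank 0) → S} (h : IsJoined D x n v r z) :
    IsJoined D' (fun j => ρ (x j)) n v' (fun j => ρ (r j)) (fun p => ρ (z p)) := by
  obtain ⟨β, hβ⟩ := h
  refine ⟨fun j => piMap ρ _ (β j), ?_⟩
  have := hβ.map ρ hD
  rw [map_ι₁] at this
  convert! this using 3 with j
  rw [map_add, piMap_smul, piMap_dualD ρ hD, ← hv]
  rfl

theorem IsJoined.congr {m : ℕ} {v : Fin (rank (m + 1)) → S} {r r' : ℕ → S} {z : Fin (rank 0) → S}
    (h : IsJoined D x n v r z) (hr : ∀ j < n, r j = r' j) : IsJoined D x n v r' z := by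
  obtain ⟨β, hβ⟩ := h
  refine ⟨β, ?_⟩
  rwa [ι₁_congr (r' := fun j => r j • v + dualD D m (β j)) fun j hj => by rw [hr j hj]]

/-- The elements congruent to `1` modulo `t`. -/
def oneAddMultiples (t : S) : Submonoid S where
  carrier := {a | ∃ s, a = 1 + t * s}
  one_mem' := ⟨0, by ring⟩
  mul_mem' := by
    rintro _ _ ⟨a, rfl⟩ ⟨b, rfl⟩
    exact ⟨a + b + t * a * b, by ring⟩

theorem weaklyRegular_localization (M : Submonoid S) (h : WeaklyRegular S x n) :
    WeaklyRegular (Localization M) (fun j => algebraMap S (Localization M) (x j)) n := by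
  have key : ∀ i, Ideal.span ((fun j => algebraMap S (Localization M) (x j)) '' {j | j < i}) =
      (Ideal.span (x '' {j | j < i})).map (algebraMap S (Localization M)) := by
    intro i
    rw [Ideal.map_span, Set.image_image]
  intro i hi a ha
  rw [inSpan_iff, key] at ha ⊢
  obtain ⟨⟨b, σ⟩, hb⟩ := IsLocalization.surj M a
  have h1 : algebraMap S (Localization M) (x i * b) ∈
      (Ideal.span (x '' {j | j < i})).map (algebraMap S (Localization M)) := by
    rw [map_mul, ← hb, ← mul_assoc]
    exact Ideal.mul_mem_right _ _ ha
  obtain ⟨τ, hτ, h2⟩ := (IsLocalization.algebraMap_mem_map_algebraMap_iff M _ _ _).1 h1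
  have h3 : τ * b ∈ Ideal.span (x '' {j | j < i}) := by
    rw [← inSpan_iff] at h2 ⊢
    refine h i hi _ ?_
    convert! h2 using 1
    rw [smul_eq_mul]; ring
  have h4 : algebraMap S (Localization M) τ * algebraMap S (Localization M) σ * a ∈
      (Ideal.span (x '' {j | j < i})).map (algebraMap S (Localization M)) := by
    convert! Ideal.mem_map_of_mem (algebraMap S (Localization M)) h3 using 1
    rw [map_mul, ← hb]; ring
  exact (Ideal.unit_mul_mem_iff_mem _ ((IsLocalization.map_units _ (⟨τ, hτ⟩ : M)).mul
    (IsLocalization.map_units _ σ))).1 h4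

variable {ρ : S →+* P} {t : S}

/-- Inverting `1 + t S` forces `t` into the Jacobson radical and leaves the reduction unchanged,
since these elements map to `1`. -/
theorem exists_isLocalReduction [IsNoetherianRing S] (ht : ∀ s : S, t * s = 0 → s = 0)
    (hρ : Function.Surjective ρ) (hker : ∀ s, ρ s = 0 ↔ ∃ s', s = t * s') :
    ∃ ρ' : Localization (oneAddMultiples t) →+* P,
      IsLocalReduction ρ' (algebraMap S (Localization (oneAddMultiples t)) t) ∧
        ∀ s, ρ' (algebraMap S _ s) = ρ s := by
  have hM : ∀ a : oneAddMultiples t, ρ a = 1 := by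
    rintro ⟨_, s, rfl⟩
    rw [map_add, map_one, (hker (t * s)).2 ⟨s, rfl⟩, add_zero]
  have hu : ∀ a : oneAddMultiples t, IsUnit (ρ a) := fun a => by rw [hM]; exact isUnit_one
  have hlift : ∀ s, IsLocalization.lift hu (algebraMap S (Localization (oneAddMultiples t)) s) =
    ρ s := IsLocalization.lift_eq hu
  refine ⟨IsLocalization.lift hu, ⟨IsLocalization.isNoetherianRing (oneAddMultiples t) _ ‹_›,
    ?_, ?_, fun p => ?_, ?_⟩, hlift⟩
  · rw [Ideal.mem_jacobson_bot]
    intro y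
    obtain ⟨⟨b, σ⟩, hb⟩ := IsLocalization.surj (oneAddMultiples t) y
    obtain ⟨σ, s, rfl⟩ := σ
    have h1 : (algebraMap S (Localization (oneAddMultiples t)) t * y + 1) *
        algebraMap S _ (1 + t * s) = algebraMap S _ (1 + t * (b + s)) := by
      rw [add_mul, mul_assoc, hb, ← map_mul, one_mul, ← map_add]
      congr 1; ring
    have h2 := IsLocalization.map_units (Localization (oneAddMultiples t))
      (⟨1 + t * (b + s), b + s, rfl⟩ : oneAddMultiples t)
    rw [← h1] at h2
    exact isUnit_of_mul_isUnit_left h2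
  · intro y hy
    obtain ⟨⟨b, σ⟩, hb⟩ := IsLocalization.surj (oneAddMultiples t) y
    have h1 : algebraMap S (Localization (oneAddMultiples t)) (t * b) = 0 := by
      rw [map_mul, ← hb, ← mul_assoc, hy, zero_mul]
    obtain ⟨τ, hτ⟩ := (IsLocalization.map_eq_zero_iff (oneAddMultiples t) _ _).1 h1
    have h2 : (τ : S) * b = 0 := ht _ (by rw [← hτ]; ring)
    have h3 : algebraMap S (Localization (oneAddMultiples t)) b = 0 :=
      (IsLocalization.map_eq_zero_iff (oneAddMultiples t) _ _).2 ⟨τ, h2⟩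
    rw [h3] at hb
    exact (IsLocalization.map_units _ σ).mul_left_eq_zero.1 hb
  · obtain ⟨s, rfl⟩ := hρ p
    exact ⟨_, hlift s⟩
  · intro y
    constructor
    · intro hy
      obtain ⟨⟨b, σ⟩, hb⟩ := IsLocalization.surj (oneAddMultiples t) y
      have h1 : ρ b = 0 := by rw [← hlift, ← hb, map_mul, hy, zero_mul]
      obtain ⟨b', rfl⟩ := (hker b).1 h1
      obtain ⟨c, hc⟩ := IsLocalization.map_units (Localization (oneAddMultiples t)) σ
      refine ⟨algebraMap S _ b' * ↑c⁻¹, ?_⟩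
      rw [← mul_assoc, ← map_mul, ← hb, ← hc, Units.mul_inv_cancel_right]
    · rintro ⟨y', rfl⟩
      rw [map_mul, hlift, (hker t).2 ⟨1, (mul_one t).symm⟩, zero_mul]

/-- The Kustin-Miller homomorphism lifts from the reduction modulo `t`. -/
theorem exists_compatible_lift [IsNoetherianRing S] (ht : ∀ s : S, t * s = 0 → s = 0)
    (hρ : Function.Surjective ρ) (hker : ∀ s, ρ s = 0 ↔ ∃ s', s = t * s') {I : Ideal S}
    (hI : ∀ p, t * p ∈ I → p ∈ I) (hx : WeaklyRegular S x n) (hIx : ∀ p ∈ I, InSpan x n p)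
    {m : ℕ} (hn : n = m + 2) {v : Fin (rank (m + 1)) → P}
    (h0 : ∀ y : Fin (rank 0) → P, y ∈ LinearMap.range (D' 0).mulVecLin ↔ ∀ p, y p ∈ I.map ρ)
    (hexact : ∀ i, Function.Exact (D' (i + 1)).mulVecLin (D' i).mulVecLin)
    (hd : IsGorensteinDual (I.map ρ) rank D' m v) :
    ∃ r, IsCompatible I x n r ∧ IsJoined D' (fun j => ρ (x j)) n v (fun j => ρ (r j)) fun _ => 1 := by
  obtain ⟨ρ', h, hρ'⟩ := exists_isLocalReduction ht hρ hker
  set L := Localization (oneAddMultiples t)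
  have hcomp : ρ'.comp (algebraMap S L) = ρ := RingHom.ext hρ'
  have hIρ : (I.map (algebraMap S L)).map ρ' = I.map ρ := by rw [Ideal.map_map, hcomp]
  have hM : ∀ a : oneAddMultiples t, ρ a = 1 := by
    rintro ⟨_, s, rfl⟩
    rw [map_add, map_one, (hker (t * s)).2 ⟨s, rfl⟩, add_zero]
  have hIL : ∀ p, algebraMap S L t * p ∈ I.map (algebraMap S L) → p ∈ I.map (algebraMap S L) := by
    intro p hp
    obtain ⟨⟨b, σ⟩, hb⟩ := IsLocalization.surj (oneAddMultiples t) p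
    have h1 : algebraMap S L (t * b) ∈ I.map (algebraMap S L) := by
      rw [map_mul, ← hb, ← mul_assoc]
      exact Ideal.mul_mem_right _ _ hp
    obtain ⟨τ, hτ, h2⟩ :=
      (IsLocalization.algebraMap_mem_map_algebraMap_iff (oneAddMultiples t) _ _ _).1 h1
    have h3 : τ * b ∈ I := hI _ (by convert h2 using 1; ring)
    have h4 : algebraMap S L τ * algebraMap S L σ * p ∈ I.map (algebraMap S L) := by
      convert! Ideal.mem_map_of_mem (algebraMap S L) h3 using 1
      rw [map_mul, ← hb]; ring
    exact (Ideal.unit_mul_mem_iff_mem _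
      ((IsLocalization.map_units _ (⟨τ, hτ⟩ : oneAddMultiples t)).mul
      (IsLocalization.map_units _ σ))).1 h4
  obtain ⟨D, w, hD, hDd, hw⟩ := h.exists_lift_dual hIL D' (by rwa [hIρ]) hexact (by rwa [hIρ])
  have hIxL : ∀ p ∈ I.map (algebraMap S L), InSpan (fun j => algebraMap S L (x j)) n p := by
    intro p hp
    rw [inSpan_iff, ← Set.image_image (algebraMap S L) x, ← Ideal.map_span]
    exact Ideal.map_mono (fun q hq => inSpan_iff.1 (hIx q hq)) hp
  obtain ⟨r', hr', hj⟩ :=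
    hD.exists_compatible_isJoined (weaklyRegular_localization _ hx) hn hIxL
  have hj' := hj.map ρ' hDd hw
  simp only [hρ', map_one] at hj'
  -- Both the common denominator `σ` and the multiplier `T` that restores compatibility over `S` are
  -- `1` modulo `t`, so the cleared tuple has the same reduction.
  obtain ⟨σ, hσ⟩ := IsLocalization.exist_integer_multiples (oneAddMultiples t) (Finset.range n) r'
  choose! a ha using fun j (hj : j < n) => hσ j (Finset.mem_range.2 hj)
  have hcompat : ∀ i < n, ∀ j < n, ∃ τ ∈ oneAddMultiples t, τ * (x i * a j - x j * a i) ∈ I := by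
    intro i hi j hj
    refine (IsLocalization.algebraMap_mem_map_algebraMap_iff (oneAddMultiples t) L _ _).1 ?_
    have := Ideal.mul_mem_left _ (algebraMap S L σ) (hr' i hi j hj)
    convert! this using 1
    rw [_root_.map_sub, map_mul, map_mul, ha i hi, ha j hj, Algebra.smul_def, Algebra.smul_def]
    ring
  choose! τ hτM hτ using hcompat
  let T : S := ∏ i ∈ Finset.range n, ∏ j ∈ Finset.range n, τ i j
  have hT : T ∈ oneAddMultiples t := Submonoid.prod_mem _ fun i hi => Submonoid.prod_mem _
    fun j hj => hτM i (Finset.mem_range.1 hi) j (Finset.mem_range.1 hj)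
  refine ⟨fun j => T * a j, fun i hi j hj => ?_, hj'.congr fun j hj => ?_⟩
  · have h1 : τ i j ∣ T := (Finset.dvd_prod_of_mem _ (Finset.mem_range.2 hj)).trans
      (Finset.dvd_prod_of_mem (fun i => ∏ j ∈ Finset.range n, τ i j) (Finset.mem_range.2 hi))
    obtain ⟨c, hc⟩ := h1
    convert! Ideal.mul_mem_left _ c (hτ i hi j hj) using 1
    rw [hc]; ring
  · rw [map_mul, hM ⟨T, hT⟩, one_mul, ← hρ' (a j), ha j hj, Algebra.smul_def, map_mul, hρ', hM,
      one_mul]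

end LiftJoined

/-! ### Homogeneous components of polynomials, Koszul elements and staircases. -/

section GradedStaircase

namespace Kos

variable {S M N : Type*} [CommRing S] [AddCommGroup M] [AddCommGroup N] [Module S M]

/-- The homogeneous components of the elements of a Koszul complex on elements of degrees `w j`,
where `π k` is the component of degree `k` on the coefficients. -/
def comp (π : ℤ → M →+ M) (w : ℕ → ℤ) : ∀ n : ℕ, ℤ → (Kos M n →+ Kos M n)
  | 0, k => π k
  | n + 1, k => (comp π w n k).prodMap (comp π w n (k + w n))

theorem comp_pair (π : ℤ → M →+ M) (w : ℕ → ℤ) {n : ℕ} (k : ℤ) (a b : Kos M n) :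
    comp π w (n + 1) k (pair a b) = pair (comp π w n k a) (comp π w n (k + w n) b) := rfl

theorem comp_smul (π : ℤ → M →+ M) (w : ℕ → ℤ) {s : S} {l : ℤ}
    (h : ∀ k m, π (k + l) (s • m) = s • π k m) :
    ∀ {n : ℕ} (k : ℤ) (y : Kos M n), comp π w n (k + l) (s • y) = s • comp π w n k y
  | 0, k, y => h k y
  | n + 1, k, y => by
    obtain ⟨a, b, rfl⟩ := exists_pair y
    rw [smul_pair, comp_pair, comp_pair, smul_pair, comp_smul π w h,
      show k + l + w n = k + w n + l by ring, comp_smul π w h]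

theorem comp_d (π : ℤ → M →+ M) (w : ℕ → ℤ) (x : ℕ → S) :
    ∀ {n : ℕ} (_ : ∀ j < n, ∀ k m, π (k + w j) (x j • m) = x j • π k m) (k : ℤ) (y : Kos M n),
      comp π w n k (d x n y) = d x n (comp π w n k y)
  | 0, _, k, _ => (π k).map_zero
  | n + 1, h, k, y => by
    obtain ⟨a, b, rfl⟩ := exists_pair y
    have ih := fun k => comp_d π w x (n := n) (fun j hj => h j (Nat.lt_succ_of_lt hj)) k
    rw [d_pair, comp_pair, comp_pair, d_pair, map_sub, ih, ih,
      comp_smul π w (h n (Nat.lt_succ_self n))]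

theorem comp_map (π : ℤ → M →+ M) (π' : ℤ → N →+ N) (w : ℕ → ℤ) (f : M →+ N)
    (h : ∀ k m, π' k (f m) = f (π k m)) :
    ∀ {n : ℕ} (k : ℤ) (y : Kos M n), comp π' w n k (map f n y) = map f n (comp π w n k y)
  | 0, k, y => h k y
  | n + 1, k, y => by
    obtain ⟨a, b, rfl⟩ := exists_pair y
    rw [map_pair, comp_pair, comp_pair, map_pair, comp_map π π' w f h, comp_map π π' w f h]

theorem Deg.comp (π : ℤ → M →+ M) (w : ℕ → ℤ) :
    ∀ {n : ℕ} {q : ℤ} {y : Kos M n} (k : ℤ), Deg n q y → Deg n q (comp π w n k y)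
  | 0, _, y, k, hy => fun h => by
    have h1 : y = 0 := hy h
    rw [h1, map_zero]; rfl
  | n + 1, q, y, k, hy => ⟨Deg.comp π w (n := n) k hy.1, Deg.comp π w (n := n) _ hy.2⟩

theorem comp_ι₀ (π : ℤ → M →+ M) (w : ℕ → ℤ) :
    ∀ {n : ℕ} (k : ℤ) (m : M), comp π w n k (ι₀ n m) = ι₀ n (π k m)
  | 0, _, _ => rfl
  | n + 1, k, m => by rw [ι₀, comp_pair, comp_ι₀ π w, map_zero]; rfl

theorem comp_ι₁ (π : ℤ → M →+ M) (w : ℕ → ℤ) :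
    ∀ {n : ℕ} (k : ℤ) (r : ℕ → M), comp π w n k (ι₁ n r) = ι₁ n fun j => π (k + w j) (r j)
  | 0, k, _ => (π k).map_zero
  | n + 1, k, r => by rw [ι₁, comp_pair, comp_ι₁ π w, comp_ι₀]; rfl

theorem comp_top (π : ℤ → M →+ M) (w : ℕ → ℤ) :
    ∀ {n : ℕ} (k : ℤ) (m : M),
      comp π w n k (top n m) = top n (π (k + ∑ j ∈ Finset.range n, w j) m)
  | 0, k, m => by
    change π k m = π (k + ∑ j ∈ Finset.range 0, w j) m
    simp
  | n + 1, k, m => by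
    rw [top, comp_pair, comp_top π w, map_zero, Finset.sum_range_succ,
      add_comm (∑ j ∈ Finset.range n, w j), ← add_assoc]
    rfl

end Kos

end GradedStaircase

namespace WeightedProj

section Component

variable {A B : Type*} [CommRing A] [CommRing B] {σ : Type*} (a : σ → ℕ)

/-- The homogeneous component of degree `k`. -/
noncomputable abbrev hcomp (k : ℤ) : MvPolynomial σ A →ₗ[A] MvPolynomial σ A :=
  MvPolynomial.weightedHomogeneousComponent (wt a) k

theorem isHomog_hcomp (k : ℤ) (p : MvPolynomial σ A) : IsHomog a (hcomp a k p) k :=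
  MvPolynomial.weightedHomogeneousComponent_isWeightedHomogeneous k p

variable {a}

theorem hcomp_mul {p : MvPolynomial σ A} {l : ℤ} (hp : IsHomog a p l) (k : ℤ)
    (q : MvPolynomial σ A) : hcomp a (k + l) (p * q) = p * hcomp a k q := by
  classical
  ext e
  rw [MvPolynomial.coeff_weightedHomogeneousComponent, MvPolynomial.coeff_mul,
    MvPolynomial.coeff_mul]
  have key : ∀ e' ∈ Finset.HasAntidiagonal.antidiagonal e, MvPolynomial.coeff e'.1 p *
      MvPolynomial.coeff e'.2 (hcomp a k q) = if Finsupp.weight (wt a) e = k + l then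
        MvPolynomial.coeff e'.1 p * MvPolynomial.coeff e'.2 q else 0 := by
    rintro ⟨e₁, e₂⟩ he
    obtain rfl : e₁ + e₂ = e := Finset.HasAntidiagonal.mem_antidiagonal.1 he
    by_cases h : MvPolynomial.coeff e₁ p = 0
    · simp [h]
    · rw [MvPolynomial.coeff_weightedHomogeneousComponent, map_add, hp h, add_comm l,
        mul_ite, mul_zero]
      simp only [add_left_inj]
  rw [Finset.sum_congr rfl key]
  split_ifs <;> simp

theorem hcomp_mul_of_isHomog {p : MvPolynomial σ A} {k : ℤ} (l : ℤ) {q : MvPolynomial σ A}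
    (hq : IsHomog a q k) : hcomp a (l + k) (p * q) = hcomp a l p * q := by
  rw [mul_comm, hcomp_mul hq, mul_comm]

/-- A polynomial is the sum of its homogeneous components. -/
theorem sum_hcomp {K : Finset ℤ} {l : ℤ} {p : MvPolynomial σ A}
    (hK : ∀ e ∈ p.support, Finsupp.weight (wt a) e - l ∈ K) : ∑ k ∈ K, hcomp a (k + l) p = p := by
  classical
  ext e
  rw [MvPolynomial.coeff_sum]
  by_cases he : e ∈ p.support
  · rw [Finset.sum_eq_single_of_mem _ (hK e he) fun k _ hk => by
      rw [MvPolynomial.coeff_weightedHomogeneousComponent, if_neg fun h => hk (by rw [h]; ring)],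
      MvPolynomial.coeff_weightedHomogeneousComponent, if_pos (by ring)]
  · rw [MvPolynomial.notMem_support_iff] at he
    rw [he]
    exact Finset.sum_eq_zero fun k _ => by
      rw [MvPolynomial.coeff_weightedHomogeneousComponent, he, ite_self]

/-- With positive weights the component of degree `0` is the constant term. -/
theorem hcomp_zero (ha : ∀ i, 0 < a i) (p : MvPolynomial σ A) :
    hcomp a 0 p = MvPolynomial.C (MvPolynomial.coeff 0 p) := by
  classical
  ext e
  rw [MvPolynomial.coeff_weightedHomogeneousComponent, MvPolynomial.coeff_C]
  have : Finsupp.weight (wt a) e = 0 ↔ 0 = e := by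
    constructor
    · intro h
      rw [Finsupp.weight_apply, Finsupp.sum, Finset.sum_eq_zero_iff_of_nonneg fun i _ => by
        rw [wt, nsmul_eq_mul]; positivity] at h
      ext i
      by_contra hi
      have := h i (Finsupp.mem_support_iff.2 (Ne.symm hi))
      rw [wt, nsmul_eq_mul, mul_eq_zero] at this
      rcases this with h' | h'
      · exact hi (by exact_mod_cast h'.symm)
      · exact (ha i).ne' (by exact_mod_cast h')
    · rintro rfl
      exact map_zero _
  simp only [this]
  split_ifs with h
  · rw [h]
  · rfl

theorem hcomp_map (ρ : A →+* B) (k : ℤ) (p : MvPolynomial σ A) :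
    hcomp a k (MvPolynomial.map ρ p) = MvPolynomial.map ρ (hcomp a k p) := by
  classical
  ext e
  rw [MvPolynomial.coeff_weightedHomogeneousComponent, MvPolynomial.coeff_map,
    MvPolynomial.coeff_map, MvPolynomial.coeff_weightedHomogeneousComponent]
  split_ifs
  · rfl
  · rw [map_zero]

theorem IsHomog.map (ρ : A →+* B) {p : MvPolynomial σ A} {l : ℤ} (hp : IsHomog a p l) :
    IsHomog a (MvPolynomial.map ρ p) l := by
  intro e he
  rw [MvPolynomial.coeff_map] at he
  exact hp fun h => he (by rw [h, map_zero])

end Component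

section JoinedComponent

variable {A : Type*} [CommRing A] {σ : Type*} {a : σ → ℕ} {rank : ℕ → ℕ}
  {deg : (i : ℕ) → Fin (rank i) → ℤ}
  {D : ∀ i, Matrix (Fin (rank i)) (Fin (rank (i + 1))) (MvPolynomial σ A)}
  {x : ℕ → MvPolynomial σ A} {n : ℕ} {w : ℕ → ℤ}

variable (a) in
/-- The homogeneous components of a vector whose coordinates are shifted by `deg`. -/
noncomputable def picomp {ι : Type*} (deg : ι → ℤ) (k : ℤ) :
    (ι → MvPolynomial σ A) →+ (ι → MvPolynomial σ A) where
  toFun y q := hcomp a (k + deg q) (y q)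
  map_zero' := by ext1; simp
  map_add' _ _ := by ext1; simp

theorem picomp_apply {ι : Type*} (deg : ι → ℤ) (k : ℤ) (y : ι → MvPolynomial σ A) (q : ι) :
    picomp a deg k y q = hcomp a (k + deg q) (y q) := rfl

theorem picomp_smul {ι : Type*} (deg : ι → ℤ) {p : MvPolynomial σ A} {l : ℤ} (hp : IsHomog a p l)
    (k : ℤ) (y : ι → MvPolynomial σ A) :
    picomp a deg (k + l) (p • y) = p • picomp a deg k y := by
  ext1 q
  rw [picomp_apply, Pi.smul_apply, Pi.smul_apply, picomp_apply, smul_eq_mul, smul_eq_mul,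
    show k + l + deg q = k + deg q + l by ring, hcomp_mul hp]

theorem picomp_dualD (hD : ∀ i p q, IsHomog a (D i p q) (deg (i + 1) q - deg i p)) (i : ℕ) (k : ℤ)
    (y : Fin (rank i) → MvPolynomial σ A) :
    picomp a (deg (i + 1)) k (dualD D i y) = dualD D i (picomp a (deg i) k y) := by
  ext1 q
  change hcomp a _ (∑ p, y p * D i p q) = ∑ p, hcomp a _ (y p) * D i p q
  rw [map_sum]
  refine Finset.sum_congr rfl fun p _ => ?_
  rw [← hcomp_mul_of_isHomog _ (hD i p q)]
  congr 2
  ring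

open Kos

/-- All differentials are homogeneous, so components commute with every step. The top Koszul class
shifts the degree of the end by the sum of the weights. -/
theorem _root_.Staircase.hcomp (hD : ∀ i p q, IsHomog a (D i p q) (deg (i + 1) q - deg i p))
    (hx : ∀ j < n, IsHomog a (x j) (w j)) (k : ℤ) :
    ∀ {i : ℕ} {y : Kos (Fin (rank i) → MvPolynomial σ A) n} {z : Fin (rank 0) → MvPolynomial σ A},
      Staircase D x n i y z → Staircase D x n i (Kos.comp (picomp a (deg i)) w n k y)
        (picomp a (deg 0) (k + ∑ j ∈ Finset.range n, w j) z)
  | 0, _, _, h => by rw [Staircase] at *; rw [h, comp_top]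
  | i + 1, y, z, ⟨h, y', hy', e⟩ => by
    refine ⟨h.comp _ _ _, _, hy'.hcomp hD hx k, ?_⟩
    rw [← comp_map (picomp a (deg i)) (picomp a (deg (i + 1))) w (dualD D i)
      fun k m => picomp_dualD hD i k m, e, comp_d]
    exact fun j hj k m => picomp_smul _ (hx j hj) k m

/-- The end `1` survives in the component of degree `-∑ w j`; as `v` has degree `-l`, the entry `r
j` is cut down to degree `w j + l - ∑ w j`. -/
theorem _root_.IsJoined.hcomp (hD : ∀ i p q, IsHomog a (D i p q) (deg (i + 1) q - deg i p))
    (hx : ∀ j < n, IsHomog a (x j) (w j)) {m : ℕ} {v : Fin (rank (m + 1)) → MvPolynomial σ A}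
    {l b : ℤ} (hv : ∀ q, IsHomog a (v q) (deg (m + 1) q - l)) (hdeg : ∀ q, deg 0 q = 0)
    (hb : b = l - ∑ j ∈ Finset.range n, w j) {r : ℕ → MvPolynomial σ A}
    (h : IsJoined D x n v r fun _ => 1) :
    IsJoined D x n v (fun j => WeightedProj.hcomp a (w j + b) (r j)) fun _ => 1 := by
  obtain ⟨β, hβ⟩ := h
  have := hβ.hcomp hD hx (- ∑ j ∈ Finset.range n, w j)
  rw [comp_ι₁] at this
  refine ⟨fun j => picomp a (deg m) (- ∑ j ∈ Finset.range n, w j + w j) (β j), ?_⟩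
  convert! this using 2
  · funext j
    rw [map_add, picomp_dualD hD]
    congr 1
    ext1 q
    rw [picomp_apply, Pi.smul_apply, Pi.smul_apply, smul_eq_mul, smul_eq_mul,
      ← hcomp_mul_of_isHomog _ (hv q)]
    congr 2
    rw [hb]; ring
  · rename_i q
    rw [picomp_apply, hdeg, neg_add_cancel, add_zero]
    exact (MvPolynomial.weightedHomogeneousComponent_eq_self
      (MvPolynomial.isWeightedHomogeneous_one A (wt a))).symm

end JoinedComponent

section GorensteinDual

variable {K : Type u} [Field K] {σ : Type v} [Fintype σ] {a : σ → ℕ}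
  {I : Ideal (MvPolynomial σ K)} {k : ℤ}

/-- The dimension hypothesis fixes the codimension at `m + 1`, which leaves cohomology of the dual
in that degree only. -/
theorem IsProjGorenstein.exists_isGorensteinDual (h : IsProjGorenstein a I k) {m e : ℕ}
    (hdim : ringKrullDim (MvPolynomial σ K ⧸ I) = (e : WithBot ℕ∞))
    (hm : e + (m + 1) = Fintype.card σ) :
    ∃ (F : GradedFreeResolution a I) (v : Fin (F.rank (m + 1)) → MvPolynomial σ K),
      IsGorensteinDual I F.rank F.d m v ∧
        ∀ q, IsHomog a (v q) (F.deg (m + 1) q - (∑ i, (a i : ℤ) + k)) := by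
  obtain ⟨F, c, hc, hne, v, hv, hvh, hgen, hann⟩ := h
  obtain rfl : c = m + 1 := by
    rw [hdim, ← hm] at hc
    have : e + c = e + (m + 1) := by exact_mod_cast hc
    omega
  refine ⟨F, v, ⟨F.rank_zero, fun p q => ?_, fun i y => ?_, fun y hy => ?_, fun i hi y hy => ?_, hv,
    fun y hy => ?_, fun p => ?_⟩, fun q => by rw [← sub_sub]; exact hvh q⟩
  · exact (F.exact_zero fun p => F.d 0 p q).1 ⟨Pi.single q 1, by ext1; simp⟩ p
  · have hcomp : F.d i * F.d (i + 1) = 0 := by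
      ext1 p q
      have := (F.exact_succ i _).2 ⟨Pi.single q 1, rfl⟩
      rw [Matrix.mulVecLin_apply, Matrix.mulVecLin_apply, Matrix.mulVec_mulVec,
        Matrix.mulVec_single_one] at this
      exact congrFun this p
    change Matrix.vecMul (Matrix.vecMul y (F.d i)) (F.d (i + 1)) = 0
    rw [Matrix.vecMul_vecMul, hcomp, Matrix.vecMul_zero]
  · have : y ∈ F.coboundaries 0 := hne 0 (by omega) ▸ hy
    exact this
  · have : y ∈ F.coboundaries (i + 1) := hne (i + 1) (by omega) ▸ hy
    exact this
  · have : y ∈ F.cocycles (m + 1) := hy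
    rw [hgen] at this
    obtain ⟨_, ha, _, ⟨x, rfl⟩, rfl⟩ := Submodule.mem_sup.1 this
    obtain ⟨p, rfl⟩ := Submodule.mem_span_singleton.1 ha
    exact ⟨p, x, rfl⟩
  · exact hann p

end GorensteinDual

end WeightedProj

namespace WeightedProj

/-! ### The equations of `D` as a regular sequence. -/

section Coordinates

variable (A : Type*) [CommRing A] (s d : ℕ)

/-- The equations `x_{d+1}, …, x_s` of `D`. -/
noncomputable def coordVar (j : ℕ) : MvPolynomial (Fin (s + 1)) A :=
  if h : d + 1 + j < s + 1 then MvPolynomial.X ⟨d + 1 + j, h⟩ else 0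

/-- The weights of `x_{d+1}, …, x_s`. -/
def coordWt {s : ℕ} (d : ℕ) (a : Fin (s + 1) → ℕ) (j : ℕ) : ℤ :=
  if h : d + 1 + j < s + 1 then a ⟨d + 1 + j, h⟩ else 0

variable {A s d}

theorem coordVar_eq {j : ℕ} (h : d + 1 + j < s + 1) :
    coordVar A s d j = MvPolynomial.X ⟨d + 1 + j, h⟩ := dif_pos h

theorem isHomog_coordVar (a : Fin (s + 1) → ℕ) (j : ℕ) :
    IsHomog a (coordVar A s d j) (coordWt d a j) := by
  rw [coordVar, coordWt]
  split_ifs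
  · exact MvPolynomial.isWeightedHomogeneous_X A (wt a) _
  · exact MvPolynomial.isWeightedHomogeneous_zero A _ _

theorem map_coordVar {B : Type*} [CommRing B] (ρ : A →+* B) (j : ℕ) :
    MvPolynomial.map ρ (coordVar A s d j) = coordVar B s d j := by
  rw [coordVar, coordVar]
  split_ifs
  · exact MvPolynomial.map_X _ _
  · exact map_zero _

theorem image_coordVar {i : ℕ} (hi : i ≤ s - d) : coordVar A s d '' {j | j < i} =
    MvPolynomial.X '' {q : Fin (s + 1) | d < (q : ℕ) ∧ (q : ℕ) < d + 1 + i} := by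
  ext p
  constructor
  · rintro ⟨j, hj, rfl⟩
    rw [Set.mem_ofPred_eq] at hj
    refine ⟨⟨d + 1 + j, by omega⟩, ⟨?_, ?_⟩, (coordVar_eq _).symm⟩
    · simp only; omega
    · simp only; omega
  · rintro ⟨q, ⟨h1, h2⟩, rfl⟩
    refine ⟨q - (d + 1), ?_, ?_⟩
    · rw [Set.mem_ofPred_eq]; omega
    · rw [coordVar_eq (by omega)]
      congr 1
      ext1
      simp only; omega

theorem coordIdeal_eq_span_image :
    coordIdeal A s d = Ideal.span (MvPolynomial.X '' {q : Fin (s + 1) | d < (q : ℕ)}) := by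
  rw [coordIdeal]
  congr 1
  ext p
  exact ⟨fun ⟨i, hi, h⟩ => ⟨i, hi, h.symm⟩, fun ⟨i, hi, h⟩ => ⟨i, hi, h.symm⟩⟩

theorem coordIdeal_eq_span :
    coordIdeal A s d = Ideal.span (coordVar A s d '' {j | j < s - d}) := by
  rw [coordIdeal_eq_span_image, image_coordVar le_rfl]
  congr 2
  ext q
  simp only [Set.mem_ofPred_eq]
  omega

theorem mem_coordIdeal_iff {p : MvPolynomial (Fin (s + 1)) A} :
    p ∈ coordIdeal A s d ↔ Kos.InSpan (coordVar A s d) (s - d) p := by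
  rw [Kos.inSpan_iff, coordIdeal_eq_span]

theorem coordVar_mem {j : ℕ} (hj : j < s - d) : coordVar A s d j ∈ coordIdeal A s d := by
  rw [coordIdeal_eq_span]
  exact Ideal.subset_span ⟨j, hj, rfl⟩

theorem map_coordIdeal {B : Type*} [CommRing B] (ρ : A →+* B) :
    (coordIdeal A s d).map (MvPolynomial.map ρ) = coordIdeal B s d := by
  rw [coordIdeal_eq_span, coordIdeal_eq_span, Ideal.map_span, Set.image_image]
  simp only [map_coordVar]

theorem weaklyRegular_coordVar :
    Kos.WeaklyRegular (MvPolynomial (Fin (s + 1)) A) (coordVar A s d) (s - d) := by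
  intro i hi p hp
  rw [Kos.inSpan_iff, image_coordVar hi.le, MvPolynomial.mem_ideal_span_X_image] at hp ⊢
  intro e he
  rw [coordVar_eq (by omega), smul_eq_mul, mul_comm] at hp
  obtain ⟨q, hq, h⟩ := hp (e + Finsupp.single ⟨d + 1 + i, by omega⟩ 1) (by
    rw [MvPolynomial.mem_support_iff, MvPolynomial.coeff_mul_X]
    exact MvPolynomial.mem_support_iff.1 he)
  refine ⟨q, hq, ?_⟩
  rwa [Finsupp.add_apply, Finsupp.single_eq_of_ne, add_zero] at h
  rintro rfl
  exact absurd hq.2 (by simp only; omega)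

/-- This turns the degree `l - ∑ w j` of `IsJoined.hcomp`, with `l = ∑ a i + k_Y`, into `k_Y - k_D`.
-/
theorem sum_coordWt (a : Fin (s + 1) → ℕ) (hd : d ≤ s) :
    ∑ j ∈ Finset.range (s - d), coordWt d a j =
      ∑ i, (a i : ℤ) -
        ∑ i ∈ Finset.univ.filter (fun i : Fin (s + 1) => (i : ℕ) ≤ d), (a i : ℤ) := by
  rw [eq_sub_iff_add_eq, ← Finset.sum_filter_add_sum_filter_not Finset.univ
    (fun i : Fin (s + 1) => (i : ℕ) ≤ d), add_comm]
  congr 1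
  refine Finset.sum_bij (fun j hj => ⟨d + 1 + j, by have := Finset.mem_range.1 hj; omega⟩) ?_ ?_ ?_ ?_
  · intro j hj
    rw [Finset.mem_filter]
    exact ⟨Finset.mem_univ _, by simp only; omega⟩
  · intro i hi j hj h
    simpa using h
  · intro q hq
    rw [Finset.mem_filter] at hq
    have := q.2
    exact ⟨q - (d + 1), Finset.mem_range.2 (by omega), Fin.ext (by simp only; omega)⟩
  · intro j hj
    have := Finset.mem_range.1 hj
    exact dif_pos (by omega)

end Coordinates

/-! ### Graded Nakayama with denominators in the base. -/

section Nakayama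

variable {A : Type*} [CommRing A] {σ : Type*} {a : σ → ℕ}

/-- Graded Nakayama lemma: the denominator can be chosen in the base ring. -/
theorem exists_C_smul_mem [IsNoetherianRing (MvPolynomial σ A)] (ha : ∀ i, 0 < a i) (t : A)
    {ι : Type*} [Fintype ι] (w : ι → ℤ) {N N' : Submodule (MvPolynomial σ A) (ι → MvPolynomial σ A)}
    (hN : ∀ k, ∀ y ∈ N, picomp a w k y ∈ N) (hN' : ∀ k, ∀ y ∈ N', picomp a w k y ∈ N')
    (h : ∀ y ∈ N, ∃ x ∈ N', ∃ z ∈ N, y = x + (MvPolynomial.C t : MvPolynomial σ A) • z) :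
    ∃ c : A, ∀ y ∈ N, (MvPolynomial.C (1 + t * c) : MvPolynomial σ A) • y ∈ N' := by
  classical
  -- The determinant trick gives `r ≡ 1` modulo `t` in the polynomial ring with `r N ⊂ N'`. Both
  -- submodules are graded, so the component of `r` of degree `0` also maps `N` into `N'`; as the
  -- weights are positive, it is a constant.
  obtain ⟨r, hr, hrN⟩ := Submodule.exists_sub_one_mem_and_smul_le_of_fg_of_le_sup
    (I := Ideal.span {MvPolynomial.C t}) (N := N') (N' := N) (P := N) (IsNoetherian.noetherian N)
    le_rfl (by
      intro y hy
      obtain ⟨x, hx, z, hz, rfl⟩ := h y hy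
      exact Submodule.add_mem_sup hx
        (Submodule.smul_mem_smul (Ideal.mem_span_singleton_self _) hz))
  obtain ⟨q, hq⟩ := Ideal.mem_span_singleton'.1 hr
  refine ⟨MvPolynomial.coeff 0 q, fun y hy => ?_⟩
  have hr0 : hcomp a 0 r = MvPolynomial.C (1 + t * MvPolynomial.coeff 0 q) := by
    rw [hcomp_zero ha, eq_add_of_sub_eq hq.symm, mul_comm q, MvPolynomial.coeff_add,
      MvPolynomial.coeff_C_mul, MvPolynomial.coeff_zero_one, add_comm]
  have key : ∀ k,
      (MvPolynomial.C (1 + t * MvPolynomial.coeff 0 q) : MvPolynomial σ A) • picomp a w k y ∈ N' := by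
    intro k
    have h1 := hN' k _ (hrN (Submodule.smul_mem_pointwise_smul _ r _ (hN k y hy)))
    convert! h1 using 1
    ext1 i
    rw [picomp_apply, Pi.smul_apply, Pi.smul_apply, smul_eq_mul, smul_eq_mul, picomp_apply, ← hr0,
      ← hcomp_mul_of_isHomog _ (isHomog_hcomp a _ _), zero_add]
  let K : Finset ℤ := Finset.univ.biUnion fun i =>
    (y i).support.image fun e => Finsupp.weight (wt a) e - w i
  have hy' : y = ∑ k ∈ K, picomp a w k y := by
    ext1 i
    rw [Finset.sum_apply]
    exact (sum_hcomp fun e he => Finset.mem_biUnion.2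
      ⟨i, Finset.mem_univ i, Finset.mem_image.2 ⟨e, he, rfl⟩⟩).symm
  rw [hy', Finset.smul_sum]
  exact Submodule.sum_mem _ fun k _ => key k

end Nakayama

end WeightedProj

namespace WeightedProj

/-! ### Existence of the unprojection near a closed point. -/

section LocalExistence

variable {A : Type u} [CommRing A] {s d : ℕ} {a : Fin (s + 1) → ℕ}

/-- The values `r j` at `x_{d + 1 + j}` of a homogeneous homomorphism of degree `b` that generates the
homomorphisms `I_D → A[x] / I` together with the inclusion, no element of `A[x] / I` being killed by
`I_D`. -/
structure IsUnprojectionTuple (a : Fin (s + 1) → ℕ) (d : ℕ) (I : Ideal (MvPolynomial (Fin (s + 1)) A))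
    (b : ℕ) (r : ℕ → MvPolynomial (Fin (s + 1)) A) : Prop where
  homog : ∀ j < s - d, IsHomog a (r j) (coordWt d a j + b)
  compat : IsCompatible I (coordVar A s d) (s - d) r
  colon : ∀ f, (∀ j < s - d, coordVar A s d j * f ∈ I) → f ∈ I
  gen : ∀ q, IsCompatible I (coordVar A s d) (s - d) q →
    ∃ p z, ∀ j < s - d, q j - (p * coordVar A s d j + z * r j) ∈ I

theorem IsHomogIdeal.mem_of_mul_mem {I : Ideal (MvPolynomial (Fin (s + 1)) A)}
    (hI : IsHomogIdeal a I) {j : ℕ} {f : MvPolynomial (Fin (s + 1)) A}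
    (h : coordVar A s d j * f ∈ I) (k : ℤ) : coordVar A s d j * hcomp a k f ∈ I := by
  rw [← hcomp_mul (isHomog_coordVar a j)]
  exact hI _ h _

theorem IsHomogIdeal.compatible_hcomp {I : Ideal (MvPolynomial (Fin (s + 1)) A)}
    (hI : IsHomogIdeal a I) {n : ℕ} {q : ℕ → MvPolynomial (Fin (s + 1)) A}
    (h : IsCompatible I (coordVar A s d) n q) (k : ℤ) :
    IsCompatible I (coordVar A s d) n fun j => hcomp a (k + coordWt d a j) (q j) := by
  intro i hi j hj
  convert! hI _ (h i hi j hj) (k + coordWt d a j + coordWt d a i) using 1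
  rw [map_sub, hcomp_mul (isHomog_coordVar a i),
    show k + coordWt d a j + coordWt d a i = k + coordWt d a i + coordWt d a j by ring,
    hcomp_mul (isHomog_coordVar a j)]

variable {κ : Type u} [Field κ] {ev : A →+* κ} {t : A}

theorem map_eq_zero_iff_dvd (hker : ∀ c, ev c = 0 ↔ ∃ c', c = t * c') {σ : Type*}
    (p : MvPolynomial σ A) :
    MvPolynomial.map ev p = 0 ↔ ∃ p', p = MvPolynomial.C t * p' := by
  have : RingHom.ker ev = Ideal.span {t} := by
    ext c
    rw [RingHom.mem_ker, hker, Ideal.mem_span_singleton]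
    rfl
  rw [← RingHom.mem_ker, MvPolynomial.ker_map, this, Ideal.map_span, Set.image_singleton,
    Ideal.mem_span_singleton]
  rfl

theorem C_mul_eq_zero (ht : ∀ c, t * c = 0 → c = 0) {σ : Type*} (p : MvPolynomial σ A)
    (h : MvPolynomial.C t * p = 0) : p = 0 := by
  ext e
  have := congrArg (MvPolynomial.coeff e) h
  rw [MvPolynomial.coeff_C_mul, MvPolynomial.coeff_zero] at this
  rw [ht _ this, MvPolynomial.coeff_zero]

/-- The Kustin-Miller homomorphism of the fibre lifts to a homogeneous homomorphism over the base,
and has the universal properties after inverting one element of the base. -/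
theorem exists_unprojection_tuple [IsNoetherianRing A] (ha : ∀ i, 0 < a i) (hds : d + 2 ≤ s)
    (hev : Function.Surjective ev) (ht : ∀ c, t * c = 0 → c = 0)
    (hker : ∀ c, ev c = 0 ↔ ∃ c', c = t * c') {I : Ideal (MvPolynomial (Fin (s + 1)) A)}
    (hI : IsHomogIdeal a I) (hIt : ∀ p, MvPolynomial.C t * p ∈ I → p ∈ I)
    (hID : I ≤ coordIdeal A s d) {kY : ℤ}
    (hGor : IsProjGorenstein a (I.map (MvPolynomial.map ev)) kY)
    (hdim : ringKrullDim (MvPolynomial (Fin (s + 1)) κ ⧸ I.map (MvPolynomial.map ev)) =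
      ((d + 2 : ℕ) : WithBot ℕ∞)) {b : ℕ}
    (hbk : (b : ℤ) =
      kY - (-∑ i ∈ Finset.univ.filter (fun i : Fin (s + 1) => (i : ℕ) ≤ d), (a i : ℤ))) :
    ∃ (g : A) (r : ℕ → MvPolynomial (Fin (s + 1)) A), ev g ≠ 0 ∧
      (∀ j < s - d, IsHomog a (r j) (coordWt d a j + b)) ∧
      IsCompatible I (coordVar A s d) (s - d) r ∧
      (∀ f, (∀ j < s - d, coordVar A s d j * f ∈ I) → MvPolynomial.C g * f ∈ I) ∧
      (∀ q, IsCompatible I (coordVar A s d) (s - d) q → ∃ p z, ∀ j < s - d,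
        MvPolynomial.C g * q j - (p * coordVar A s d j + z * r j) ∈ I) ∧
      IsUnprojectionTuple a d (I.map (MvPolynomial.map ev)) b
        (fun j => MvPolynomial.map ev (r j)) := by
  set x := coordVar A s d
  set x' := coordVar κ s d
  have hxx : ∀ j, MvPolynomial.map ev (x j) = x' j := map_coordVar ev
  obtain ⟨m, hm⟩ : ∃ m, s - d = m + 2 := ⟨s - d - 2, by omega⟩
  have hρ : Function.Surjective (MvPolynomial.map (σ := Fin (s + 1)) ev) :=
    MvPolynomial.map_surjective ev hev
  have hmem : ∀ p, MvPolynomial.map ev p ∈ I.map (MvPolynomial.map ev) →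
      ∃ p₁ ∈ I, ∃ p₂, p = p₁ + MvPolynomial.C t * p₂ := by
    intro p hp
    obtain ⟨p₁, hp₁, e⟩ := (Ideal.mem_map_iff_of_surjective _ hρ).1 hp
    obtain ⟨p₂, hp₂⟩ := (map_eq_zero_iff_dvd hker (p - p₁)).1 (by rw [map_sub, e, sub_self])
    exact ⟨p₁, hp₁, p₂, by rw [← hp₂]; ring⟩
  obtain ⟨F, v, hF, hv⟩ := hGor.exists_isGorensteinDual (m := m) hdim (by
    rw [Fintype.card_fin]; omega)
  have hx : Kos.WeaklyRegular _ x (s - d) := weaklyRegular_coordVar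
  have hx' : Kos.WeaklyRegular _ x' (s - d) := weaklyRegular_coordVar
  obtain ⟨r, hhom, hr, hj⟩ : ∃ r : ℕ → MvPolynomial (Fin (s + 1)) A,
      (∀ j, IsHomog a (r j) (coordWt d a j + b)) ∧ IsCompatible I x (s - d) r ∧
      IsJoined F.d x' (s - d) v (fun j => MvPolynomial.map ev (r j)) fun _ => 1 := by
    obtain ⟨r, hr, hj⟩ := exists_compatible_lift (C_mul_eq_zero ht) hρ (map_eq_zero_iff_dvd hker)
      hIt hx (fun p hp => mem_coordIdeal_iff.1 (hID hp)) hm F.exact_zero F.exact_succ hF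
    simp only [hxx] at hj
    -- The lifted tuple need not be homogeneous, but its component of degree `b` is still compatible
    -- and its reduction is still joined to `1`.
    have hj' := hj.hcomp F.homog (fun j _ => isHomog_coordVar a j) hv F.deg_zero (b := b) (by
      rw [sum_coordWt a (by omega), hbk]; ring)
    simp only [hcomp_map] at hj'
    have hr' := hI.compatible_hcomp hr b
    simp only [add_comm (b : ℤ)] at hr'
    exact ⟨_, fun j => isHomog_hcomp a _ _, hr', hj'⟩
  have hT : IsUnprojectionTuple a d (I.map (MvPolynomial.map ev)) b
      (fun j => MvPolynomial.map ev (r j)) := by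
    refine ⟨fun j _ => (hhom j).map ev, fun i hi j hj => ?_, fun f hf =>
      hF.mem_of_forall_mul_mem hx' (by omega) hf, fun q hq => hF.exists_of_compatible hx' hm hj hq⟩
    convert! Ideal.mem_map_of_mem (MvPolynomial.map ev) (hr i hi j hj) using 1
    rw [map_sub, map_mul, map_mul, hxx, hxx]
  -- Graded Nakayama for `(I : I_D)` and `I`, viewed as modules of vectors of length one.
  have hcol : ∃ c : A, ∀ f, (∀ j < s - d, x j * f ∈ I) → MvPolynomial.C (1 + t * c) * f ∈ I := by
    let N : Submodule (MvPolynomial (Fin (s + 1)) A) (Unit → MvPolynomial (Fin (s + 1)) A) :=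
      { carrier := {y | ∀ j < s - d, x j * y () ∈ I}
        add_mem' := fun hy hz j hj => by
          rw [Pi.add_apply, mul_add]
          exact I.add_mem (hy j hj) (hz j hj)
        zero_mem' := fun j hj => by rw [Pi.zero_apply, mul_zero]; exact I.zero_mem
        smul_mem' := fun p y hy j hj => by
          rw [Pi.smul_apply, smul_eq_mul, mul_left_comm]
          exact I.mul_mem_left _ (hy j hj) }
    obtain ⟨c, hc⟩ := exists_C_smul_mem ha t (fun _ : Unit => 0) (N := N)
      (N' := Submodule.comap (LinearMap.proj ()) I)
      (fun k y hy j hj => hI.mem_of_mul_mem (hy j hj) _) (fun k y hy => hI _ hy _) (by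
        -- On the fibre the colon ideal is `I`, so `y` is an element of `I` plus `t` times some
        -- `p₂`; `t` being regular modulo `I`, `p₂` is again in the colon ideal.
        intro y hy
        obtain ⟨p₁, hp₁, p₂, e⟩ := hmem (y ()) (hT.colon _ fun j hj => by
          convert! Ideal.mem_map_of_mem (MvPolynomial.map ev) (hy j hj) using 1
          rw [map_mul, hxx])
        refine ⟨fun _ => p₁, hp₁, fun _ => p₂, fun j hj => hIt _ ?_, funext fun _ => e⟩
        convert! I.sub_mem (hy j hj) (I.mul_mem_left (x j) hp₁) using 1
        rw [e]; ring)
    exact ⟨c, fun f hf => hc (fun _ => f) hf⟩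
  -- The same argument for the module of compatible tuples and its submodule generated, modulo `I`,
  -- by the tuples `x` and `r`.
  have hgen : ∃ c : A, ∀ q, IsCompatible I x (s - d) q → ∃ p z, ∀ j < s - d,
        MvPolynomial.C (1 + t * c) * q j - (p * x j + z * r j) ∈ I := by
    let N : Submodule (MvPolynomial (Fin (s + 1)) A)
        (Fin (s - d) → MvPolynomial (Fin (s + 1)) A) :=
      { carrier := {y | ∀ i j : Fin (s - d), x i * y j - x j * y i ∈ I}
        add_mem' := fun {y z} hy hz i j => by
          convert! I.add_mem (hy i j) (hz i j) using 1
          simp only [Pi.add_apply]; ring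
        zero_mem' := fun i j => by simp
        smul_mem' := fun p y hy i j => by
          convert! I.mul_mem_left p (hy i j) using 1
          simp only [Pi.smul_apply, smul_eq_mul]; ring }
    let N' : Submodule (MvPolynomial (Fin (s + 1)) A)
        (Fin (s - d) → MvPolynomial (Fin (s + 1)) A) :=
      { carrier := {y | ∃ p z, ∀ j : Fin (s - d), y j - (p * x j + z * r j) ∈ I}
        add_mem' := by
          rintro y y' ⟨p, z, h⟩ ⟨p', z', h'⟩
          refine ⟨p + p', z + z', fun j => ?_⟩
          convert! I.add_mem (h j) (h' j) using 1
          simp only [Pi.add_apply]; ring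
        zero_mem' := ⟨0, 0, fun j => by simp⟩
        smul_mem' := by
          rintro c y ⟨p, z, h⟩
          refine ⟨c * p, c * z, fun j => ?_⟩
          convert! I.mul_mem_left c (h j) using 1
          simp only [Pi.smul_apply, smul_eq_mul]; ring }
    obtain ⟨c, hc⟩ := exists_C_smul_mem ha t (fun j : Fin (s - d) => coordWt d a j) (N := N)
      (N' := N') (by
        intro k y hy i j
        convert! hI _ (hy i j) (k + coordWt d a j + coordWt d a i) using 1
        rw [map_sub, hcomp_mul (isHomog_coordVar a i),
          show k + coordWt d a j + coordWt d a i = k + coordWt d a i + coordWt d a j by ring,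
          hcomp_mul (isHomog_coordVar a j)]
        rfl) (by
        rintro k y ⟨p, z, h⟩
        refine ⟨hcomp a k p, hcomp a (k - b) z, fun j => ?_⟩
        convert! hI _ (h j) (k + coordWt d a j) using 1
        rw [map_sub, map_add, hcomp_mul_of_isHomog _ (isHomog_coordVar a j),
          show k + coordWt d a j = k - b + (coordWt d a j + b) by ring,
          hcomp_mul_of_isHomog _ (hhom j), picomp_apply,
          show k + coordWt d a j = k - b + (coordWt d a j + b) by ring]) (by
        intro y hy
        let y' : ℕ → MvPolynomial (Fin (s + 1)) A := fun j => if h : j < s - d then y ⟨j, h⟩ else 0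
        have hy' : ∀ j (hj : j < s - d), y' j = y ⟨j, hj⟩ := fun j hj => dif_pos hj
        obtain ⟨p', z', h⟩ := hT.gen (fun j => MvPolynomial.map ev (y' j)) fun i hi j hj => by
          convert! Ideal.mem_map_of_mem (MvPolynomial.map ev) (hy ⟨i, hi⟩ ⟨j, hj⟩) using 1
          simp only [map_sub, map_mul, hxx, hy' _ hi, hy' _ hj, x']
        obtain ⟨p, rfl⟩ := hρ p'
        obtain ⟨z, rfl⟩ := hρ z'
        have h1 : ∀ j : Fin (s - d), ∃ p₁ ∈ I, ∃ p₂,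
            y j - (p * x j + z * r j) = p₁ + MvPolynomial.C t * p₂ := fun j => hmem _ (by
          convert! h j j.2 using 1
          rw [map_sub, map_add, map_mul, map_mul, hxx, hy' _ j.2])
        choose p₁ hp₁ p₂ e using h1
        refine ⟨fun j => p * x j + z * r j + p₁ j, ⟨p, z, fun j => ?_⟩, p₂, fun i j => hIt _ ?_,
          funext fun j => ?_⟩
        · rw [add_sub_cancel_left]
          exact hp₁ j
        · have h2 := I.sub_mem (I.sub_mem (hy i j) (I.mul_mem_left z (hr i i.2 j j.2)))
            (I.sub_mem (I.mul_mem_left (x i) (hp₁ j)) (I.mul_mem_left (x j) (hp₁ i)))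
          convert! h2 using 1
          linear_combination (-x i) * e j + x j * e i
        · change y j = _ + MvPolynomial.C t * p₂ j
          linear_combination e j)
    refine ⟨c, fun q hq => ?_⟩
    obtain ⟨p, z, h⟩ := hc (fun j => q j) fun i j => hq i i.2 j j.2
    exact ⟨p, z, fun j hj => h ⟨j, hj⟩⟩
  obtain ⟨c₁, h₁⟩ := hcol
  obtain ⟨c₂, h₂⟩ := hgen
  have htz : ev t = 0 := (hker t).2 ⟨1, (mul_one t).symm⟩
  refine ⟨(1 + t * c₁) * (1 + t * c₂), r, by simp [htz], fun j _ => hhom j, hr, fun f hf => ?_,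
    fun q hq => ?_, hT⟩
  · rw [mul_comm (1 + t * c₁), map_mul, mul_assoc]
    exact I.mul_mem_left _ (h₁ f hf)
  · obtain ⟨p, z, h⟩ := h₂ q hq
    refine ⟨MvPolynomial.C (1 + t * c₁) * p, MvPolynomial.C (1 + t * c₁) * z, fun j hj => ?_⟩
    convert! I.mul_mem_left (MvPolynomial.C (1 + t * c₁)) (h j hj) using 1
    rw [map_mul]; ring

end LocalExistence

end WeightedProj

namespace WeightedProj

/-! ### Between compatible tuples, homomorphisms and unprojection ideals. -/

section UnprojectionHom

variable {A : Type u} [CommRing A] {s d : ℕ} {a : Fin (s + 1) → ℕ} {b : ℕ}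
  {I : Ideal (MvPolynomial (Fin (s + 1)) A)}

/-- The element `x_{d + 1 + j}` of the ideal of `D` in the coordinate ring of `Y`. -/
noncomputable def coordElem (I : Ideal (MvPolynomial (Fin (s + 1)) A)) (d : ℕ) (j : ℕ)
    (hj : j < s - d) : idealIn I (coordIdeal A s d) :=
  ⟨Ideal.Quotient.mk I (coordVar A s d j), Ideal.mem_map_of_mem _ (coordVar_mem hj)⟩

theorem exists_sum_of_mem_coordIdeal {p : MvPolynomial (Fin (s + 1)) A}
    (hp : p ∈ coordIdeal A s d) :
    ∃ c : Fin (s - d) → MvPolynomial (Fin (s + 1)) A, p = ∑ j, c j * coordVar A s d j := by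
  have : coordIdeal A s d =
      Ideal.span (Set.range fun j : Fin (s - d) => coordVar A s d j) := by
    rw [coordIdeal_eq_span]
    congr 1
    ext q
    exact ⟨fun ⟨j, hj, h⟩ => ⟨⟨j, hj⟩, h⟩, fun ⟨j, h⟩ => ⟨j, j.2, h⟩⟩
  rw [this] at hp
  obtain ⟨c, hc⟩ := (Ideal.mem_span_range_iff_exists_fun).1 hp
  exact ⟨c, hc.symm⟩

theorem exists_eq_sum_coordElem (f : idealIn I (coordIdeal A s d)) :
    ∃ c : Fin (s - d) → MvPolynomial (Fin (s + 1)) A,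
      f = ∑ j, Ideal.Quotient.mk I (c j) • coordElem I d j j.2 := by
  obtain ⟨p, hp, e⟩ := (Ideal.mem_map_iff_of_surjective _ Ideal.Quotient.mk_surjective).1 f.2
  obtain ⟨c, rfl⟩ := exists_sum_of_mem_coordIdeal hp
  refine ⟨c, Subtype.ext ?_⟩
  rw [← e, map_sum, Submodule.coe_sum]
  exact Finset.sum_congr rfl fun j _ => map_mul _ _ _

theorem hom_ext {φ ψ : idealIn I (coordIdeal A s d) →ₗ[MvPolynomial (Fin (s + 1)) A ⧸ I]
    (MvPolynomial (Fin (s + 1)) A ⧸ I)}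
    (h : ∀ j (hj : j < s - d), φ (coordElem I d j hj) = ψ (coordElem I d j hj)) : φ = ψ := by
  ext f
  obtain ⟨c, rfl⟩ := exists_eq_sum_coordElem f
  simp only [map_sum, map_smul, h]

/-- Compatibility covers only the Koszul relations among the `x_j`. For a general relation `∑ c_j
x_j ∈ I` it shows that each `x_i` multiplies `∑ c_j r_j` into `I`, and the colon hypothesis
concludes. -/
theorem exists_hom {r : ℕ → MvPolynomial (Fin (s + 1)) A}
    (hr : IsCompatible I (coordVar A s d) (s - d) r)
    (hcol : ∀ f, (∀ j < s - d, coordVar A s d j * f ∈ I) → f ∈ I) :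
    ∃ φ : idealIn I (coordIdeal A s d) →ₗ[MvPolynomial (Fin (s + 1)) A ⧸ I]
      (MvPolynomial (Fin (s + 1)) A ⧸ I),
      ∀ j (hj : j < s - d), φ (coordElem I d j hj) = Ideal.Quotient.mk I (r j) := by
  let ψ₁ := Fintype.linearCombination (MvPolynomial (Fin (s + 1)) A ⧸ I)
    fun j : Fin (s - d) => coordElem I d j j.2
  let ψ₂ := Fintype.linearCombination (MvPolynomial (Fin (s + 1)) A ⧸ I)
    fun j : Fin (s - d) => Ideal.Quotient.mk I (r j)
  have hs : Function.Surjective ψ₁ := fun f => by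
    obtain ⟨c, rfl⟩ := exists_eq_sum_coordElem f
    exact ⟨fun j => Ideal.Quotient.mk I (c j), Fintype.linearCombination_apply _ _ _⟩
  have hk : LinearMap.ker ψ₁ ≤ LinearMap.ker ψ₂ := by
    intro c hc
    choose c' hc' using fun j => Ideal.Quotient.mk_surjective (I := I) (c j)
    obtain rfl : (fun j => Ideal.Quotient.mk I (c' j)) = c := funext hc'
    have h1 : ∑ j, c' j * coordVar A s d j ∈ I := by
      have := congrArg Subtype.val (LinearMap.mem_ker.1 hc)
      rw [Fintype.linearCombination_apply, Submodule.coe_sum] at this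
      rw [← Ideal.Quotient.eq_zero_iff_mem, map_sum]
      refine Eq.trans (Finset.sum_congr rfl fun j _ => ?_) this
      exact map_mul _ _ _
    have h2 : ∑ j : Fin (s - d), c' j * r j ∈ I := hcol _ fun i hi => by
      have h3 := I.add_mem (I.sum_mem fun (j : Fin (s - d)) (_ : j ∈ Finset.univ) =>
        I.mul_mem_left (c' j) (hr i hi j j.2)) (I.mul_mem_left (r i) h1)
      convert! h3 using 1
      rw [Finset.mul_sum, Finset.mul_sum, ← Finset.sum_add_distrib]
      exact Finset.sum_congr rfl fun j _ => by ring
    rw [LinearMap.mem_ker, Fintype.linearCombination_apply]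
    rw [← Ideal.Quotient.eq_zero_iff_mem, map_sum] at h2
    refine Eq.trans (Finset.sum_congr rfl fun j _ => ?_) h2
    exact (map_mul _ _ _).symm
  refine ⟨(LinearMap.ker ψ₁).liftQ ψ₂ hk ∘ₗ (ψ₁.quotKerEquivOfSurjective hs).symm.toLinearMap,
    fun j hj => ?_⟩
  have h1 : ψ₁ (Pi.single ⟨j, hj⟩ 1) = coordElem I d j hj := by
    rw [Fintype.linearCombination_apply_single, one_smul]
  have h2 : (ψ₁.quotKerEquivOfSurjective hs).symm (coordElem I d j hj) =
      Submodule.Quotient.mk (Pi.single ⟨j, hj⟩ 1) := by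
    rw [LinearEquiv.symm_apply_eq, ← h1]
    rfl
  rw [LinearMap.comp_apply, LinearEquiv.coe_coe, h2, Submodule.liftQ_apply,
    Fintype.linearCombination_apply_single, one_smul]

theorem isCompatible_of_hom {φ : idealIn I (coordIdeal A s d) →ₗ[MvPolynomial (Fin (s + 1)) A ⧸ I]
      (MvPolynomial (Fin (s + 1)) A ⧸ I)} {q : ℕ → MvPolynomial (Fin (s + 1)) A}
    (hq : ∀ j (hj : j < s - d), φ (coordElem I d j hj) = Ideal.Quotient.mk I (q j)) :
    IsCompatible I (coordVar A s d) (s - d) q := by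
  intro i hi j hj
  rw [← Ideal.Quotient.eq_zero_iff_mem, map_sub, map_mul, map_mul, ← hq i hi, ← hq j hj,
    ← smul_eq_mul, ← smul_eq_mul, ← map_smul, ← map_smul, ← map_sub]
  convert! map_zero φ
  rw [sub_eq_zero]
  exact Subtype.ext (mul_comm _ _)

theorem IsUnprojectionTuple.exists_isUnprojectionHom {r : ℕ → MvPolynomial (Fin (s + 1)) A}
    (h : IsUnprojectionTuple a d I b r) (hI : I ≤ coordIdeal A s d) :
    ∃ φ, IsUnprojectionHom a I (coordIdeal A s d) b φ ∧
      ∀ j (hj : j < s - d), φ (coordElem I d j hj) = Ideal.Quotient.mk I (r j) := by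
  obtain ⟨φ, hφ⟩ := exists_hom h.compat h.colon
  refine ⟨φ, ⟨fun m f => ?_, ?_⟩, hφ⟩
  · rintro ⟨p, hp, e⟩
    -- Because `I ⊂ I_D`, the homogeneous representative itself lies in the ideal of `D`, so its
    -- coefficients in the `x_j` can be taken homogeneous.
    have hpD : p ∈ coordIdeal A s d := by
      obtain ⟨p', hp', e'⟩ :=
        (Ideal.mem_map_iff_of_surjective _ Ideal.Quotient.mk_surjective).1 f.2
      rw [← e, Ideal.Quotient.eq] at e'
      have := Ideal.sub_mem _ hp' (hI e')
      rwa [sub_sub_cancel] at this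
    obtain ⟨c, hc⟩ := exists_sum_of_mem_coordIdeal hpD
    have hp' : p = ∑ j : Fin (s - d), hcomp a (m - coordWt d a j) (c j) * coordVar A s d j := by
      rw [← MvPolynomial.weightedHomogeneousComponent_eq_self hp, hc, map_sum]
      refine Finset.sum_congr rfl fun j _ => ?_
      rw [← hcomp_mul_of_isHomog _ (isHomog_coordVar a j), sub_add_cancel]
    refine ⟨∑ j : Fin (s - d), hcomp a (m - coordWt d a j) (c j) * r j,
      MvPolynomial.IsWeightedHomogeneous.sum _ _ _ fun j _ => ?_, ?_⟩
    · have := (isHomog_hcomp a (m - coordWt d a j) (c j)).mul (h.homog j j.2)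
      rwa [show m - coordWt d a j + (coordWt d a j + b) = m + b by ring] at this
    · have hf : f = ∑ j : Fin (s - d),
          Ideal.Quotient.mk I (hcomp a (m - coordWt d a j) (c j)) • coordElem I d j j.2 := by
        refine Subtype.ext ?_
        rw [← e, hp', map_sum, Submodule.coe_sum]
        exact Finset.sum_congr rfl fun j _ => map_mul _ _ _
      rw [hf, map_sum, map_sum]
      refine Finset.sum_congr rfl fun j _ => ?_
      rw [map_smul, hφ, map_mul]
      rfl
  · rw [eq_top_iff]
    rintro ψ -
    choose! q hq using fun j (hj : j < s - d) =>
      Ideal.Quotient.mk_surjective (I := I) (ψ (coordElem I d j hj))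
    obtain ⟨p, z, hpz⟩ := h.gen q (isCompatible_of_hom fun j hj => (hq j hj).symm)
    rw [Submodule.mem_span_pair]
    refine ⟨Ideal.Quotient.mk I p, Ideal.Quotient.mk I z, hom_ext fun j hj => ?_⟩
    have := hpz j hj
    rw [← Ideal.Quotient.eq, map_add, map_mul, map_mul, hq j hj, ← hφ j hj] at this
    exact this.symm

theorem IsUnprojectionHom.exists_repr {φ : idealIn I (coordIdeal A s d)
      →ₗ[MvPolynomial (Fin (s + 1)) A ⧸ I] (MvPolynomial (Fin (s + 1)) A ⧸ I)}
    (h : IsUnprojectionHom a I (coordIdeal A s d) b φ) :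
    ∃ q : ℕ → MvPolynomial (Fin (s + 1)) A, (∀ j < s - d, IsHomog a (q j) (coordWt d a j + b)) ∧
      ∀ j (hj : j < s - d), φ (coordElem I d j hj) = Ideal.Quotient.mk I (q j) := by
  have : ∀ j (hj : j < s - d), ∃ g, IsHomog a g (coordWt d a j + b) ∧
      Ideal.Quotient.mk I g = φ (coordElem I d j hj) := fun j hj =>
    h.homog _ _ ⟨_, isHomog_coordVar a j, rfl⟩
  choose! q hq hq' using this
  exact ⟨q, hq, fun j hj => (hq' j hj).symm⟩

theorem IsUnprojectionHom.exists_of_tuple {φ : idealIn I (coordIdeal A s d)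
      →ₗ[MvPolynomial (Fin (s + 1)) A ⧸ I] (MvPolynomial (Fin (s + 1)) A ⧸ I)}
    (h : IsUnprojectionHom a I (coordIdeal A s d) b φ) {q : ℕ → MvPolynomial (Fin (s + 1)) A}
    (hq : ∀ j (hj : j < s - d), φ (coordElem I d j hj) = Ideal.Quotient.mk I (q j))
    {r : ℕ → MvPolynomial (Fin (s + 1)) A} (hr : IsUnprojectionTuple a d I b r) :
    ∃ p z, ∀ j < s - d, r j - (p * coordVar A s d j + z * q j) ∈ I := by
  obtain ⟨ψ, hψ⟩ := exists_hom hr.compat hr.colon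
  have hmem : ψ ∈ Submodule.span (MvPolynomial (Fin (s + 1)) A ⧸ I)
      {(idealIn I (coordIdeal A s d)).subtype, φ} := by
    rw [h.generates]; trivial
  obtain ⟨p', z', e⟩ := Submodule.mem_span_pair.1 hmem
  obtain ⟨p, rfl⟩ := Ideal.Quotient.mk_surjective p'
  obtain ⟨z, rfl⟩ := Ideal.Quotient.mk_surjective z'
  refine ⟨p, z, fun j hj => ?_⟩
  rw [← Ideal.Quotient.eq, ← hψ j hj, ← e, map_add, map_mul, map_mul, ← hq j hj]
  rfl

/-- The ideal generated by `I` and the elements `S x_{d + 1 + j} - q j`. -/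
noncomputable def tupleIdeal (I : Ideal (MvPolynomial (Fin (s + 1)) A)) (d : ℕ)
    (q : ℕ → MvPolynomial (Fin (s + 1)) A) : Ideal (MvPolynomial (Option (Fin (s + 1))) A) :=
  I.map (MvPolynomial.rename (R := A) (some : Fin (s + 1) → Option (Fin (s + 1)))) ⊔
    Ideal.span ((fun j => MvPolynomial.X none * MvPolynomial.rename some (coordVar A s d j) -
      MvPolynomial.rename some (q j)) '' {j | j < s - d})

/-- Linearity of `φ` reduces the relations to the generators of `I_D`. This finite presentation
visibly commutes with base change. -/
theorem unprojectionIdeal_eq {φ : idealIn I (coordIdeal A s d)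
      →ₗ[MvPolynomial (Fin (s + 1)) A ⧸ I] (MvPolynomial (Fin (s + 1)) A ⧸ I)}
    {q : ℕ → MvPolynomial (Fin (s + 1)) A}
    (hq : ∀ j (hj : j < s - d), φ (coordElem I d j hj) = Ideal.Quotient.mk I (q j)) :
    unprojectionIdeal I (coordIdeal A s d) φ = tupleIdeal I d q := by
  refine le_antisymm (sup_le le_sup_left (Ideal.span_le.2 ?_))
    (sup_le le_sup_left (Ideal.span_le.2 ?_))
  · rintro _ ⟨f, hf, g, hg, rfl⟩
    obtain ⟨c, hc⟩ := exists_sum_of_mem_coordIdeal hf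
    have h1 : g - ∑ j : Fin (s - d), c j * q j ∈ I := by
      rw [← Ideal.Quotient.eq, hg, map_sum]
      have : (⟨Ideal.Quotient.mk I f, Ideal.mem_map_of_mem (Ideal.Quotient.mk I) hf⟩ :
          idealIn I (coordIdeal A s d)) =
            ∑ j, Ideal.Quotient.mk I (c j) • coordElem I d j j.2 := by
        refine Subtype.ext ?_
        rw [Submodule.coe_sum]
        simp only [hc, map_sum]
        exact Finset.sum_congr rfl fun j _ => map_mul _ _ _
      rw [this, map_sum]
      refine Finset.sum_congr rfl fun j _ => ?_
      rw [map_smul, hq, map_mul]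
      rfl
    have h2 : MvPolynomial.X none * MvPolynomial.rename some f - MvPolynomial.rename some g =
        ∑ j : Fin (s - d), MvPolynomial.rename some (c j) *
          (MvPolynomial.X none * MvPolynomial.rename some (coordVar A s d j) -
            MvPolynomial.rename some (q j)) -
        MvPolynomial.rename some (g - ∑ j : Fin (s - d), c j * q j) := by
      rw [hc]
      simp only [map_sub, map_sum, map_mul, mul_sub, Finset.sum_sub_distrib, Finset.mul_sum,
        mul_left_comm]
      abel
    rw [SetLike.mem_coe, h2]
    refine Ideal.sub_mem _ (Ideal.sum_mem _ fun j _ => Ideal.mul_mem_left _ _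
      (Ideal.mem_sup_right (Ideal.subset_span ⟨j, j.2, rfl⟩)))
      (Ideal.mem_sup_left (Ideal.mem_map_of_mem _ h1))
  · rintro _ ⟨j, hj, rfl⟩
    exact Ideal.mem_sup_right (Ideal.subset_span ⟨_, coordVar_mem hj, _, (hq j hj).symm, rfl⟩)

theorem map_tupleIdeal {B : Type*} [CommRing B] (ρ : A →+* B)
    (q : ℕ → MvPolynomial (Fin (s + 1)) A) :
    (tupleIdeal I d q).map (MvPolynomial.map ρ) =
      tupleIdeal (I.map (MvPolynomial.map ρ)) d fun j => MvPolynomial.map ρ (q j) := by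
  rw [tupleIdeal, tupleIdeal, Ideal.map_sup, Ideal.map_span, Set.image_image]
  congr 1
  · change Ideal.map _ (Ideal.map (MvPolynomial.rename some).toRingHom _) =
      Ideal.map (MvPolynomial.rename some).toRingHom _
    rw [Ideal.map_map, Ideal.map_map]
    congr 1
    exact RingHom.ext fun p => MvPolynomial.map_rename _ _ _
  · simp only [map_sub, map_mul, MvPolynomial.map_X, MvPolynomial.map_rename, map_coordVar]

/-- A homogeneous generator of the homomorphisms restricts to one on the fibre, when the
homomorphisms of the fibre lift. -/
theorem IsUnprojectionHom.isUnprojection_map {κ : Type u} [CommRing κ] {ev : A →+* κ}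
    (hI : I ≤ coordIdeal A s d)
    {φ : idealIn I (coordIdeal A s d)
      →ₗ[MvPolynomial (Fin (s + 1)) A ⧸ I] (MvPolynomial (Fin (s + 1)) A ⧸ I)}
    (h : IsUnprojectionHom a I (coordIdeal A s d) b φ) {r : ℕ → MvPolynomial (Fin (s + 1)) A}
    (hr : IsUnprojectionTuple a d I b r)
    (hr' : IsUnprojectionTuple a d (I.map (MvPolynomial.map ev)) b
      fun j => MvPolynomial.map ev (r j)) :
    IsUnprojection a (I.map (MvPolynomial.map ev)) (coordIdeal κ s d) b
      ((unprojectionIdeal I (coordIdeal A s d) φ).map (MvPolynomial.map ev)) := by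
  obtain ⟨q, hqh, hq⟩ := h.exists_repr
  -- The known tuple `r` equals `p x + z q` modulo `I`. After reduction, whatever `r` and `x`
  -- generate on the fibre is also generated by `q` and `x`.
  obtain ⟨p, z, hpz⟩ := h.exists_of_tuple hq hr
  have hq' : IsUnprojectionTuple a d (I.map (MvPolynomial.map ev)) b
      fun j => MvPolynomial.map ev (q j) := by
    refine ⟨fun j hj => (hqh j hj).map ev, fun i hi j hj => ?_, hr'.colon, fun y hy => ?_⟩
    · convert! Ideal.mem_map_of_mem (MvPolynomial.map ev) (isCompatible_of_hom hq i hi j hj) using 1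
      rw [map_sub, map_mul, map_mul, map_coordVar, map_coordVar]
    · obtain ⟨p', z', h'⟩ := hr'.gen y hy
      refine ⟨p' + z' * MvPolynomial.map ev p, z' * MvPolynomial.map ev z, fun j hj => ?_⟩
      have h1 := Ideal.mul_mem_left _ z' (Ideal.mem_map_of_mem (MvPolynomial.map ev) (hpz j hj))
      convert! Ideal.add_mem _ (h' j hj) h1 using 1
      rw [map_sub, map_add, map_mul, map_mul, map_coordVar]
      ring
  obtain ⟨ψ, hψ, hψq⟩ := hq'.exists_isUnprojectionHom (by
    rw [← map_coordIdeal ev]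
    exact Ideal.map_mono hI)
  exact ⟨ψ, hψ, by rw [unprojectionIdeal_eq hψq, unprojectionIdeal_eq hq, map_tupleIdeal]⟩

end UnprojectionHom

end WeightedProj

namespace WeightedProj

/-! ### Flatness of the unprojection by normal forms. -/

section Flat

variable {A : Type u} [CommRing A] {s d : ℕ}

theorem flat_prod (R M N : Type*) [CommRing R] [AddCommGroup M] [AddCommGroup N] [Module R M]
    [Module R N] [Module.Flat R M] [Module.Flat R N] : Module.Flat R (M × N) := by
  refine Module.Flat.iff_rTensor_injectiveₛ.2 fun P _ _ Q => ?_
  have h : (TensorProduct.prodRight R R P M N : _ → _) ∘ Q.subtype.rTensor (M × N) =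
      Prod.map (Q.subtype.rTensor M) (Q.subtype.rTensor N) ∘ TensorProduct.prodRight R R Q M N := by
    refine congrArg (fun f : _ →ₗ[R] _ => (f : _ → _)) (?_ :
      (TensorProduct.prodRight R R P M N).toLinearMap ∘ₗ Q.subtype.rTensor (M × N) =
      LinearMap.prodMap (Q.subtype.rTensor M) (Q.subtype.rTensor N) ∘ₗ
        (TensorProduct.prodRight R R Q M N).toLinearMap)
    exact TensorProduct.ext' fun x y => rfl
  have h1 : Function.Injective (Q.subtype.rTensor M) :=
    Module.Flat.rTensor_preserves_injective_linearMap _ Q.subtype_injective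
  have h2 : Function.Injective (Q.subtype.rTensor N) :=
    Module.Flat.rTensor_preserves_injective_linearMap _ Q.subtype_injective
  refine Function.Injective.of_comp (f := TensorProduct.prodRight R R P M N) ?_
  rw [h]
  exact (h1.prodMap h2).comp (TensorProduct.prodRight R R Q M N).injective

/-- Setting the equations of `D` to zero. -/
noncomputable def restrictCoord (A : Type u) [CommRing A] (s d : ℕ) :
    MvPolynomial (Fin (s + 1)) A →ₐ[A] MvPolynomial (Fin (s + 1)) A :=
  MvPolynomial.aeval fun i => if d < (i : ℕ) then 0 else MvPolynomial.X i

theorem restrictCoord_eq_zero {p : MvPolynomial (Fin (s + 1)) A} (hp : p ∈ coordIdeal A s d) :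
    restrictCoord A s d p = 0 := by
  have : coordIdeal A s d ≤ RingHom.ker (restrictCoord A s d) := by
    rw [coordIdeal, Ideal.span_le]
    rintro _ ⟨i, hi, rfl⟩
    rw [SetLike.mem_coe, RingHom.mem_ker, restrictCoord, MvPolynomial.aeval_X, if_pos hi]
  exact this hp

theorem sub_restrictCoord_mem (p : MvPolynomial (Fin (s + 1)) A) :
    p - restrictCoord A s d p ∈ coordIdeal A s d := by
  have : (Ideal.Quotient.mkₐ A (coordIdeal A s d)).comp (restrictCoord A s d) =
      Ideal.Quotient.mkₐ A (coordIdeal A s d) := by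
    refine MvPolynomial.algHom_ext fun i => ?_
    rw [AlgHom.comp_apply, restrictCoord, MvPolynomial.aeval_X]
    split_ifs with h
    · have : MvPolynomial.X i ∈ coordIdeal A s d := Ideal.subset_span ⟨i, h, rfl⟩
      rw [map_zero]
      exact (Ideal.Quotient.eq_zero_iff_mem.2 this).symm
    · rfl
  rw [← Ideal.Quotient.eq]
  exact (DFunLike.congr_fun this p).symm

theorem coordIdeal_mem_iff_restrictCoord {p : MvPolynomial (Fin (s + 1)) A} :
    p ∈ coordIdeal A s d ↔ restrictCoord A s d p = 0 := by
  refine ⟨restrictCoord_eq_zero, fun h => ?_⟩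
  have := sub_restrictCoord_mem (d := d) p
  rwa [h, sub_zero] at this

/-- The section of the projection from the polynomial ring to the coordinate ring of `D`. -/
noncomputable def coordSection (A : Type u) [CommRing A] (s d : ℕ) :
    (MvPolynomial (Fin (s + 1)) A ⧸ coordIdeal A s d) →ₐ[A] MvPolynomial (Fin (s + 1)) A :=
  Ideal.Quotient.liftₐ _ (restrictCoord A s d) fun _ => restrictCoord_eq_zero

theorem flat_coordIdeal_quotient :
    Module.Flat A (MvPolynomial (Fin (s + 1)) A ⧸ coordIdeal A s d) := by
  refine Module.Flat.of_retract (coordSection A s d).toLinearMap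
    (Ideal.Quotient.mkₐ A (coordIdeal A s d)).toLinearMap ?_
  refine LinearMap.ext fun q => ?_
  obtain ⟨p, rfl⟩ := Ideal.Quotient.mk_surjective q
  exact (Ideal.Quotient.eq.2 (sub_restrictCoord_mem p)).symm

variable {I : Ideal (MvPolynomial (Fin (s + 1)) A)} (hI : I ≤ coordIdeal A s d)
  (φ : idealIn I (coordIdeal A s d) →ₗ[MvPolynomial (Fin (s + 1)) A ⧸ I]
    (MvPolynomial (Fin (s + 1)) A ⧸ I))

/-- The difference of `r` and its restriction to `D`, as an element of the ideal of `D`. -/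
noncomputable def coordRemainder : (MvPolynomial (Fin (s + 1)) A ⧸ I) →ₗ[A]
    idealIn I (coordIdeal A s d) :=
  LinearMap.codRestrict ((idealIn I (coordIdeal A s d)).restrictScalars A)
    (LinearMap.id - (Ideal.Quotient.mkₐ A I).toLinearMap ∘ₗ (coordSection A s d).toLinearMap ∘ₗ
      (Ideal.Quotient.factorₐ A hI).toLinearMap) (by
    intro r
    obtain ⟨p, rfl⟩ := Ideal.Quotient.mk_surjective r
    exact Ideal.mem_map_of_mem (Ideal.Quotient.mk I) (sub_restrictCoord_mem p))

/-- The normal form of `S ^ j * r` in the unprojection. -/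
noncomputable def normalForm : ℕ → (MvPolynomial (Fin (s + 1)) A ⧸ I) →ₗ[A]
    (MvPolynomial (Fin (s + 1)) A ⧸ I) × (ℕ →₀ MvPolynomial (Fin (s + 1)) A ⧸ coordIdeal A s d)
  | 0 => LinearMap.inl A _ _
  -- Index `j` of the finitely supported part holds the coefficient of `S ^ (j + 1)`. The
  -- coefficient restricted to `D` stays there; the remainder lies in `I_D` and drops one power of
  -- `S` through `φ`.
  | j + 1 => LinearMap.inr A _ _ ∘ₗ Finsupp.lsingle j ∘ₗ (Ideal.Quotient.factorₐ A hI).toLinearMap +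
      normalForm j ∘ₗ φ.restrictScalars A ∘ₗ coordRemainder hI

theorem normalForm_succ_of_mem (j : ℕ) (f : idealIn I (coordIdeal A s d)) :
    normalForm hI φ (j + 1) f = normalForm hI φ j (φ f) := by
  obtain ⟨p, hp, e⟩ := (Ideal.mem_map_iff_of_surjective _ Ideal.Quotient.mk_surjective).1 f.2
  have h1 : Ideal.Quotient.factorₐ A hI (f : MvPolynomial (Fin (s + 1)) A ⧸ I) = 0 := by
    rw [← e]
    exact Ideal.Quotient.eq_zero_iff_mem.2 hp
  have h2 : coordRemainder hI f = f := by
    refine Subtype.ext ?_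
    change (f : MvPolynomial (Fin (s + 1)) A ⧸ I) - Ideal.Quotient.mk I (coordSection A s d
      (Ideal.Quotient.factorₐ A hI f)) = f
    rw [h1, map_zero, map_zero, sub_zero]
  change (0, Finsupp.single j (Ideal.Quotient.factorₐ A hI f)) +
    normalForm hI φ j (φ (coordRemainder hI f)) = _
  rw [h1, h2, Finsupp.single_zero, ← Prod.zero_eq_mk, zero_add]

/-- The normal form of a polynomial in `S`. -/
noncomputable def polyNormalForm : MvPolynomial (Option (Fin (s + 1))) A →ₗ[A]
    (MvPolynomial (Fin (s + 1)) A ⧸ I) × (ℕ →₀ MvPolynomial (Fin (s + 1)) A ⧸ coordIdeal A s d) :=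
  Polynomial.lsum (fun j => normalForm hI φ j ∘ₗ (Ideal.Quotient.mkₐ A I).toLinearMap) ∘ₗ
    (MvPolynomial.optionEquivLeft A (Fin (s + 1))).toLinearMap

theorem optionEquivLeft_symm_monomial {σ : Type*} (j : ℕ) (p : MvPolynomial σ A) :
    (MvPolynomial.optionEquivLeft A σ).symm (Polynomial.monomial j p) =
      MvPolynomial.X none ^ j * MvPolynomial.rename some p := by
  have h : ((MvPolynomial.optionEquivLeft A σ).toAlgHom.comp
      (MvPolynomial.rename (R := A) (some : σ → Option σ))) =
      (Polynomial.CAlgHom (R := MvPolynomial σ A) (A := MvPolynomial σ A)).restrictScalars A := by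
    refine MvPolynomial.algHom_ext fun i => ?_
    change MvPolynomial.optionEquivLeft A σ (MvPolynomial.rename some (MvPolynomial.X i)) =
      Polynomial.C (MvPolynomial.X i)
    rw [MvPolynomial.rename_X, MvPolynomial.optionEquivLeft_X_some]
  have h' : MvPolynomial.optionEquivLeft A σ (MvPolynomial.rename some p) = Polynomial.C p :=
    DFunLike.congr_fun h p
  rw [AlgEquiv.symm_apply_eq, map_mul, map_pow, MvPolynomial.optionEquivLeft_X_none, h',
    ← Polynomial.C_mul_X_pow_eq_monomial, mul_comm]

theorem polyNormalForm_monomial (j : ℕ) (p : MvPolynomial (Fin (s + 1)) A) :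
    polyNormalForm hI φ (MvPolynomial.X none ^ j * MvPolynomial.rename some p) =
      normalForm hI φ j (Ideal.Quotient.mk I p) := by
  rw [← optionEquivLeft_symm_monomial, polyNormalForm, LinearMap.comp_apply]
  change Polynomial.lsum _ (MvPolynomial.optionEquivLeft A _
    ((MvPolynomial.optionEquivLeft A _).symm _)) = _
  rw [AlgEquiv.apply_symm_apply, Polynomial.lsum_apply, Polynomial.sum_monomial_index]
  · rfl
  · exact map_zero _

theorem option_induction {σ : Type*} {motive : MvPolynomial (Option σ) A → Prop}
    (add : ∀ p q, motive p → motive q → motive (p + q))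
    (monomial : ∀ j p, motive (MvPolynomial.X none ^ j * MvPolynomial.rename some p))
    (p : MvPolynomial (Option σ) A) : motive p := by
  rw [← (MvPolynomial.optionEquivLeft A σ).symm_apply_apply p]
  induction MvPolynomial.optionEquivLeft A σ p using Polynomial.induction_on' with
  | add p q hp hq => rw [map_add]; exact add _ _ hp hq
  | monomial j p => rw [optionEquivLeft_symm_monomial]; exact monomial j p

/-- The normal form is only `A`-linear, so the argument runs through the ideal `K` of elements all
of whose multiples have normal form zero; it suffices to test multiples by `S ^ j q`. -/
theorem polyNormalForm_eq_zero {p : MvPolynomial (Option (Fin (s + 1))) A}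
    (hp : p ∈ unprojectionIdeal I (coordIdeal A s d) φ) : polyNormalForm hI φ p = 0 := by
  let K : Ideal (MvPolynomial (Option (Fin (s + 1))) A) :=
    { carrier := {p | ∀ q, polyNormalForm hI φ (q * p) = 0}
      add_mem' := fun h1 h2 q => by rw [mul_add, map_add, h1, h2, add_zero]
      zero_mem' := fun q => by rw [mul_zero, map_zero]
      smul_mem' := fun c p h q => by rw [smul_eq_mul, ← mul_assoc, h] }
  have hK : unprojectionIdeal I (coordIdeal A s d) φ ≤ K := by
    refine sup_le (Ideal.map_le_iff_le_comap.2 fun p hp q => ?_) (Ideal.span_le.2 ?_)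
    · induction q using option_induction with
      | add q q' h h' => rw [add_mul, map_add, h, h', add_zero]
      | monomial j q =>
        rw [mul_assoc, ← map_mul, polyNormalForm_monomial,
          Ideal.Quotient.eq_zero_iff_mem.2 (I.mul_mem_left q hp), map_zero]
    · rintro _ ⟨f, hf, g, hg, rfl⟩ q
      induction q using option_induction with
      | add q q' h h' => rw [add_mul, map_add, h, h', add_zero]
      | monomial j q =>
        have : MvPolynomial.X none ^ j * MvPolynomial.rename some q *
            (MvPolynomial.X none * MvPolynomial.rename some f - MvPolynomial.rename some g) =
            MvPolynomial.X none ^ (j + 1) * MvPolynomial.rename some (q * f) -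
              MvPolynomial.X none ^ j * MvPolynomial.rename some (q * g) := by
          rw [map_mul, map_mul]; ring
        rw [this, map_sub, polyNormalForm_monomial, polyNormalForm_monomial, map_mul _ q g, hg,
          ← smul_eq_mul (Ideal.Quotient.mk I q), ← map_smul, ← normalForm_succ_of_mem, sub_eq_zero]
        rfl
  simpa using hK hp 1

/-- The class in the unprojection of an element of the coordinate ring of `Y`. -/
noncomputable def baseMap : (MvPolynomial (Fin (s + 1)) A ⧸ I) →ₐ[A]
    (MvPolynomial (Option (Fin (s + 1))) A ⧸ unprojectionIdeal I (coordIdeal A s d) φ) :=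
  Ideal.Quotient.liftₐ I ((Ideal.Quotient.mkₐ A _).comp (MvPolynomial.rename some)) fun _ hp =>
    Ideal.Quotient.eq_zero_iff_mem.2 (Ideal.mem_sup_left (Ideal.mem_map_of_mem _ hp))

theorem mul_baseMap (f : idealIn I (coordIdeal A s d)) :
    Ideal.Quotient.mk (unprojectionIdeal I (coordIdeal A s d) φ) (MvPolynomial.X none) *
      baseMap φ f = baseMap φ (φ f) := by
  obtain ⟨p, hp, e⟩ := (Ideal.mem_map_iff_of_surjective _ Ideal.Quotient.mk_surjective).1 f.2
  obtain ⟨g, hg⟩ := Ideal.Quotient.mk_surjective (φ f)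
  rw [← e, ← hg]
  obtain rfl : ⟨Ideal.Quotient.mk I p, Ideal.mem_map_of_mem _ hp⟩ = f := Subtype.ext e
  exact Ideal.Quotient.eq.2 (Ideal.mem_sup_right (Ideal.subset_span ⟨p, hp, g, hg, rfl⟩))

/-- The class in the unprojection of a normal form. -/
noncomputable def ofNormalForm :
    (MvPolynomial (Fin (s + 1)) A ⧸ I) × (ℕ →₀ MvPolynomial (Fin (s + 1)) A ⧸ coordIdeal A s d)
      →ₗ[A] (MvPolynomial (Option (Fin (s + 1))) A ⧸ unprojectionIdeal I (coordIdeal A s d) φ) :=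
  LinearMap.coprod (baseMap φ).toLinearMap (Finsupp.lsum ℕ fun j =>
    LinearMap.mulLeft A (Ideal.Quotient.mk _ (MvPolynomial.X none ^ (j + 1))) ∘ₗ
      (baseMap φ).toLinearMap ∘ₗ (Ideal.Quotient.mkₐ A I).toLinearMap ∘ₗ
        (coordSection A s d).toLinearMap)

theorem ofNormalForm_normalForm (j : ℕ) (r : MvPolynomial (Fin (s + 1)) A ⧸ I) :
    ofNormalForm φ (normalForm hI φ j r) =
      Ideal.Quotient.mk _ (MvPolynomial.X none ^ j) * baseMap φ r := by
  induction j generalizing r with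
  | zero =>
    rw [pow_zero, map_one, one_mul]
    change ofNormalForm φ (r, 0) = _
    rw [ofNormalForm, LinearMap.coprod_apply, map_zero, add_zero]
    rfl
  | succ j ih =>
    have h : (r : MvPolynomial (Fin (s + 1)) A ⧸ I) = Ideal.Quotient.mk I (coordSection A s d
        (Ideal.Quotient.factorₐ A hI r)) + coordRemainder hI r := (add_sub_cancel _ _).symm
    have h1 : ofNormalForm φ (0, Finsupp.single j (Ideal.Quotient.factorₐ A hI r)) =
        Ideal.Quotient.mk _ (MvPolynomial.X none ^ (j + 1)) * baseMap φ (Ideal.Quotient.mk I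
          (coordSection A s d (Ideal.Quotient.factorₐ A hI r))) := by
      rw [ofNormalForm, LinearMap.coprod_apply, map_zero, zero_add]
      exact Finsupp.sum_single_index (map_zero _)
    have h2 : normalForm hI φ (j + 1) r = (0, Finsupp.single j (Ideal.Quotient.factorₐ A hI r)) +
      normalForm hI φ j (φ (coordRemainder hI r)) := rfl
    rw [h2, map_add, ih, h1]
    conv_rhs => rw [h, map_add, mul_add]
    rw [← mul_baseMap, pow_succ, map_mul, mul_assoc _ _ (baseMap φ (coordRemainder hI r :
      MvPolynomial (Fin (s + 1)) A ⧸ I))]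

/-- An unprojection of a flat family containing a constant family `D` is flat. -/
theorem flat_unprojectionIdeal (hI : I ≤ coordIdeal A s d)
    (hflat : Module.Flat A (MvPolynomial (Fin (s + 1)) A ⧸ I)) :
    Module.Flat A (MvPolynomial (Option (Fin (s + 1))) A ⧸
      unprojectionIdeal I (coordIdeal A s d) φ) := by
  have := flat_coordIdeal_quotient (A := A) (s := s) (d := d)
  have : Module.Flat A (ℕ →₀ MvPolynomial (Fin (s + 1)) A ⧸ coordIdeal A s d) := by
    classical
    exact Module.Flat.of_linearEquiv (finsuppLEquivDirectSum A _ ℕ)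
  have := flat_prod A (MvPolynomial (Fin (s + 1)) A ⧸ I)
    (ℕ →₀ MvPolynomial (Fin (s + 1)) A ⧸ coordIdeal A s d)
  let J := unprojectionIdeal I (coordIdeal A s d) φ
  -- Evaluating a normal form recovers the class it came from, so the coordinate ring of `X` is a
  -- retract of `R × (ℕ →₀ O_D)`.
  refine Module.Flat.of_retract (((J.restrictScalars A).liftQ (polyNormalForm hI φ)
    fun p hp => polyNormalForm_eq_zero hI φ hp) ∘ₗ
      (Submodule.Quotient.restrictScalarsEquiv A J).symm.toLinearMap) (ofNormalForm φ) ?_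
  refine LinearMap.ext fun q => ?_
  obtain ⟨p, rfl⟩ := Ideal.Quotient.mk_surjective q
  change ofNormalForm φ (polyNormalForm hI φ p) = Ideal.Quotient.mk J p
  induction p using option_induction with
  | add p q h h' => rw [map_add, map_add, map_add, h, h']
  | monomial j p =>
    rw [polyNormalForm_monomial, ofNormalForm_normalForm, map_mul]
    rfl

end Flat

end WeightedProj

/-! ### Local parameters on smooth curves, in algebra. -/

section SmoothCurve

/-- A standard smooth algebra of relative dimension one over a field has a local parameter at each
maximal ideal. -/
theorem RingHom.IsStandardSmoothOfRelativeDimension.exists_parameter {k A : Type u} [Field k]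
    [CommRing A] {f : k →+* A} (hf : f.IsStandardSmoothOfRelativeDimension 1)
    (m : Ideal A) [hm : m.IsMaximal] :
    ∃ u ∈ m, (∀ c, u * c = 0 → c = 0) ∧ ∀ c ∈ m, ∃ g ∉ m, ∃ c', g * c = u * c' := by
  obtain ⟨g, hg, he⟩ := hf.exists_etale_mvPolynomial
  let := f.toAlgebra
  let := g.toAlgebra
  have : Algebra.IsStandardSmooth k A := hf.isStandardSmooth
  have : Algebra.FiniteType k A := inferInstance
  have : Algebra.Etale (MvPolynomial (Fin 1) k) A := he
  have : IsScalarTower k (MvPolynomial (Fin 1) k) A := .of_algebraMap_eq' hg.symm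
  let := Ideal.Quotient.field m
  let q := m.comap g
  have hq : q.IsPrime := Ideal.IsPrime.comap g
  have : IsPrincipalIdealRing (MvPolynomial (Fin 1) k) :=
    .of_surjective (MvPolynomial.uniqueAlgEquiv k (Fin 1)).symm.toRingHom (AlgEquiv.surjective _)
  obtain ⟨t, ht⟩ := (IsPrincipalIdealRing.principal q).principal
  -- By the Nullstellensatz `A ⧸ m` is finite over `k`, so the coordinate of the affine line is
  -- algebraic there and some non-zero polynomial lies in `q`.
  have hq0 : q ≠ ⊥ := by
    intro h
    have : Module.Finite k (A ⧸ m) := finite_of_finite_type_of_isJacobsonRing k (A ⧸ m)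
    have h1 : Transcendental k (MvPolynomial.X (0 : Fin 1) : MvPolynomial (Fin 1) k) :=
      MvPolynomial.transcendental_X k 0
    obtain ⟨p, hp, hp'⟩ := (Algebra.IsIntegral.isIntegral (R := k)
      (Ideal.Quotient.mk m (g (MvPolynomial.X 0)))).isAlgebraic
    refine h1 ⟨p, hp, ?_⟩
    rw [← Ideal.mem_bot, ← h, Ideal.mem_comap, ← Ideal.Quotient.eq_zero_iff_mem]
    have h2 := Polynomial.aeval_algHom_apply ((Ideal.Quotient.mkₐ k m).comp
      (IsScalarTower.toAlgHom k (MvPolynomial (Fin 1) k) A)) (MvPolynomial.X 0) p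
    exact h2.symm.trans hp'
  have ht0 : t ≠ 0 := by
    rintro rfl
    exact hq0 (by rw [ht]; simp)
  refine ⟨g t, ?_, fun c hc => ?_, fun c hc => ?_⟩
  · change t ∈ q
    rw [ht]
    exact Submodule.mem_span_singleton_self t
  -- Étale over the affine line gives flatness, so the generator `t` of `q` stays regular in `A`.
  · have h := IsSMulRegular.of_flat (S := A) (x := t) fun x y hxy =>
      mul_left_cancel₀ ht0 hxy
    exact h (hc.trans (smul_zero _).symm)
  · have : q = m.under (MvPolynomial (Fin 1) k) := rfl
    have : m.LiesOver q := ⟨rfl⟩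
    let := Localization.AtPrime.algebraOfLiesOver q m
    -- Unramifiedness says that `q` generates the maximal ideal of the localisation at `m`.
    have := ((Algebra.isUnramifiedAt_iff_map_eq (MvPolynomial (Fin 1) k) q m).1 inferInstance).2
    have hc' := (IsLocalization.AtPrime.to_map_mem_maximal_iff (Localization.AtPrime m) m c).2 hc
    rw [← this, ht, Ideal.submodule_span_eq, Ideal.map_span, Set.image_singleton,
      IsScalarTower.algebraMap_apply _ A, ← Set.image_singleton, ← Ideal.map_span,
      IsLocalization.algebraMap_mem_map_algebraMap_iff m.primeCompl] at hc'
    obtain ⟨w, hw, h⟩ := hc'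
    obtain ⟨c', e⟩ := Ideal.mem_span_singleton.1 h
    exact ⟨w, hw, c', e⟩

/-- Up to a denominator outside `m`, a nilpotent element is `u` times another nilpotent element, `u`
being regular. Locally at `m` it therefore lies in every power of the maximal ideal, and Krull's
intersection theorem makes it zero. -/
theorem eq_zero_of_isNilpotent_of_parameters {A : Type*} [CommRing A] [IsNoetherianRing A]
    (h : ∀ (m : Ideal A) [m.IsMaximal],
      ∃ u ∈ m, (∀ c, u * c = 0 → c = 0) ∧ ∀ c ∈ m, ∃ g ∉ m, ∃ c', g * c = u * c') :
    IsReduced A := by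
  refine ⟨fun c hc => eq_zero_of_localization c fun m hm => ?_⟩
  obtain ⟨u, hu, hu0, hum⟩ := h m
  have key : ∀ n : ℕ, ∃ g ∉ m, ∃ y, IsNilpotent y ∧ g * c = u ^ n * y := by
    intro n
    induction n with
    | zero => exact ⟨1, (Ideal.ne_top_iff_one m).1 hm.ne_top, c, hc, by ring⟩
    | succ n ih =>
      obtain ⟨g, hg, y, hy, e⟩ := ih
      have hym : y ∈ m := nilpotent_iff_mem_prime.1 hy m hm.isPrime
      obtain ⟨g', hg', y', e'⟩ := hum y hym
      refine ⟨g' * g, hm.isPrime.mul_notMem hg' hg, y', ?_, ?_⟩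
      · obtain ⟨N, hN⟩ := hy
        have hinj : ∀ (i : ℕ) (z : A), u ^ i * z = 0 → z = 0 := by
          intro i
          induction i with
          | zero => intro z hz; simpa using hz
          | succ i ih => intro z hz; exact ih z (hu0 _ (by rw [← hz]; ring))
        refine ⟨N, hinj N _ ?_⟩
        rw [← mul_pow, ← e', mul_pow, hN, mul_zero]
      · linear_combination g' * e + u ^ n * e'
  have hmem : algebraMap A (Localization.AtPrime m) c ∈
      ⨅ i : ℕ, IsLocalRing.maximalIdeal (Localization.AtPrime m) ^ i := by
    refine Ideal.mem_iInf.2 fun n => ?_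
    obtain ⟨g, hg, y, -, e⟩ := key n
    have hgu := IsLocalization.map_units (Localization.AtPrime m) (⟨g, hg⟩ : m.primeCompl)
    rw [← Ideal.unit_mul_mem_iff_mem _ hgu]
    change algebraMap A _ g * _ ∈ _
    rw [← map_mul, e, map_mul, map_pow]
    refine Ideal.mul_mem_right _ _ (Ideal.pow_mem_pow ?_ n)
    exact (IsLocalization.AtPrime.to_map_mem_maximal_iff (Localization.AtPrime m) m u).2 hu
  rwa [Ideal.iInf_pow_eq_bot_of_isLocalRing _ (Ideal.IsMaximal.ne_top inferInstance),
    Ideal.mem_bot] at hmem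

/-- A local parameter generates the maximal ideal on a basic open neighbourhood. -/
theorem exists_uniform_of_parameter {A : Type*} [CommRing A] [IsNoetherianRing A] {m : Ideal A}
    [hm : m.IsPrime] {u : A} (h : ∀ c ∈ m, ∃ g ∉ m, ∃ c', g * c = u * c') :
    ∃ g ∉ m, ∀ c ∈ m, ∃ c', g * c = u * c' := by
  obtain ⟨S, hS⟩ := (isNoetherianRing_iff_ideal_fg A).1 inferInstance m
  have hmem : ∀ c : S, (c : A) ∈ m := fun c => hS ▸ Ideal.subset_span c.2
  choose g hg c' hc' using fun c : S => h c (hmem c)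
  refine ⟨∏ c, g c, fun hp => ?_, fun c hc => ?_⟩
  · obtain ⟨i, -, hi⟩ := (hm.prod_mem_iff).1 hp
    exact hg i hi
  · suffices m ≤ (Ideal.span {u}).colon ({∏ c, g c} : Set A) by
      have := Submodule.mem_colon_singleton.1 (this hc)
      obtain ⟨y, hy⟩ := Ideal.mem_span_singleton.1 this
      exact ⟨y, by rw [← hy, smul_eq_mul, mul_comm]⟩
    rw [← hS, Ideal.span_le]
    intro x hx
    refine Submodule.mem_colon_singleton.2 (Ideal.mem_span_singleton.2 ?_)
    have h1 : u ∣ g ⟨x, hx⟩ * x := ⟨_, hc' ⟨x, hx⟩⟩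
    have h2 : g ⟨x, hx⟩ ∣ ∏ c, g c := Finset.dvd_prod_of_mem g (Finset.mem_univ _)
    rw [smul_eq_mul, mul_comm]
    exact h1.trans (mul_dvd_mul_right h2 x)

theorem parameter_of_away {A B κ : Type*} [CommRing A] [CommRing B] [Algebra A B] [CommRing κ]
    {g u : A} [IsLocalization.Away g B] (hu : ∀ c, u * c = 0 → c = 0) (ev : B →+* κ)
    (hu0 : ev (algebraMap A B u) = 0)
    (h : ∀ c, ev (algebraMap A B c) = 0 → ∃ c', g * c = u * c') :
    (∀ c, algebraMap A B u * c = 0 → c = 0) ∧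
      ∀ c, ev c = 0 ↔ ∃ c', c = algebraMap A B u * c' := by
  have hg := IsLocalization.Away.algebraMap_isUnit (S := B) g
  refine ⟨fun c hc => ?_, fun c => ⟨fun hc => ?_, ?_⟩⟩
  · obtain ⟨N, c', e⟩ := IsLocalization.Away.surj g c
    have h1 : algebraMap A B (u * c') = 0 := by
      rw [map_mul, ← e, ← mul_assoc, hc, zero_mul]
    obtain ⟨⟨_, M, rfl⟩, h2⟩ := (IsLocalization.map_eq_zero_iff (Submonoid.powers g) B _).1 h1
    have h3 := hu (g ^ M * c') (by rw [← h2]; ring)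
    have h4 := congrArg (algebraMap A B) h3
    rw [map_mul, map_pow, map_zero, (hg.pow M).mul_right_eq_zero, ← e,
      (hg.pow N).mul_left_eq_zero] at h4
    exact h4
  · obtain ⟨N, c', e⟩ := IsLocalization.Away.surj g c
    obtain ⟨y, hy⟩ := h c' (by rw [← e, map_mul, hc, zero_mul])
    obtain ⟨w, hw⟩ := (hg.pow (N + 1)).exists_left_inv
    refine ⟨w * algebraMap A B y, ?_⟩
    have h1 := congrArg (algebraMap A B) hy
    rw [map_mul, map_mul, ← e] at h1
    linear_combination w * h1 - c * hw
  · rintro ⟨c', rfl⟩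
    rw [map_mul, hu0, zero_mul]

end SmoothCurve

namespace WeightedProj

/-! ### Passing to a basic open subset. -/

section Localization

variable {A B : Type*} [CommRing A] [CommRing B] [Algebra A B] (g : A) [IsLocalization.Away g B]
  {σ : Type*}

theorem exists_map_eq_pow_mul (p : MvPolynomial σ B) (n : ℕ) :
    ∃ (N : ℕ) (p' : MvPolynomial σ A), n ≤ N ∧
      MvPolynomial.map (algebraMap A B) p' = MvPolynomial.C (algebraMap A B g) ^ N * p := by
  let := MvPolynomial.algebraMvPolynomial (σ := σ) (R := A) (S := B)
  have := MvPolynomial.isLocalization (σ := σ) (Submonoid.powers g) B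
  obtain ⟨⟨p', ⟨x, y, ⟨N, rfl⟩, rfl⟩⟩, e⟩ :=
    IsLocalization.surj ((Submonoid.powers g).map (MvPolynomial.C (σ := σ))) p
  refine ⟨n + N, MvPolynomial.C g ^ n * p', Nat.le_add_right _ _, ?_⟩
  change p * MvPolynomial.map (algebraMap A B) (MvPolynomial.C (g ^ N)) =
    MvPolynomial.map (algebraMap A B) p' at e
  rw [map_mul, ← e, map_pow, MvPolynomial.map_C, MvPolynomial.map_C, pow_add, map_pow, map_pow]
  ring

theorem exists_pow_mul_mem_of_map_mem {I : Ideal (MvPolynomial σ A)} {p : MvPolynomial σ A}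
    (hp : MvPolynomial.map (algebraMap A B) p ∈ I.map (MvPolynomial.map (algebraMap A B))) :
    ∃ N : ℕ, MvPolynomial.C g ^ N * p ∈ I := by
  let := MvPolynomial.algebraMvPolynomial (σ := σ) (R := A) (S := B)
  have := MvPolynomial.isLocalization (σ := σ) (Submonoid.powers g) B
  obtain ⟨_, ⟨x, ⟨N, rfl⟩, rfl⟩, h⟩ := (IsLocalization.algebraMap_mem_map_algebraMap_iff
    ((Submonoid.powers g).map (MvPolynomial.C (σ := σ))) (MvPolynomial σ B) I p).1 hp
  refine ⟨N, ?_⟩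
  rw [← map_pow]
  exact h

theorem isUnit_C_algebraMap : IsUnit (MvPolynomial.C (σ := σ) (algebraMap A B g)) :=
  (IsLocalization.Away.algebraMap_isUnit g).map MvPolynomial.C

theorem exists_pow_mul_mem {I : Ideal (MvPolynomial σ A)} {n : ℕ} {f : ℕ → MvPolynomial σ A}
    (hf : ∀ j < n, ∃ N : ℕ, MvPolynomial.C g ^ N * f j ∈ I) :
    ∃ N : ℕ, ∀ j < n, MvPolynomial.C g ^ N * f j ∈ I := by
  choose! N hN using hf
  refine ⟨∑ j ∈ Finset.range n, N j, fun j hj => ?_⟩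
  obtain ⟨m, hm⟩ := Nat.exists_eq_add_of_le
    (Finset.single_le_sum (f := N) (fun i _ => Nat.zero_le _) (Finset.mem_range.2 hj))
  rw [hm, pow_add, mul_assoc, mul_left_comm]
  exact I.mul_mem_left _ (hN j hj)

end Localization

section LocalizationTuple

variable {A B : Type u} [CommRing A] [CommRing B] [Algebra A B] {g : A} [IsLocalization.Away g B]
  {s d b : ℕ} {a : Fin (s + 1) → ℕ} {I : Ideal (MvPolynomial (Fin (s + 1)) A)}
  {r : ℕ → MvPolynomial (Fin (s + 1)) A}

/-- Data over the localisation are multiplied by a power of `g` to come from `A`; the properties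
there hold up to a factor `g`, which is now a unit. -/
theorem IsUnprojectionTuple.of_away (hr : ∀ j < s - d, IsHomog a (r j) (coordWt d a j + b))
    (hcompat : IsCompatible I (coordVar A s d) (s - d) r)
    (hcol : ∀ f, (∀ j < s - d, coordVar A s d j * f ∈ I) → MvPolynomial.C g * f ∈ I)
    (hgen : ∀ q, IsCompatible I (coordVar A s d) (s - d) q → ∃ p z, ∀ j < s - d,
      MvPolynomial.C g * q j - (p * coordVar A s d j + z * r j) ∈ I) :
    IsUnprojectionTuple a d (I.map (MvPolynomial.map (algebraMap A B))) b
      fun j => MvPolynomial.map (algebraMap A B) (r j) := by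
  have hu : IsUnit (MvPolynomial.C (σ := Fin (s + 1)) (algebraMap A B g)) :=
    isUnit_C_algebraMap g
  have hC : ∀ (N : ℕ), MvPolynomial.map (algebraMap A B) (MvPolynomial.C (σ := Fin (s + 1)) g ^ N) =
      MvPolynomial.C (algebraMap A B g) ^ N := fun N => by rw [map_pow, MvPolynomial.map_C]
  refine ⟨fun j hj => (hr j hj).map _, fun i hi j hj => ?_, fun f hf => ?_, fun q hq => ?_⟩
  · convert! Ideal.mem_map_of_mem (MvPolynomial.map (algebraMap A B)) (hcompat i hi j hj) using 1
    rw [map_sub, map_mul, map_mul, map_coordVar, map_coordVar]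
  · obtain ⟨N, f', -, hf'⟩ := exists_map_eq_pow_mul g f 0
    obtain ⟨M, hM⟩ := exists_pow_mul_mem g (I := I) (n := s - d)
      (f := fun j => coordVar A s d j * f') fun j hj => exists_pow_mul_mem_of_map_mem (B := B) g (by
        rw [map_mul, hf', map_coordVar, mul_left_comm]
        exact Ideal.mul_mem_left _ _ (hf j hj))
    have h1 := hcol (MvPolynomial.C g ^ M * f') fun j hj => by
      rw [mul_left_comm]; exact hM j hj
    have h2 := Ideal.mem_map_of_mem (MvPolynomial.map (algebraMap A B)) h1
    rw [← mul_assoc, ← pow_succ', map_mul, hf', hC, ← mul_assoc, ← pow_add] at h2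
    exact (Ideal.unit_mul_mem_iff_mem _ (hu.pow _)).1 h2
  · have h1 : ∃ (N : ℕ) (q' : ℕ → MvPolynomial (Fin (s + 1)) A), ∀ j < s - d,
        MvPolynomial.map (algebraMap A B) (q' j) = MvPolynomial.C (algebraMap A B g) ^ N * q j := by
      choose N q' hN hq' using fun j => exists_map_eq_pow_mul g (q j) 0
      refine ⟨∑ j ∈ Finset.range (s - d), N j, fun j =>
        MvPolynomial.C g ^ ((∑ j ∈ Finset.range (s - d), N j) - N j) * q' j, fun j hj => ?_⟩
      rw [map_mul, hC, hq', ← mul_assoc, ← pow_add, Nat.sub_add_cancel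
        (Finset.single_le_sum (f := N) (fun i _ => Nat.zero_le _) (Finset.mem_range.2 hj))]
    obtain ⟨N, q', hq'⟩ := h1
    have h2 : ∀ i < s - d, ∃ M : ℕ, ∀ j < s - d, MvPolynomial.C g ^ M *
        (coordVar A s d i * q' j - coordVar A s d j * q' i) ∈ I := fun i hi =>
      exists_pow_mul_mem g fun j hj => exists_pow_mul_mem_of_map_mem (B := B) g (by
        rw [map_sub, map_mul, map_mul, hq' i hi, hq' j hj, map_coordVar, map_coordVar,
          mul_left_comm, mul_left_comm (coordVar B s d j), ← mul_sub]
        exact Ideal.mul_mem_left _ _ (hq i hi j hj))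
    choose! M hM using h2
    have hM' : ∀ i < s - d, ∀ j < s - d, MvPolynomial.C g ^ (∑ i ∈ Finset.range (s - d), M i) *
        (coordVar A s d i * q' j - coordVar A s d j * q' i) ∈ I := fun i hi j hj => by
      obtain ⟨m, hm⟩ := Nat.exists_eq_add_of_le
        (Finset.single_le_sum (f := M) (fun i _ => Nat.zero_le _) (Finset.mem_range.2 hi))
      rw [hm, pow_add, mul_assoc, mul_left_comm]
      exact I.mul_mem_left _ (hM i hi j hj)
    set L := ∑ i ∈ Finset.range (s - d), M i
    obtain ⟨p, z, hpz⟩ := hgen (fun j => MvPolynomial.C g ^ L * q' j) fun i hi j hj => by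
      rw [mul_left_comm, mul_left_comm (coordVar A s d j), ← mul_sub]
      exact hM' i hi j hj
    obtain ⟨w, hw⟩ := (hu.pow (1 + L + N)).exists_left_inv
    refine ⟨w * MvPolynomial.map (algebraMap A B) p, w * MvPolynomial.map (algebraMap A B) z,
      fun j hj => ?_⟩
    have h3 := Ideal.mul_mem_left _ w
      (Ideal.mem_map_of_mem (MvPolynomial.map (algebraMap A B)) (hpz j hj))
    convert! h3 using 1
    rw [map_sub, map_mul, map_mul, hC, hq' j hj, map_add, map_mul, map_mul, map_coordVar,
      MvPolynomial.map_C]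
    linear_combination -q j * hw

end LocalizationTuple

end WeightedProj

/-! ### Smooth curves as schemes: reducedness, closed points, parameters. -/

section SmoothCurveScheme

variable {k : Type u} [Field k] {T : Scheme.{u}} (π : T ⟶ Spec (CommRingCat.of k))

theorem exists_isStandardSmooth_field [SmoothOfRelativeDimension 1 π] (t : T) :
    ∃ (V : T.affineOpens) (f : k →+* Γ(T, V)), t ∈ V.1 ∧
      f.IsStandardSmoothOfRelativeDimension 1 := by
  obtain ⟨U, hU, V, hV, ht, e, hf⟩ :=
    SmoothOfRelativeDimension.exists_isStandardSmoothOfRelativeDimension (n := 1) (f := π) t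
  -- The spectrum of a field has one point, so the open subset containing the image of `t` is
  -- everything.
  have hU' : U = ⊤ := by
    refine top_le_iff.1 fun x _ => ?_
    rw [Subsingleton.elim x (π t)]
    exact e ht
  subst hU'
  refine ⟨⟨V, hV⟩, ((π.appLE ⊤ V e).hom).comp
    (Scheme.ΓSpecIso (.of k)).symm.commRingCatIsoToRingEquiv.toRingHom, ht, ?_⟩
  exact RingHom.isStandardSmoothOfRelativeDimension_respectsIso.2 _ _ hf

theorem isLocallyNoetherian_of_smooth_field [SmoothOfRelativeDimension 1 π] :
    IsLocallyNoetherian T := by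
  have := SmoothOfRelativeDimension.smooth 1 π
  exact LocallyOfFiniteType.isLocallyNoetherian π

theorem jacobsonSpace_of_smooth_field [SmoothOfRelativeDimension 1 π] : JacobsonSpace T := by
  have := SmoothOfRelativeDimension.smooth 1 π
  exact LocallyOfFiniteType.jacobsonSpace π

theorem isReduced_of_smooth_field [SmoothOfRelativeDimension 1 π] : IsReduced T := by
  have := isLocallyNoetherian_of_smooth_field π
  refine @isReduced_of_isReduced_stalk T fun t => ?_
  obtain ⟨V, f, ht, hf⟩ := exists_isStandardSmooth_field π t
  have : IsNoetherianRing Γ(T, V) := IsLocallyNoetherian.component_noetherian V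
  have : _root_.IsReduced Γ(T, V) :=
    eq_zero_of_isNilpotent_of_parameters fun m _ => hf.exists_parameter m
  let := (T.presheaf.germ V.1 t ht).hom.toAlgebra
  have : IsLocalization.AtPrime (T.presheaf.stalk t) (V.2.primeIdealOf ⟨t, ht⟩).asIdeal :=
    V.2.isLocalization_stalk ⟨t, ht⟩
  exact isReduced_localizationPreserves (V.2.primeIdealOf ⟨t, ht⟩).asIdeal.primeCompl _ inferInstance

variable (V : T.affineOpens) {t : T} (ht : t ∈ V.1)

theorem evaluation_eq_zero_iff (c : Γ(T, V)) :
    T.evaluation V.1 t ht c = 0 ↔ c ∈ (V.2.primeIdealOf ⟨t, ht⟩).asIdeal := by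
  let := (T.presheaf.germ V.1 t ht).hom.toAlgebra
  have : IsLocalization.AtPrime (T.presheaf.stalk t) (V.2.primeIdealOf ⟨t, ht⟩).asIdeal :=
    V.2.isLocalization_stalk ⟨t, ht⟩
  rw [← IsLocalization.AtPrime.to_map_mem_maximal_iff (T.presheaf.stalk t)
    (V.2.primeIdealOf ⟨t, ht⟩).asIdeal]
  exact IsLocalRing.residue_eq_zero_iff _

theorem evaluation_surjective (hc : IsClosed ({t} : Set T)) :
    Function.Surjective (T.evaluation V.1 t ht) := by
  let := (T.presheaf.germ V.1 t ht).hom.toAlgebra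
  have : IsLocalization.AtPrime (T.presheaf.stalk t) (V.2.primeIdealOf ⟨t, ht⟩).asIdeal :=
    V.2.isLocalization_stalk ⟨t, ht⟩
  have := V.2.primeIdealOf_isMaximal_of_isClosed ⟨t, ht⟩ hc
  intro y
  obtain ⟨z, hz⟩ := (IsLocalization.AtPrime.equivQuotMaximalIdeal
    (V.2.primeIdealOf ⟨t, ht⟩).asIdeal (T.presheaf.stalk t)).surjective y
  obtain ⟨c, rfl⟩ := Ideal.Quotient.mk_surjective z
  exact ⟨c, hz⟩

theorem evaluation_restrict (g : Γ(T, V)) (hg : t ∈ T.basicOpen g) :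
    (T.evaluation (T.basicOpen g) t hg).hom.comp
      (T.presheaf.map (CategoryTheory.homOfLE (T.basicOpen_le g)).op).hom =
      (T.evaluation V.1 t (T.basicOpen_le g hg)).hom := by
  rw [← CommRingCat.hom_comp, Scheme.evaluation, Scheme.evaluation,
    TopCat.Presheaf.germ_res_assoc]

/-- A closed point of a smooth curve has an affine neighbourhood on which its ideal is generated by
a regular element. -/
theorem exists_affine_parameter [SmoothOfRelativeDimension 1 π] (hc : IsClosed ({t} : Set T)) :
    ∃ (V : T.affineOpens) (ht : t ∈ V.1) (u : Γ(T, V)), (∀ c, u * c = 0 → c = 0) ∧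
      ∀ c, (T.evaluation V.1 t ht).hom c = 0 ↔ ∃ c', c = u * c' := by
  have := isLocallyNoetherian_of_smooth_field π
  obtain ⟨V, f, ht, hf⟩ := exists_isStandardSmooth_field π t
  have : IsNoetherianRing Γ(T, V) := IsLocallyNoetherian.component_noetherian V
  have := V.2.primeIdealOf_isMaximal_of_isClosed ⟨t, ht⟩ hc
  obtain ⟨u, hu, hu0, hum⟩ := hf.exists_parameter (V.2.primeIdealOf ⟨t, ht⟩).asIdeal
  obtain ⟨g, hg, hgu⟩ := exists_uniform_of_parameter hum
  have htg : t ∈ T.basicOpen g := by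
    rw [← Scheme.evaluation_ne_zero_iff_mem_basicOpen _ _ ht, Ne, evaluation_eq_zero_iff]
    exact hg
  have hloc := V.2.isLocalization_basicOpen g
  have hev : ∀ c, T.evaluation (T.basicOpen g) t htg (algebraMap Γ(T, V) Γ(T, T.basicOpen g) c) =
    T.evaluation V.1 t ht c := fun c => DFunLike.congr_fun (evaluation_restrict V g htg) c
  obtain ⟨h1, h2⟩ := parameter_of_away (g := g) hu0 (T.evaluation (T.basicOpen g) t htg).hom
    ((hev u).trans ((evaluation_eq_zero_iff V ht u).2 hu)) fun c hc =>
      hgu c ((evaluation_eq_zero_iff V ht c).1 ((hev c).symm.trans hc))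
  exact ⟨T.affineBasicOpen g, htg, algebraMap Γ(T, V) Γ(T, T.basicOpen g) u, h1, h2⟩

/-- On a reduced scheme a non-zero section has a non-empty basic open set, which contains a closed
point by the Jacobson property. -/
theorem eq_zero_of_evaluation_eq_zero [IsReduced T] [JacobsonSpace T] {U : T.Opens} {c : Γ(T, U)}
    (h : ∀ t (ht : t ∈ U), IsClosed ({t} : Set T) → T.evaluation U t ht c = 0) : c = 0 := by
  rw [← basicOpen_eq_bot_iff]
  by_contra hne
  obtain ⟨t, ht, hc⟩ := jacobsonSpace_iff_locallyClosed.1 inferInstance (T.basicOpen c : Set T)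
    (TopologicalSpace.Opens.nonempty_coeSort.1 (not_isEmpty_iff.1 fun he => hne (by
      exact TopologicalSpace.Opens.ext (Set.isEmpty_coe_sort.1 he)))) (T.basicOpen c).2.isLocallyClosed
  exact (Scheme.evaluation_ne_zero_iff_mem_basicOpen _ _ (T.basicOpen_le c ht) _).2 ht
    (h t _ hc)

end SmoothCurveScheme

namespace WeightedProj

/-! ### Families over the curve and their fibres. -/

section Family

variable {T : Scheme.{u}} {σ : Type v} {a : σ → ℕ} (Z : Family T a)

theorem Family.map_evaluation_basicOpen (U : T.affineOpens) (g : Γ(T, U)) {t : T}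
    (hg : t ∈ T.basicOpen g) :
    (Z.ideal (T.affineBasicOpen g)).map (MvPolynomial.map (T.evaluation (T.basicOpen g) t hg).hom) =
      (Z.ideal U).map (MvPolynomial.map (T.evaluation U.1 t (T.basicOpen_le g hg)).hom) := by
  have e := congrArg (Ideal.map (MvPolynomial.map (σ := σ)
    (T.evaluation (T.basicOpen g) t hg).hom)) (Z.map_ideal_basicOpen U g)
  refine e.symm.trans ((Ideal.map_map _ _).trans ?_)
  rw [← evaluation_restrict U g hg]
  congr 1
  exact RingHom.ext fun p => MvPolynomial.map_map _ _ p

theorem Family.map_evaluation_congr {U V : T.affineOpens} (h : U = V) {t : T} (hU : t ∈ U.1)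
    (hV : t ∈ V.1) : (Z.ideal U).map (MvPolynomial.map (T.evaluation U.1 t hU).hom) =
      (Z.ideal V).map (MvPolynomial.map (T.evaluation V.1 t hV).hom) := by
  subst h; rfl

/-- Two affine neighbourhoods of `t` share a neighbourhood that is basic open in both, and
restriction to it does not change the ideal of the fibre. -/
theorem Family.fibreIdeal_eq (V : T.affineOpens) {t : T} (ht : t ∈ V.1) :
    Z.fibreIdeal t = (Z.ideal V).map (MvPolynomial.map (T.evaluation V.1 t ht).hom) := by
  refine le_antisymm (iSup₂_le fun U hU => ?_) (le_iSup₂_of_le V ht le_rfl)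
  obtain ⟨f, g, hfg, hx⟩ := exists_basicOpen_le_affine_inter U.2 V.2 t ⟨hU, ht⟩
  have hx' : t ∈ T.basicOpen g := hfg ▸ hx
  rw [← Z.map_evaluation_basicOpen U f hx, ← Z.map_evaluation_basicOpen V g hx']
  exact (Z.map_evaluation_congr (Subtype.ext hfg) hx hx').le

theorem map_restrictCoord {A B : Type u} [CommRing A] [CommRing B] (ρ : A →+* B) (s d : ℕ)
    (p : MvPolynomial (Fin (s + 1)) A) :
    MvPolynomial.map ρ (restrictCoord A s d p) = restrictCoord B s d (MvPolynomial.map ρ p) := by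
  refine (MvPolynomial.map_eval₂ ρ _ p).trans ?_
  change _ = MvPolynomial.eval₂ MvPolynomial.C _ _
  congr 1
  funext i
  rw [Function.comp_apply]
  split_ifs
  · exact map_zero _
  · exact MvPolynomial.map_X _ _

/-- After restriction to `D` the coefficients of `p` vanish at every closed point, hence are zero.
-/
theorem Family.ideal_le_coordIdeal [IsReduced T] [JacobsonSpace T] {s d : ℕ}
    {a : Fin (s + 1) → ℕ} {Y : Family T a}
    (hD : ∀ t : T, IsClosed ({t} : Set T) →
      Y.fibreIdeal t ≤ coordIdeal (T.residueField t) s d) (U : T.affineOpens) :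
    Y.ideal U ≤ coordIdeal Γ(T, U) s d := by
  intro p hp
  rw [coordIdeal_mem_iff_restrictCoord]
  ext e
  rw [MvPolynomial.coeff_zero]
  refine eq_zero_of_evaluation_eq_zero fun t ht hc => ?_
  have h1 := hD t hc
  rw [Y.fibreIdeal_eq U ht] at h1
  have h2 := restrictCoord_eq_zero (h1 (Ideal.mem_map_of_mem _ hp))
  rw [← map_restrictCoord] at h2
  have h4 := congrArg (MvPolynomial.coeff e) h2
  rwa [MvPolynomial.coeff_map, MvPolynomial.coeff_zero] at h4

theorem mem_of_C_mul_mem_of_flat {A : Type*} [CommRing A] {I : Ideal (MvPolynomial σ A)}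
    [Module.Flat A (MvPolynomial σ A ⧸ I)] {u : A} (hu : ∀ c, u * c = 0 → c = 0)
    {p : MvPolynomial σ A} (hp : MvPolynomial.C u * p ∈ I) : p ∈ I := by
  have h1 : IsSMulRegular A u := fun x y hxy =>
    sub_eq_zero.1 (hu _ (by rw [mul_sub, sub_eq_zero]; exact hxy))
  have h2 := IsSMulRegular.of_flat (S := MvPolynomial σ A ⧸ I) h1
  rw [← Ideal.Quotient.eq_zero_iff_mem] at hp ⊢
  rw [map_mul] at hp
  exact h2 (hp.trans (smul_zero _).symm)

/-- Near a closed point of a smooth curve, the unprojection homomorphism of the fibre lifts to a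
generator of the homomorphisms. -/
theorem Family.exists_isUnprojectionTuple {k : Type u} [Field k]
    (π : T ⟶ Spec (CommRingCat.of k)) [SmoothOfRelativeDimension 1 π] {s d b : ℕ} (hds : d + 2 ≤ s) {a : Fin (s + 1) → ℕ}
    (ha : ∀ i, 0 < a i) {Y : Family T a} (hflat : Y.IsFlat) {kY : ℤ} {t : T}
    (hc : IsClosed ({t} : Set T)) (hGor : IsProjGorenstein a (Y.fibreIdeal t) kY)
    (hdim : ringKrullDim (MvPolynomial (Fin (s + 1)) (T.residueField t) ⧸ Y.fibreIdeal t) =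
      ((d + 2 : ℕ) : WithBot ℕ∞))
    (hD : ∀ U : T.affineOpens, Y.ideal U ≤ coordIdeal Γ(T, U) s d)
    (hbk : (b : ℤ) = kY -
      (-∑ i ∈ Finset.univ.filter (fun i : Fin (s + 1) => (i : ℕ) ≤ d), (a i : ℤ))) :
    ∃ (V : T.affineOpens) (ht : t ∈ V.1) (r : ℕ → MvPolynomial (Fin (s + 1)) Γ(T, V)),
      IsUnprojectionTuple a d (Y.ideal V) b r ∧
      IsUnprojectionTuple a d
        ((Y.ideal V).map (MvPolynomial.map (T.evaluation V.1 t ht).hom)) b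
        fun j => MvPolynomial.map (T.evaluation V.1 t ht).hom (r j) := by
  have := isLocallyNoetherian_of_smooth_field π
  obtain ⟨V, ht, u, hu, hker⟩ := exists_affine_parameter π hc
  have : IsNoetherianRing Γ(T, V) := IsLocallyNoetherian.component_noetherian V
  have := hflat V
  rw [Y.fibreIdeal_eq V ht] at hGor hdim
  obtain ⟨g, r, hg, hr, hcompat, hcol, hgen, hκ⟩ := exists_unprojection_tuple ha hds
    (evaluation_surjective V ht hc) hu hker (Y.homog V)
    (fun p hp => mem_of_C_mul_mem_of_flat hu hp) (hD V) hGor hdim hbk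
  have htg : t ∈ T.basicOpen g := (Scheme.evaluation_ne_zero_iff_mem_basicOpen _ _ ht _).1 hg
  have hloc := V.2.isLocalization_basicOpen g
  have h1 := IsUnprojectionTuple.of_away (B := Γ(T, T.basicOpen g)) hr hcompat hcol hgen
  refine ⟨T.affineBasicOpen g, htg,
    fun j => MvPolynomial.map (algebraMap Γ(T, V) Γ(T, T.basicOpen g)) (r j), ?_, ?_⟩
  · have e := Y.map_ideal_basicOpen V g
    exact e ▸ h1
  · have e := Y.map_evaluation_basicOpen V g htg
    have e' : (fun j => MvPolynomial.map (T.evaluation (T.basicOpen g) t htg).hom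
        (MvPolynomial.map (algebraMap Γ(T, V) Γ(T, T.basicOpen g)) (r j))) =
        fun j => MvPolynomial.map (T.evaluation V.1 t ht).hom (r j) := by
      funext j
      rw [MvPolynomial.map_map]
      exact congrArg (fun ρ => MvPolynomial.map ρ (r j)) (evaluation_restrict V g htg)
    have h2 := hκ
    rw [← e, ← e'] at h2
    exact h2

end Family

end WeightedProj

theorem mainTheorem6 {k : Type u} [Field k] (T : Scheme.{u})
    (π : T ⟶ Spec (CommRingCat.of k)) [SmoothOfRelativeDimension 1 π]
    (s d : ℕ) (hds : d + 2 ≤ s) (a : Fin (s + 1) → ℕ) (ha : ∀ i, 0 < a i)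
    (Y : WeightedProj.Family T a) (hflat : Y.IsFlat) (kY : ℤ)
    (hGor : ∀ t : T, IsClosed ({t} : Set T) → WeightedProj.IsProjGorenstein a (Y.fibreIdeal t) kY)
    (hdim : ∀ t : T, IsClosed ({t} : Set T) →
      ringKrullDim (MvPolynomial (Fin (s + 1)) (T.residueField t) ⧸ Y.fibreIdeal t) =
        ((d + 2 : ℕ) : WithBot ℕ∞))
    (hD : ∀ t : T, IsClosed ({t} : Set T) →
      Y.fibreIdeal t ≤ WeightedProj.coordIdeal (T.residueField t) s d)
    (b : ℕ) (hb : 0 < b)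
    (hbk : (b : ℤ) = kY - (-∑ i ∈ Finset.univ.filter (fun i : Fin (s + 1) => (i : ℕ) ≤ d), (a i : ℤ))) :
    (∀ t : T, IsClosed ({t} : Set T) → ∃ U : T.affineOpens, t ∈ U.1 ∧
      ∃ J, WeightedProj.IsUnprojection a (Y.ideal U)
        (WeightedProj.coordIdeal Γ(T, U) s d) b J) ∧
    ∀ X : WeightedProj.Family T (WeightedProj.extendWeights a b),
      (∀ U : T.affineOpens, WeightedProj.IsUnprojection a (Y.ideal U)
        (WeightedProj.coordIdeal Γ(T, U) s d) b (X.ideal U)) →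
      X.IsFlat ∧
      ∀ t : T, IsClosed ({t} : Set T) →
        WeightedProj.IsUnprojection a (Y.fibreIdeal t)
          (WeightedProj.coordIdeal (T.residueField t) s d) b (X.fibreIdeal t) := by
  have := isReduced_of_smooth_field π
  have := jacobsonSpace_of_smooth_field π
  have hI := fun U => WeightedProj.Family.ideal_le_coordIdeal hD U
  have key := fun (t : T) (hc : IsClosed ({t} : Set T)) =>
    WeightedProj.Family.exists_isUnprojectionTuple π hds ha hflat hc (hGor t hc) (hdim t hc) hI hbk
  refine ⟨fun t hc => ?_, fun X hX => ⟨fun U => ?_, fun t hc => ?_⟩⟩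
  · obtain ⟨V, ht, r, hr, -⟩ := key t hc
    obtain ⟨φ, hφ, -⟩ := hr.exists_isUnprojectionHom (hI V)
    exact ⟨V, ht, _, φ, hφ, rfl⟩
  · obtain ⟨φ, -, e⟩ := hX U
    rw [e]
    exact WeightedProj.flat_unprojectionIdeal φ (hI U) (hflat U)
  -- The fibre is computed on the neighbourhood `V` from `key`, where the given generator can be
  -- compared with the tuple lifted from the fibre.
  · obtain ⟨V, ht, r, hr, hr'⟩ := key t hc
    obtain ⟨φ, hφ, e⟩ := hX V
    rw [Y.fibreIdeal_eq V ht, X.fibreIdeal_eq V ht, e]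
    exact hφ.isUnprojection_map (hI V) hr hr'
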